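/- \textbf{Setting.} Let $\mathfrak g$ be a finite-dimensional real Lie algebra of compact type (negative definite Killing form $K$), and let $\mathfrak g=\mathfrak m\oplus\mathfrak h$, $\mathfrak m\neq 0$, be a Hermitian symmetric Lie algebra: $[\mathfrak h,\mathfrak h]\subseteq\mathfrak h$, $[\mathfrak h,\mathfrak m]\subseteq\mathfrak m$, $[\mathfrak m,\mathfrak m]\subseteq\mathfrak h$, with an element $A\in\mathfrak h$ whose centralizer in $\mathfrak g$ is $\mathfrak h$ and for which $J=\mathrm{ad}(A)$ satisfies $J^2=-1$ on $\mathfrak m$. Use the inner product $-K$ on $\mathfrak g$ and put $a=|A|^2=\dim\mathfrak m$. Let $G$ be the adjoint group (the identity component of $\mathrm{Aut}(\mathfrak g)$), $H\subset G$ the stabilizer of $A$, and identify the Hermitian symmetric space $M=G/H$ with the orbit $\mathrm{Ad}(G)A\subset\mathfrak g$. The flat space $\mathrm{Aff}(G,H)=(G\rtimes\mathfrak g)/G$ is identified with $\mathfrak g$. Let $I\subseteq\mathbb R$ be an open interval; fields are functions of $(x,t)\in\mathbb R\times I$, and all fields are smooth. Let $n\ge 0$. \textbf{The three hierarchies.}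 \begin{itemize} \item For $q$ with values in $\mathfrak m$, let $\mathcal H=D_x-\mathrm{ad}(q)D_x^{-1}\mathrm{ad}(q)$ and $\mathcal R=\mathcal HJ^{-1}$. The $+m$ isospectral flow is $\frac1a q_t=\mathcal R^m(Jq)$. \item For $\chi$ with values in $M$, let $J_\chi=\mathrm{ad}(\chi)$, $\nabla_x=-J_\chi^2D_x$ (the Levi-Civita derivative of $M$), $\nabla^{\mathfrak h}_x=(1+J_\chi^2)D_x$, and $\mathcal R_\chi=-J_\chi\big(\nabla_x-\mathrm{ad}(\chi_x)(\nabla_x^{\mathfrak h})^{-1}\mathrm{ad}(\chi_x)\big)$. The $+n$ map equation is $\chi_t=\mathcal R_\chi^n(\chi_x)$. \item For $T$ with values in $a^{-1/2}\,\mathrm{Ad}(G)A$, let $\nabla_x^{\mathfrak h}=(1+a\,\mathrm{ad}(T)^2)D_x$ and $\mathcal R_T=\mathrm{ad}(T)^{-1}\big(D_x-a\,\mathrm{ad}(T_x)(\nabla_x^{\mathfrak h})^{-1}\mathrm{ad}(T_x)\big)$, where $\mathrm{ad}(T)^{-1}$ is extended by $0$ to $\ker\mathrm{ad}(T)$. The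 $+k$ spin model is $T_t=\mathcal R_T^k(T_x)$, $|T|=1$. \end{itemize} Here $D_x^{-1}F$ denotes the local primitive of $F$ (its value at $x$ depends on finitely many $x$-derivatives of $q$ at $x$) that vanishes for $q=0$. Likewise $(\nabla_x^{\mathfrak h})^{-1}F$ denotes the local solution $P$ of $\nabla_x^{\mathfrak h}P=F$ that lies in $\ker\mathrm{ad}(\chi)$ (respectively $\ker\mathrm{ad}(T)$) and vanishes on constant curves. \textbf{Hasimoto variables.} A parallel frame for $\chi:\mathbb R\times I\to M$ is a smooth $\psi:\mathbb R\times I\to G$ with $\mathrm{Ad}(\psi)A=\chi$ and $\psi^{-1}\partial_x\psi\in\mathfrak m$; then $q=\psi^{-1}\partial_x\psi$ is a Hasimoto variable of $\chi$. It is unaffected by replacing $\chi,\psi$ by $g(t)\chi,\ g(t)\psi$ with $g:I\to G$, and replacing $\psi$ by $\psi h(t)$ with $h:I\to H$ replaces $q$ by $\mathrm{Ad}(h(t)^{-1})q$. \textbf{Theorem.} \begin{enumerate} \item All the inverses $D_x^{-1}$ and $(\nabla^{\mathfrak h}_x)^{-1}$ that occur in $\mathcal R^k(Jq)$, $\mathcal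 R_\chi^k(\chi_x)$ and $\mathcal R_T^k(T_x)$, $k\ge 0$, exist and are unique. \item Every smooth $\chi:\mathbb R\times I\to M$ has a parallel frame and a Hasimoto variable, and every smooth $q:\mathbb R\times I\to\mathfrak m$ is the Hasimoto variable of some $\chi$. \item If $q$ is a Hasimoto variable of $\chi$, then the following are equivalent: (a) for some smooth $g:I\to G$ the map $g(t)\chi$ solves the $+n$ map equation; (b) for some smooth $h:I\to H$ the function $\mathrm{Ad}(h(t)^{-1})q$ solves the $+(n+1)$ isospectral flow after rescaling time, $t\mapsto a t$. In particular every solution $\chi$ has a Hasimoto variable that solves the $+(n+1)$ flow, and every solution $q$ is the Hasimoto variable of a solution $\chi$. \item If, for each $t$, $q$ and all its $x$-derivatives and $\partial_t\psi$ tend to $0$ as $x\to-\infty$, then $\chi$ solves the $+n$ map equation if and only if $q(x,at)$ solves the $+(n+1)$ isospectral flow. \item $\chi$ solves the $+n$ map equation if and only if $T(x,t)=a^{-1/2}\chi(x,a^{n/2}t)$ solves the $+n$ spin model. \end{enumerate} -/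

import Mathlib

open Set Filter Topology
open scoped ContDiff

namespace HermSym

/-- A real Lie algebra is of compact (semisimple) type: its Killing form is negative definite. -/
class IsCompactType (𝔤 : Type*) [LieRing 𝔤] [LieAlgebra ℝ 𝔤] : Prop where
  killing_neg : ∀ x : 𝔤, x ≠ 0 → killingForm ℝ 𝔤 x x < 0

noncomputable section Norm

variable (𝔤 : Type*) [LieRing 𝔤] [LieAlgebra ℝ 𝔤] [IsCompactType 𝔤]

/-- The `ad`-invariant inner product `⟨a, b⟩ = - Kill(a, b)`. -/
@[reducible] def killingCore : InnerProductSpace.Core ℝ 𝔤 where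
  inner a b := -killingForm ℝ 𝔤 a b
  conj_inner_symm a b := by
    simp [LieModule.traceForm_comm ℝ 𝔤 𝔤 a b]
  re_inner_nonneg a := by
    by_cases h : a = 0
    · simp [h]
    · have := IsCompactType.killing_neg a h
      simpa using this.le
  add_left a b c := by simp; ring
  smul_left a b r := by simp
  definite a h := by
    by_contra hne
    have := IsCompactType.killing_neg a hne
    linarith

instance (priority := 50) killingNormedAddCommGroup : NormedAddCommGroup 𝔤 :=
  @InnerProductSpace.Core.toNormedAddCommGroup ℝ 𝔤 _ _ _ (killingCore 𝔤)

instance (priority := 50) killingInnerProductSpace : InnerProductSpace ℝ 𝔤 :=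
  @InnerProductSpace.ofCore ℝ 𝔤 _ _ _ (killingCore 𝔤).toCore

end Norm

section Algebra

variable {𝔤 : Type*} [LieRing 𝔤] [LieAlgebra ℝ 𝔤]

/-- A Hermitian symmetric Lie algebra `𝔤 = 𝔪 ⊕ 𝔥` with Hermitian structure `A ∈ 𝔥`. -/
structure IsHermitianSymmetric (𝔥 : LieSubalgebra ℝ 𝔤) (𝔪 : Submodule ℝ 𝔤) (A : 𝔤) : Prop where
  isCompl : IsCompl 𝔥.toSubmodule 𝔪
  lie_h_m : ∀ a ∈ 𝔥, ∀ y ∈ 𝔪, ⁅a, y⁆ ∈ 𝔪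
  lie_m_m : ∀ y ∈ 𝔪, ∀ z ∈ 𝔪, ⁅y, z⁆ ∈ 𝔥
  mem : A ∈ 𝔥
  centralizer : ∀ y : 𝔤, ⁅A, y⁆ = 0 ↔ y ∈ 𝔥
  sq : ∀ y ∈ 𝔪, ⁅A, ⁅A, y⁆⁆ = -y

end Algebra

/-- The automorphism group `Aut 𝔤`, with composition as multiplication. -/
instance autGroup (𝔤 : Type*) [LieRing 𝔤] [LieAlgebra ℝ 𝔤] : Group (𝔤 ≃ₗ⁅ℝ⁆ 𝔤) where
  __ := (inferInstance : One (𝔤 ≃ₗ⁅ℝ⁆ 𝔤))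
  mul φ₁ φ₂ := φ₂.trans φ₁
  inv φ := φ.symm
  mul_assoc _ _ _ := rfl
  one_mul _ := rfl
  mul_one _ := rfl
  inv_mul_cancel φ := by
    apply LieEquiv.ext
    intro y
    exact φ.symm_apply_apply y

section Group

variable (𝔤 : Type*) [LieRing 𝔤] [LieAlgebra ℝ 𝔤] [FiniteDimensional ℝ 𝔤] [IsCompactType 𝔤]

/-- The adjoint group `G = Ad(G)` of `𝔤`: the identity (path) component of `Aut 𝔤`. -/
def adjointGroup : Subgroup (𝔤 ≃ₗ⁅ℝ⁆ 𝔤) where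
  carrier := {φ | ∃ p : ℝ → (𝔤 ≃ₗ⁅ℝ⁆ 𝔤), (∀ y : 𝔤, Continuous fun s => p s y) ∧ p 0 = 1 ∧ p 1 = φ}
  one_mem' := ⟨fun _ => 1, fun _ => continuous_const, rfl, rfl⟩
  mul_mem' := by
    rintro φ₁ φ₂ ⟨p, hp, hp0, hp1⟩ ⟨r, hr, hr0, hr1⟩
    refine ⟨fun s => if s ≤ 1 / 2 then r (2 * s) else p (2 * s - 1) * φ₂, fun y => ?_, ?_, ?_⟩
    · have h : (fun s : ℝ => (if s ≤ 1 / 2 then r (2 * s) else p (2 * s - 1) * φ₂) y)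
          = fun s : ℝ => if s ≤ 1 / 2 then r (2 * s) y else p (2 * s - 1) (φ₂ y) := by
        funext s
        split_ifs <;> rfl
      rw [h]
      refine Continuous.if_le ((hr y).comp (by fun_prop)) ((hp (φ₂ y)).comp (by fun_prop))
        continuous_id continuous_const ?_
      intro s hs
      subst hs
      norm_num [hr1, hp0]
    · norm_num [hr0]
    · norm_num [hp1]
  inv_mem' := by
    rintro φ ⟨p, hp, hp0, hp1⟩
    refine ⟨fun s => φ⁻¹ * p (1 - s), fun y => ?_, by simp [hp1], by simp [hp0]⟩
    have hc : Continuous (fun z : 𝔤 => (φ⁻¹ : 𝔤 ≃ₗ⁅ℝ⁆ 𝔤) z) :=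
      LinearMap.continuous_of_finiteDimensional
        (((φ⁻¹ : 𝔤 ≃ₗ⁅ℝ⁆ 𝔤) : 𝔤 →ₗ⁅ℝ⁆ 𝔤) : 𝔤 →ₗ[ℝ] 𝔤)
    exact hc.comp ((hp y).comp (by fun_prop))

variable {𝔤}

/-- The subgroup `H ⊆ G` that stabilizes `A` in the adjoint representation. -/
def isotropyGroup (A : 𝔤) : Subgroup (𝔤 ≃ₗ⁅ℝ⁆ 𝔤) where
  carrier := {φ | φ ∈ adjointGroup 𝔤 ∧ φ A = A}
  one_mem' := ⟨one_mem _, rfl⟩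
  mul_mem' := by
    rintro φ₁ φ₂ ⟨h₁, e₁⟩ ⟨h₂, e₂⟩
    refine ⟨mul_mem h₁ h₂, ?_⟩
    change φ₁ (φ₂ A) = A
    rw [e₂, e₁]
  inv_mem' := by
    rintro φ ⟨h, e⟩
    refine ⟨inv_mem h, ?_⟩
    change φ.symm A = A
    conv_lhs => rw [← e]
    exact φ.symm_apply_apply A

/-- The Hermitian symmetric space `M = G/H`, embedded isometrically in `𝔤` as the adjoint
orbit `Ad(G)A`. -/
def symmetricSpace (A : 𝔤) : Set 𝔤 := {v | ∃ φ ∈ adjointGroup 𝔤, φ A = v}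

end Group

noncomputable section Functionals

variable {𝔤 : Type*} [LieRing 𝔤] [LieAlgebra ℝ 𝔤] [IsCompactType 𝔤]

/-- Smooth curves `ℝ → 𝔤` with values in `N`. -/
def smoothCurves (N : Set 𝔤) : Set (ℝ → 𝔤) := {γ | ContDiff ℝ ∞ γ ∧ ∀ x, γ x ∈ N}

/-- Expressions `F(γ)(x)` formed from a curve `γ`. -/
abbrev CurveFun (𝔤 : Type*) := (ℝ → 𝔤) → ℝ → 𝔤

/-- `F(γ)(x)` depends only on finitely many derivatives of `γ` at `x`, for smooth curves in `N`. -/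
def IsLocal (N : Set 𝔤) (F : CurveFun 𝔤) : Prop :=
  ∃ k : ℕ, ∀ γ ∈ smoothCurves N, ∀ γ' ∈ smoothCurves N, ∀ x : ℝ,
    (∀ i ≤ k, iteratedDeriv i γ x = iteratedDeriv i γ' x) → F γ x = F γ' x

/-! ### Isospectral flows for the Hasimoto variable -/

/-- `P = Dₓ⁻¹ F`: the primitive of `F` that is itself a local expression and vanishes for `q = 0`.
These conditions determine `P(q)` for all smooth `𝔪`-valued `q`. -/
def IsPrimitive (𝔪 : Submodule ℝ 𝔤) (F P : CurveFun 𝔤) : Prop :=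
  IsLocal (𝔪 : Set 𝔤) P ∧ (∀ q ∈ smoothCurves (𝔪 : Set 𝔤), ∀ x, HasDerivAt (P q) (F q x) x) ∧
    ∀ x, P (fun _ => 0) x = 0

open Classical in
/-- The operator `Dₓ⁻¹`. -/
def Dinv (𝔪 : Submodule ℝ 𝔤) (F : CurveFun 𝔤) : CurveFun 𝔤 :=
  if h : ∃ P, IsPrimitive 𝔪 F P then h.choose else 0

/-- `Jq = [A, q]` as an expression in `q`. -/
def Jq (A : 𝔤) : CurveFun 𝔤 := fun q x => ⁅A, q x⁆

/-- `J⁻¹ = -J = -ad(A)` on `𝔪`. -/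
def Jinv (A : 𝔤) (F : CurveFun 𝔤) : CurveFun 𝔤 := fun q x => -⁅A, F q x⁆

/-- `ad(q)`. -/
def adq (F : CurveFun 𝔤) : CurveFun 𝔤 := fun q x => ⁅q x, F q x⁆

/-- `ℋ = Dₓ - ad(q) Dₓ⁻¹ ad(q)`. -/
def Hop (𝔪 : Submodule ℝ 𝔤) (F : CurveFun 𝔤) : CurveFun 𝔤 :=
  fun q x => deriv (F q) x - adq (Dinv 𝔪 (adq F)) q x

/-- `ℛ = ℋ J⁻¹`. -/
def Rop (𝔪 : Submodule ℝ 𝔤) (A : 𝔤) (F : CurveFun 𝔤) : CurveFun 𝔤 := Hop 𝔪 (Jinv A F)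

/-! ### Operators along curves in an adjoint orbit -/

/-- `ad(γ)`. -/
def adCurve (F : CurveFun 𝔤) : CurveFun 𝔤 := fun γ x => ⁅γ x, F γ x⁆

/-- `ad(γₓ)`. -/
def adCurveX (F : CurveFun 𝔤) : CurveFun 𝔤 := fun γ x => ⁅deriv γ x, F γ x⁆

/-- `P = (∇^𝔥ₓ)⁻¹ F` where `∇^𝔥ₓ = (1 + c ad(γ)²) Dₓ`, for curves `γ` in `N`: the local expression
`P` in the kernel of `ad(γ)` with `∇^𝔥ₓ P = F` that vanishes on constant curves. These conditions
determine `P(γ)` for all smooth curves `γ` in the orbits considered below. -/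
def IsHPrimitive (N : Set 𝔤) (c : ℝ) (F P : CurveFun 𝔤) : Prop :=
  IsLocal N P ∧
    (∀ γ ∈ smoothCurves N, Differentiable ℝ (P γ) ∧ ∀ x, ⁅γ x, P γ x⁆ = 0 ∧
      deriv (P γ) x + c • ⁅γ x, ⁅γ x, deriv (P γ) x⁆⁆ = F γ x) ∧
    ∀ v ∈ N, ∀ x, P (fun _ => v) x = 0

open Classical in
/-- The operator `(∇^𝔥ₓ)⁻¹`. -/
def Hinv (N : Set 𝔤) (c : ℝ) (F : CurveFun 𝔤) : CurveFun 𝔤 :=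
  if h : ∃ P, IsHPrimitive N c F P then h.choose else 0

/-- The derivative `γₓ` as an expression in `γ`. -/
def curveX : CurveFun 𝔤 := fun γ x => deriv γ x

end Functionals

noncomputable section Flows

variable {𝔤 : Type*} [LieRing 𝔤] [LieAlgebra ℝ 𝔤] [FiniteDimensional ℝ 𝔤] [IsCompactType 𝔤]

/-- `J_χ = ad(χ)` on `T_χ M`. -/
def Jmap (F : CurveFun 𝔤) : CurveFun 𝔤 := adCurve F

/-- The covariant derivative `∇ₓ = -J_χ² Dₓ` of `M` along a curve (orthogonal projection of `Dₓ`
to `T_χ M`). -/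
def covDeriv (F : CurveFun 𝔤) : CurveFun 𝔤 := fun γ x => -⁅γ x, ⁅γ x, deriv (F γ) x⁆⁆

/-- `𝓜_χ = ad(χₓ) (∇^𝔥ₓ)⁻¹ ad(χₓ)`. -/
def Mop (A : 𝔤) (F : CurveFun 𝔤) : CurveFun 𝔤 :=
  adCurveX (Hinv (symmetricSpace A) 1 (adCurveX F))

/-- `ℛ_χ = -J_χ (∇ₓ - 𝓜_χ)`. -/
def Rmap (A : 𝔤) (F : CurveFun 𝔤) : CurveFun 𝔤 := -Jmap (covDeriv F - Mop A F)

/-- The squared norm `-Kill(A, A) = dim 𝔪` of `A`. -/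
def normSq (𝔪 : Submodule ℝ 𝔤) : ℝ := Module.finrank ℝ 𝔪

/-- The vectors `(dim 𝔪)^{-1/2} Ad(ψ)A`, `ψ ∈ G`, in which spin vectors take their values. -/
def spinSpace (𝔪 : Submodule ℝ 𝔤) (A : 𝔤) : Set 𝔤 :=
  {v | √(normSq 𝔪) • v ∈ symmetricSpace A}

/-- `ad(T)⁻¹`: the inverse of `ad(T)` on the range of `ad(T)`, where `ad(T)² = -1/dim 𝔪`, extended
by zero to the kernel of `ad(T)`. -/
def adInvT (𝔪 : Submodule ℝ 𝔤) (F : CurveFun 𝔤) : CurveFun 𝔤 := -(normSq 𝔪 • adCurve F)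

/-- `ℛ_T = ad(T)⁻¹ (Dₓ - dim 𝔪 · ad(Tₓ) (∇^𝔥ₓ)⁻¹ ad(Tₓ))`, with `∇^𝔥ₓ = (1 + dim 𝔪 · ad(T)²) Dₓ`. -/
def Rspin (𝔪 : Submodule ℝ 𝔤) (A : 𝔤) (F : CurveFun 𝔤) : CurveFun 𝔤 :=
  adInvT 𝔪 ((fun γ x => deriv (F γ) x) -
    normSq 𝔪 • adCurveX (Hinv (spinSpace 𝔪 A) (normSq 𝔪) (adCurveX F)))

/-- `f(x, t)` is smooth on `ℝ × I` with values in `N`. -/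
def IsSmoothField (N : Set 𝔤) (I : Set ℝ) (f : ℝ → ℝ → 𝔤) : Prop :=
  ContDiffOn ℝ ∞ (fun p : ℝ × ℝ => f p.1 p.2) (univ ×ˢ I) ∧ ∀ x, ∀ t ∈ I, f x t ∈ N

/-- `q` solves the `+m` isospectral flow `(1 / dim 𝔪) qₜ = ℛᵐ(Jq)` on `ℝ × I`. -/
def IsospectralFlow (𝔪 : Submodule ℝ 𝔤) (A : 𝔤) (m : ℕ) (I : Set ℝ) (q : ℝ → ℝ → 𝔤) : Prop :=
  IsSmoothField (𝔪 : Set 𝔤) I q ∧ ∀ x, ∀ t ∈ I,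
    (1 / normSq 𝔪) • deriv (fun s => q x s) t = ((Rop 𝔪 A)^[m] (Jq A)) (fun y => q y t) x

/-- `χ` solves the `+n` map equation `χₜ = ℛ_χⁿ(χₓ)` in `M` on `ℝ × I`. -/
def MapFlow (A : 𝔤) (n : ℕ) (I : Set ℝ) (χ : ℝ → ℝ → 𝔤) : Prop :=
  IsSmoothField (symmetricSpace A) I χ ∧ ∀ x, ∀ t ∈ I,
    deriv (fun s => χ x s) t = ((Rmap A)^[n] curveX) (fun y => χ y t) x

/-- `T` solves the `+k` spin model `Tₜ = ℛ_Tᵏ(Tₓ)`, `|T| = 1`, on `ℝ × I`. -/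
def SpinFlow (𝔪 : Submodule ℝ 𝔤) (A : 𝔤) (k : ℕ) (I : Set ℝ) (T : ℝ → ℝ → 𝔤) : Prop :=
  IsSmoothField (spinSpace 𝔪 A) I T ∧ (∀ x, ∀ t ∈ I, ‖T x t‖ = 1) ∧ ∀ x, ∀ t ∈ I,
    deriv (fun s => T x s) t = ((Rspin 𝔪 A)^[k] curveX) (fun y => T y t) x

/-- `ψ : ℝ × I → G` is a parallel frame for the map `χ = Ad(ψ)A`, with Hasimoto variable
`q = ψ⁻¹ ∂ₓψ ∈ 𝔪`. -/
structure IsParallelFrame (𝔪 : Submodule ℝ 𝔤) (A : 𝔤) (I : Set ℝ)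
    (ψ : ℝ → ℝ → (𝔤 ≃ₗ⁅ℝ⁆ 𝔤)) (χ q : ℝ → ℝ → 𝔤) : Prop where
  mem : ∀ x, ∀ t ∈ I, ψ x t ∈ adjointGroup 𝔤
  smooth : ∀ y : 𝔤, ContDiffOn ℝ ∞ (fun p : ℝ × ℝ => ψ p.1 p.2 y) (univ ×ˢ I)
  map_eq : ∀ x, ∀ t ∈ I, χ x t = ψ x t A
  q_mem : ∀ x, ∀ t ∈ I, q x t ∈ 𝔪
  deriv_eq : ∀ x, ∀ t ∈ I, ∀ y : 𝔤, deriv (fun s => ψ s t y) x = ψ x t ⁅q x t, y⁆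

/-- `g : I → K` is smooth, for a subgroup `K` of `Aut 𝔤`. -/
def IsSmoothPath (K : Subgroup (𝔤 ≃ₗ⁅ℝ⁆ 𝔤)) (I : Set ℝ) (g : ℝ → (𝔤 ≃ₗ⁅ℝ⁆ 𝔤)) : Prop :=
  (∀ t ∈ I, g t ∈ K) ∧ ∀ y : 𝔤, ContDiffOn ℝ ∞ (fun t => g t y) I

/-- Rescaling of time, `f(x, t) ↦ f(x, c t)`. -/
def timeScale (c : ℝ) (f : ℝ → ℝ → 𝔤) : ℝ → ℝ → 𝔤 := fun x t => f x (c * t)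

end Flows

end HermSym

open HermSym

/-! All three hierarchies are read off one formal series. For `𝔪`-valued `q` let `X = ∑ Xₙ λ⁻ⁿ`, `X₀
= A`, satisfy `Xₓ + [q, X] = λ[A, X]` and `ad(X)³ = -ad(X)`. The Lax equation fixes the `𝔪`-part of
`Xₙ₊₁` and the cubic constraint fixes its `𝔥`-part. Both are algebraic in earlier coefficients and
their derivatives, so nothing is integrated and every `Xₙ` is a smooth function of finitely many
derivatives of `q` (`isJet_lax`). That the two conditions are compatible is the main point
(`lax_claim`). The `𝔥`-part of `Xₙ₊₁` is then the local primitive that the recursion asks for, and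
`ℛⁿ(Jq) = -[A, Xₙ₊₁]` (`Rop_iterate`).

The construction is gauge equivariant (`lax_equivariant`). A parallel frame `ψ` turns the pair `(q,
A)` into `(0, χ)`, so `Yₙ = ψ Xₙ` is local in `χ`, satisfies `∂ₓYₙ = [χ, Yₙ₊₁]`, and gives `ℛ_χⁿ(χₓ)
= [χ, Yₙ₊₁]` (`Rmap_iterate`). The spin hierarchy is the same one rescaled (`Rspin_iterate`).

Local inverses are unique because the difference of two of them is local and of constant norm along
each curve: it vanishes after the curve is deformed, away from the point of interest, to a constant
one (`eq_zero_of_local`).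

To compare flows, write `ψₜ = ψ ad(p)`, so that `qₜ = pₓ + [q, p]`, and put `w = p + Xₙ₊₁`. The map
equation says `[A, w] = 0`, while `wₓ + [q, w] = qₜ + [A, Xₙ₊₂]`. If `w` lies in `𝔥`, the `𝔥`-part
of this identity makes `w` a function `c(t)`, and the `𝔪`-part is the isospectral flow up to `[q,
c]`, which a rotation in `H` removes (`evolution_of_lie_eq_zero`). Conversely, if `q` satisfies the
flow up to such a term, then `ψ(w - c)` depends on `t` only (`frame_apply_const`), and a motion
`g(t)` of `M` removes it. Under decay at `-∞` both functions of `t` vanish. Existence of frames is a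
linear equation in `Aut 𝔤` with smooth parameter dependence (`exists_smooth_frame`). -/

namespace HermSym

/-! ### Smoothness of a parameter-dependent path as a map into a Banach space of paths -/

section Curry

variable {P : Type} [NormedAddCommGroup P]

open Classical in
/-- The path `s ↦ f (s, p)` over the unit interval, as a continuous map. -/
noncomputable def pathMap {F : Type*} [NormedAddCommGroup F] (f : ℝ × P → F) (p : P) :
    C(unitInterval, F) :=
  if h : Continuous (fun s : unitInterval => f (s, p)) then ⟨_, h⟩ else 0

variable {F : Type*} [NormedAddCommGroup F] {f : ℝ × P → F} {W : Set (ℝ × P)}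
  {U : Set P}

lemma pathMap_apply (hf : ContinuousOn f W) (hW : ∀ p ∈ U, ∀ s : unitInterval, ((s : ℝ), p) ∈ W)
    {p : P} (hp : p ∈ U) (s : unitInterval) : pathMap f p s = f (s, p) := by
  have h : Continuous (fun s : unitInterval => f (s, p)) :=
    hf.comp_continuous (by fun_prop) (fun s => hW p hp s)
  simp [pathMap, h]

lemma continuousOn_pathMap (hf : ContinuousOn f W)
    (hW : ∀ p ∈ U, ∀ s : unitInterval, ((s : ℝ), p) ∈ W) : ContinuousOn (pathMap f) U := by
  rw [continuousOn_iff_continuous_domRestrict]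
  let g : C(U × unitInterval, F) := ⟨fun z => f ((z.2 : ℝ), (z.1 : P)),
    hf.comp_continuous (by fun_prop) (fun z => hW _ z.1.2 z.2)⟩
  convert g.curry.continuous using 1
  ext p s
  simpa [g] using pathMap_apply hf hW p.2 s

variable [NormedSpace ℝ P] [NormedSpace ℝ F]

/-- Evaluation of a path of operators at a fixed vector, as a path of operators. -/
noncomputable def pathFlip (P : Type) [NormedAddCommGroup P] [NormedSpace ℝ P]
    (F : Type*) [NormedAddCommGroup F] [NormedSpace ℝ F] :
    C(unitInterval, P →L[ℝ] F) →L[ℝ] (P →L[ℝ] C(unitInterval, F)) :=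
  LinearMap.mkContinuous₂
    (LinearMap.mk₂ ℝ (fun (g : C(unitInterval, P →L[ℝ] F)) (v : P) =>
        (⟨fun s => g s v, by fun_prop⟩ : C(unitInterval, F)))
      (fun _ _ _ => by ext; simp) (fun _ _ _ => by ext; simp)
      (fun _ _ _ => by ext; simp) (fun _ _ _ => by ext; simp)) 1
    (fun g v => by
      rw [ContinuousMap.norm_le _ (by positivity)]
      intro s
      simpa using (g s).le_of_opNorm_le (g.norm_coe_le_norm s) v)

@[simp] lemma pathFlip_apply {F : Type*} [NormedAddCommGroup F] [NormedSpace ℝ F]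
    (g : C(unitInterval, P →L[ℝ] F)) (v : P) (s : unitInterval) :
    pathFlip P F g v s = g s v := rfl

/-- The path of partial derivatives is continuous in the sup norm, so the mean value inequality on a
ball around `p` bounds the remainder by the same `ε` for every `s`. -/
lemma hasFDerivAt_pathMap (hU : IsOpen U) (hWo : IsOpen W) (hf : ContDiffOn ℝ 1 f W)
    (hW : ∀ p ∈ U, ∀ s : unitInterval, ((s : ℝ), p) ∈ W) {p : P} (hp : p ∈ U) :
    HasFDerivAt (pathMap f)
      (pathFlip P F (pathMap (fun z => (fderiv ℝ f z).comp (.inr ℝ ℝ P)) p)) p := by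
  have hc : ContinuousOn (fun z => (fderiv ℝ f z).comp (.inr ℝ ℝ P)) W :=
    (hf.continuousOn_fderiv_of_isOpen hWo le_rfl).clm_comp continuousOn_const
  have hc' := continuousOn_pathMap hc hW
  rw [hasFDerivAt_iff_isLittleO, Asymptotics.isLittleO_iff]
  intro ε hε
  have h1 := (hc'.continuousAt (hU.mem_nhds hp)).eventually (Metric.closedBall_mem_nhds _ hε)
  obtain ⟨δ, hδ, hball⟩ := Metric.mem_nhds_iff.1 (h1.and (hU.mem_nhds hp))
  filter_upwards [Metric.ball_mem_nhds p hδ] with p' hp'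
  rw [ContinuousMap.norm_le _ (by positivity)]
  intro s
  have hpU : ∀ x ∈ Metric.ball p δ, x ∈ U := fun x hx => (hball hx).2
  have hd : ∀ x ∈ Metric.ball p δ, HasFDerivWithinAt (fun x => f (s, x))
      ((fderiv ℝ f (s, x)).comp (.inr ℝ ℝ P)) (Metric.ball p δ) x := by
    intro x hx
    have h2 : HasFDerivAt f (fderiv ℝ f (s, x)) ((s : ℝ), x) :=
      ((hf.contDiffAt (hWo.mem_nhds (hW x (hpU x hx) s))).differentiableAt
        (by norm_num)).hasFDerivAt
    exact (h2.comp x (hasFDerivAt_prodMk_right (s : ℝ) x)).hasFDerivWithinAt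
  have := (convex_ball p δ).norm_image_sub_le_of_norm_hasFDerivWithin_le' (C := ε)
    (φ := (fderiv ℝ f (s, p)).comp (.inr ℝ ℝ P)) hd (fun x hx => ?_)
    (Metric.mem_ball_self hδ) hp'
  · rwa [ContinuousMap.sub_apply, ContinuousMap.sub_apply, pathFlip_apply,
      pathMap_apply hf.continuousOn hW (hpU p' hp'), pathMap_apply hf.continuousOn hW hp,
      pathMap_apply hc hW hp]
  · have h3 := (hball hx).1
    rw [dist_eq_norm] at h3
    have h4 := (ContinuousMap.norm_coe_le_norm _ s).trans h3
    rwa [ContinuousMap.sub_apply, pathMap_apply hc hW (hpU x hx), pathMap_apply hc hW hp] at h4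

/-- The derivative is again a `pathMap`, of an operator-valued function, so the induction must run
over all targets `F` at once. As `P` lives in `Type`, operators `P →L[ℝ] F` stay in the universe of
`F`. -/
lemma contDiffOn_pathMap_nat.{u} (hU : IsOpen U) (hWo : IsOpen W)
    (hW : ∀ p ∈ U, ∀ s : unitInterval, ((s : ℝ), p) ∈ W) (n : ℕ) :
    ∀ {F : Type u} [NormedAddCommGroup F] [NormedSpace ℝ F] {f : ℝ × P → F},
      ContDiffOn ℝ n f W → ContDiffOn ℝ n (pathMap f) U := by
  induction n with
  | zero =>
    intro F _ _ f hf
    simp only [Nat.cast_zero, contDiffOn_zero] at hf ⊢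
    exact continuousOn_pathMap hf hW
  | succ n ih =>
    intro F _ _ f hf
    have h1 : ContDiffOn ℝ 1 f W := hf.of_le (by exact_mod_cast Nat.le_add_left 1 n)
    push_cast at hf ⊢
    have hf' := ((contDiffOn_succ_iff_fderiv_of_isOpen hWo).1 hf).2.2
    rw [contDiffOn_succ_iff_fderiv_of_isOpen hU]
    refine ⟨fun p hp => (hasFDerivAt_pathMap hU hWo h1 hW
      hp).differentiableAt.differentiableWithinAt, by simp, ?_⟩
    have h2 : ContDiffOn ℝ n (fun z => (fderiv ℝ f z).comp (.inr ℝ ℝ P)) W :=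
      hf'.clm_comp contDiffOn_const
    have h3 : ContDiff ℝ n (fun g => pathFlip P F g) := by fun_prop
    exact (h3.comp_contDiffOn (ih h2)).congr
      fun p hp => (hasFDerivAt_pathMap hU hWo h1 hW hp).fderiv

lemma contDiffOn_pathMap (hU : IsOpen U) (hWo : IsOpen W)
    (hW : ∀ p ∈ U, ∀ s : unitInterval, ((s : ℝ), p) ∈ W) (hf : ContDiffOn ℝ ∞ f W) :
    ContDiffOn ℝ ∞ (pathMap f) U := by
  rw [contDiffOn_infty] at hf ⊢
  exact fun n => contDiffOn_pathMap_nat hU hWo hW n (hf n)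

end Curry

/-! ### Volterra operators and the path-ordered exponential -/

section Volterra

open MeasureTheory

variable {R : Type*} [NormedRing R]

lemma continuous_IccExtend_path (f : C(unitInterval, R)) :
    Continuous (IccExtend (zero_le_one' ℝ) f) := f.continuous.Icc_extend'

variable [NormedAlgebra ℝ R]

variable (R) in
/-- The Volterra operator `f ↦ ∫₀ˢ f` on continuous paths. -/
noncomputable def volterra : C(unitInterval, R) →L[ℝ] C(unitInterval, R) :=
  LinearMap.mkContinuous
    { toFun := fun f => ⟨fun s => ∫ r in (0 : ℝ)..s, IccExtend (zero_le_one' ℝ) f r,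
        (intervalIntegral.continuous_primitive
          (fun a b => (continuous_IccExtend_path f).intervalIntegrable a b) 0).comp
          continuous_subtype_val⟩
      map_add' := fun f g => by
        ext s
        simp only [ContinuousMap.coe_mk, ContinuousMap.add_apply]
        rw [← intervalIntegral.integral_add
          ((continuous_IccExtend_path f).intervalIntegrable _ _)
          ((continuous_IccExtend_path g).intervalIntegrable _ _)]
        rfl
      map_smul' := fun c f => by
        ext s
        simp only [ContinuousMap.coe_mk, ContinuousMap.smul_apply, RingHom.id_apply]
        rw [← intervalIntegral.integral_smul]
        rfl } 1
    (fun f => by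
      rw [one_mul, ContinuousMap.norm_le _ (norm_nonneg _)]
      intro s
      have := intervalIntegral.norm_integral_le_of_norm_le_const (a := (0 : ℝ)) (b := s)
        (f := IccExtend (zero_le_one' ℝ) f) (C := ‖f‖) (fun r _ => f.norm_coe_le_norm _)
      refine this.trans ?_
      rw [sub_zero, abs_of_nonneg s.2.1]
      exact mul_le_of_le_one_right (norm_nonneg _) s.2.2)

/-- The operator `y ↦ ∫₀ˢ α y`. -/
noncomputable def volterraMul (α : C(unitInterval, R)) :
    C(unitInterval, R) →L[ℝ] C(unitInterval, R) :=
  (volterra R).comp (ContinuousLinearMap.mul ℝ C(unitInterval, R) α)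

lemma volterraMul_apply (α f : C(unitInterval, R)) (s : unitInterval) :
    volterraMul α f s = ∫ r in (0 : ℝ)..s, IccExtend (zero_le_one' ℝ) (α * f) r := rfl

/-- Integrating `rⁿ / n!` at each step produces the factorial that makes the Volterra operator
quasinilpotent. -/
lemma norm_volterraMul_pow_apply_le (α f : C(unitInterval, R)) (n : ℕ) (s : unitInterval) :
    ‖(volterraMul α ^ n) f s‖ ≤ ‖α‖ ^ n * (s : ℝ) ^ n / n.factorial * ‖f‖ := by
  induction n generalizing s with
  | zero => simpa using f.norm_coe_le_norm s
  | succ n ih =>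
    rw [pow_succ', mul_apply_eq_comp, volterraMul_apply]
    refine (intervalIntegral.norm_integral_le_of_norm_le s.2.1
      (g := fun r => ‖α‖ ^ (n + 1) / n.factorial * ‖f‖ * r ^ n) (ae_of_all _ fun r hr => ?_)
      (by apply Continuous.intervalIntegrable; fun_prop)).trans (le_of_eq ?_)
    · have hr' : r ∈ Icc (0 : ℝ) 1 := ⟨hr.1.le, hr.2.trans s.2.2⟩
      rw [IccExtend_of_mem _ _ hr', ContinuousMap.mul_apply]
      refine (norm_mul_le _ _).trans ((mul_le_mul (α.norm_coe_le_norm _) (ih ⟨r, hr'⟩)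
        (norm_nonneg _) (norm_nonneg _)).trans (le_of_eq ?_))
      ring
    · rw [intervalIntegral.integral_const_mul, integral_pow, Nat.factorial_succ]
      push_cast
      field_simp
      ring

/-- Some power `Vⁿ` has norm below one, so `1 - Vⁿ` is a unit; it factors as `1 - V` times a
commuting geometric sum, hence `1 - V` is a unit too. -/
lemma isUnit_one_sub_volterraMul [CompleteSpace R] (α : C(unitInterval, R)) :
    IsUnit (1 - volterraMul α) := by
  obtain ⟨n, hn⟩ := ((FloorSemiring.tendsto_pow_div_factorial_atTop ‖α‖).eventually
    (gt_mem_nhds (zero_lt_one' ℝ))).exists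
  have h1 : ‖volterraMul α ^ n‖ < 1 := by
    refine lt_of_le_of_lt (ContinuousLinearMap.opNorm_le_bound _ (by positivity)
      (M := ‖α‖ ^ n / n.factorial) fun f => ?_) hn
    rw [ContinuousMap.norm_le _ (by positivity)]
    intro s
    refine (norm_volterraMul_pow_apply_le α f n s).trans ?_
    gcongr
    exact mul_le_of_le_one_right (by positivity) (pow_le_one₀ s.2.1 s.2.2)
  have h2 := isUnit_one_sub_of_norm_lt_one (R := C(unitInterval, R) →L[ℝ] C(unitInterval, R)) h1
  rw [← mul_neg_geom_sum] at h2
  have hc : Commute (1 - volterraMul α) (∑ i ∈ Finset.range n, volterraMul α ^ i) :=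
    (mul_neg_geom_sum (volterraMul α) n).trans (geom_sum_mul_neg (volterraMul α) n).symm
  exact (hc.isUnit_mul_iff.1 h2).1

/-- The solution of `y' = α y`, `y(0) = 1` over the unit interval. -/
noncomputable def pathExp (α : C(unitInterval, R)) : C(unitInterval, R) :=
  Ring.inverse (1 - volterraMul α) 1

/-- Inversion is smooth at units of a Banach algebra, so smooth dependence of the solution on the
coefficient needs no estimates. -/
lemma contDiff_pathExp [CompleteSpace R] : ContDiff ℝ ∞ (pathExp (R := R)) := by
  have h1 : ContDiff ℝ ∞ (fun α : C(unitInterval, R) => 1 - volterraMul α) := by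
    unfold volterraMul
    fun_prop
  have h2 : ContDiff ℝ ∞ (fun α : C(unitInterval, R) => Ring.inverse (1 - volterraMul α)) := by
    rw [contDiff_iff_contDiffAt]
    intro α
    have := contDiffAt_ringInverse ℝ (n := ∞)
      (R := C(unitInterval, R) →L[ℝ] C(unitInterval, R)) (isUnit_one_sub_volterraMul α).unit
    exact this.comp α h1.contDiffAt
  exact h2.clm_apply contDiff_const

lemma eq_pathExp_iff [CompleteSpace R] (α y : C(unitInterval, R)) :
    y = pathExp α ↔ y = 1 + volterraMul α y := by
  obtain ⟨u, hu⟩ := isUnit_one_sub_volterraMul α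
  rw [pathExp, ← hu, Ring.inverse_unit]
  have key : y - volterraMul α y = (u : _ →L[ℝ] _) y := by rw [hu]; rfl
  rw [← sub_eq_iff_eq_add, key]
  constructor
  · rintro rfl
    rw [← mul_apply_eq_comp, u.mul_inv]; rfl
  · intro h
    rw [← h, ← mul_apply_eq_comp, u.inv_mul]; rfl

lemma pathExp_apply [CompleteSpace R] (α : C(unitInterval, R)) (s : unitInterval) :
    pathExp α s = 1 + ∫ r in (0 : ℝ)..s, IccExtend (zero_le_one' ℝ) (α * pathExp α) r :=
  DFunLike.congr_fun ((eq_pathExp_iff α _).1 rfl) s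

/-- Solving up to an intermediate time is solving a time-rescaled equation; both sides satisfy the
same integral equation. -/
lemma pathExp_scale [CompleteSpace R] (α β : C(unitInterval, R)) (c : unitInterval)
    (h : ∀ s : unitInterval, β s = (c : ℝ) • α (c * s)) (s : unitInterval) :
    pathExp β s = pathExp α (c * s) := by
  let z : C(unitInterval, R) := ⟨fun s => pathExp α (c * s), by fun_prop⟩
  suffices z = pathExp β from (DFunLike.congr_fun this s).symm
  rw [eq_pathExp_iff]
  ext s
  change pathExp α (c * s) = 1 + volterraMul β z s
  rw [pathExp_apply, volterraMul_apply]
  congr 1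
  have h1 := intervalIntegral.smul_integral_comp_mul_left (a := 0) (b := s)
    (IccExtend (zero_le_one' ℝ) (α * pathExp α)) (c : ℝ)
  rw [mul_zero] at h1
  rw [Icc.coe_mul, ← h1, ← intervalIntegral.integral_smul]
  refine intervalIntegral.integral_congr fun r hr => ?_
  rw [uIcc_of_le s.2.1] at hr
  have hr' : r ∈ Icc (0 : ℝ) 1 := ⟨hr.1, hr.2.trans s.2.2⟩
  have hcr : (c : ℝ) * r ∈ Icc (0 : ℝ) 1 := (c * ⟨r, hr'⟩ : unitInterval).2
  rw [IccExtend_of_mem _ _ hr', IccExtend_of_mem _ _ hcr, ContinuousMap.mul_apply,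
    ContinuousMap.mul_apply, h, smul_mul_assoc]
  rfl

end Volterra

/-! ### Linear equations with smooth parameter dependence -/

section ODE

open MeasureTheory

variable {R : Type*} [NormedRing R] [NormedAlgebra ℝ R] [CompleteSpace R]
  {T : Type} [NormedAddCommGroup T] [NormedSpace ℝ T]

/-- Linear equations `uₓ = a u` in a Banach algebra have fundamental solutions that depend smoothly
on parameters. -/
theorem exists_smooth_fundamental_solution {U : Set (ℝ × T)} (hU : IsOpen U) {x₀ : ℝ}
    (hstar : ∀ p ∈ U, ∀ s ∈ Icc (0 : ℝ) 1, (x₀ + s * (p.1 - x₀), p.2) ∈ U)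
    {a : ℝ × T → R} (ha : ContDiffOn ℝ ∞ a U) :
    ∃ u : ℝ × T → R, ContDiffOn ℝ ∞ u U ∧ (∀ t, u (x₀, t) = 1) ∧
      ∀ x t, (x, t) ∈ U → HasDerivAt (fun y => u (y, t)) (a (x, t) * u (x, t)) x := by
  let θ : ℝ × (ℝ × T) → ℝ × T := fun z => (x₀ + z.1 * (z.2.1 - x₀), z.2.2)
  have hθ : ContDiff ℝ ∞ θ := by fun_prop
  let f : ℝ × (ℝ × T) → R := fun z => (z.2.1 - x₀) • a (θ z)
  have hf : ContDiffOn ℝ ∞ f (θ ⁻¹' U) :=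
    (by fun_prop : ContDiffOn ℝ ∞ (fun z : ℝ × (ℝ × T) => z.2.1 - x₀) (θ ⁻¹' U)).smul
      (ha.comp hθ.contDiffOn fun _ h => h)
  have hW : ∀ p ∈ U, ∀ s : unitInterval, ((s : ℝ), p) ∈ θ ⁻¹' U := fun p hp s => hstar p hp s s.2
  have hfapp : ∀ p ∈ U, ∀ s : unitInterval, pathMap f p s = f (s, p) :=
    fun p hp s => pathMap_apply hf.continuousOn hW hp s
  -- The case distinction makes `u(x₀, t) = 1` hold even for `(x₀, t)` outside `U`. On `U` it
  -- changes nothing, since `f` carries the factor `x - x₀`.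
  let u : ℝ × T → R := fun p => if p.1 = x₀ then 1 else pathExp (pathMap f p) 1
  have hu1 : ∀ p ∈ U, u p = pathExp (pathMap f p) 1 := by
    rintro ⟨x, t⟩ hp
    by_cases hx : x = x₀
    · subst hx
      have h0 : pathMap f (x, t) = 0 := by
        ext s
        rw [hfapp _ hp]
        simp [f]
      have h1 : pathExp (0 : C(unitInterval, R)) = 1 := by
        symm
        rw [eq_pathExp_iff]
        simp [volterraMul]
      simp [u, h0, h1]
    · simp [u, hx]
  have hu : ContDiffOn ℝ ∞ u U := by
    refine ContDiffOn.congr (f := fun p => pathExp (pathMap f p) 1) ?_ hu1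
    have h1 := (contDiff_pathExp (R := R)).comp_contDiffOn
      (contDiffOn_pathMap hU (hU.preimage hθ.continuous) hW hf)
    exact (ContinuousMap.evalCLM ℝ (1 : unitInterval)).contDiff.comp_contDiffOn h1
  -- The path solved for the end point `p` passes through the values of `u` at all points of the
  -- segment, which turns the integral equation on the unit interval into one for `u`.
  have hscale : ∀ p ∈ U, ∀ s : unitInterval, pathExp (pathMap f p) s = u (θ (s, p)) := by
    intro p hp s
    rw [hu1 _ (hstar p hp s s.2), pathExp_scale (pathMap f p) (pathMap f (θ (s, p))) s _ 1, mul_one]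
    intro r
    rw [hfapp _ (hstar p hp s s.2), hfapp _ hp]
    simp only [f, θ, Icc.coe_mul]
    rw [smul_smul]
    congr 3 <;> ring
  have hint : ∀ x t, (x, t) ∈ U → u (x, t) = 1 + ∫ r in x₀..x, a (r, t) * u (r, t) := by
    intro x t hp
    rw [hu1 _ hp, pathExp_apply]
    congr 1
    have h1 := intervalIntegral.smul_integral_comp_add_mul (a := 0) (b := 1)
      (fun r => a (r, t) * u (r, t)) (x - x₀) x₀
    rw [mul_zero, add_zero, mul_one, add_sub_cancel] at h1
    rw [← h1, ← intervalIntegral.integral_smul]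
    refine intervalIntegral.integral_congr fun r hr => ?_
    rw [Icc.coe_one, uIcc_of_le zero_le_one] at hr
    rw [IccExtend_of_mem _ _ hr, ContinuousMap.mul_apply, hfapp _ hp, hscale _ hp]
    simp only [f, θ, smul_mul_assoc]
    rw [mul_comm r]
  refine ⟨u, hu, fun t => by simp [u], fun x t hp => ?_⟩
  have hV : IsOpen {y : ℝ | (y, t) ∈ U} := hU.preimage (by fun_prop)
  have hcont : ContinuousOn (fun y => a (y, t) * u (y, t)) {y : ℝ | (y, t) ∈ U} :=
    (ha.continuousOn.mul hu.continuousOn).comp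
      (f := fun y : ℝ => (y, t)) (by fun_prop) fun _ h => h
  have hsub : uIcc x₀ x ⊆ {y : ℝ | (y, t) ∈ U} := by
    intro y hy
    rw [← segment_eq_uIcc, segment_eq_image'] at hy
    obtain ⟨s, hs, rfl⟩ := hy
    exact hstar _ hp s hs
  have hd := intervalIntegral.integral_hasDerivAt_right
    (hcont.mono hsub).intervalIntegrable
    (hcont.stronglyMeasurableAtFilter hV x hp) (hcont.continuousAt (hV.mem_nhds hp))
  refine (hd.const_add 1).congr_of_eventuallyEq ?_
  filter_upwards [hV.mem_nhds hp] with y hy using hint y t hy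

end ODE

/-! ### The relation `ℓ³ = -ℓ` and its linearization -/

section CubicRing

variable {R : Type*} [Ring R]

/-- The linearization of `ℓ ↦ ℓ³ + ℓ`. -/
def cubicLin (ℓ N : R) : R := N * ℓ * ℓ + ℓ * N * ℓ + ℓ * ℓ * N + N

/-- Commutators with `ℓ` are the infinitesimal conjugations, and these preserve the relation. -/
lemma cubicLin_commutator {ℓ : R} (h : ℓ * ℓ * ℓ = -ℓ) (Z : R) :
    cubicLin ℓ (ℓ * Z - Z * ℓ) = 0 := by
  have : cubicLin ℓ (ℓ * Z - Z * ℓ) = (ℓ * ℓ * ℓ) * Z - Z * (ℓ * ℓ * ℓ) + (ℓ * Z - Z * ℓ) := by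
    unfold cubicLin; noncomm_ring
  rw [this, h]; noncomm_ring

variable [Algebra ℝ R]

/-- The inverse of `cubicLin ℓ` on the commutant of `ℓ`. -/
noncomputable def cubicWeight (ℓ : R) : R := 1 + (3 / 2 : ℝ) • (ℓ * ℓ)

lemma cubicWeight_commute (ℓ : R) : ℓ * cubicWeight ℓ = cubicWeight ℓ * ℓ := by
  simp [cubicWeight, mul_add, add_mul, mul_assoc]

/-- On the commutant the linearization is multiplication by `1 + 3ℓ²`. As `ℓ²` acts with eigenvalues
`0` and `-1`, this is `1` or `-2`, and the weight `1 + (3/2)ℓ²` is `1` or `-1/2`. -/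
lemma cubicWeight_mul_cubicLin {ℓ : R} (h : ℓ * ℓ * ℓ = -ℓ) {N : R} (hN : ℓ * N = N * ℓ) :
    cubicWeight ℓ * cubicLin ℓ N = N := by
  have h1 : cubicLin ℓ N = (3 : ℝ) • (ℓ * ℓ * N) + N := by
    have e : ℓ * N * ℓ = ℓ * ℓ * N := by rw [mul_assoc, ← hN, mul_assoc]
    have e' : N * ℓ * ℓ = ℓ * ℓ * N := by rw [← hN, e]
    rw [cubicLin, e, e']; module
  have h2 : ℓ * ℓ * (ℓ * ℓ * N) = -(ℓ * ℓ * N) := by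
    have : ℓ * ℓ * (ℓ * ℓ * N) = ℓ * ℓ * ℓ * (ℓ * N) := by noncomm_ring
    rw [this, h]; noncomm_ring
  rw [h1, cubicWeight, add_mul, one_mul, smul_mul_assoc, mul_add, mul_smul_comm, h2]
  module

/-- A commutator with `ℓ` that commutes with `ℓ` is killed by the linearization, which is invertible
on the commutant. -/
lemma commutator_eq_zero {ℓ Z : R} (h : ℓ * ℓ * ℓ = -ℓ)
    (hZ : ℓ * (ℓ * Z - Z * ℓ) = (ℓ * Z - Z * ℓ) * ℓ) : ℓ * Z - Z * ℓ = 0 := by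
  rw [← cubicWeight_mul_cubicLin h hZ, cubicLin_commutator h, mul_zero]

end CubicRing

/-! ### The Killing inner product and the trace-form adjoint of `ad` -/

section Killing

variable {𝔤 : Type*} [LieRing 𝔤] [LieAlgebra ℝ 𝔤] [IsCompactType 𝔤]

local notation "⟪" x ", " y "⟫" => inner ℝ x y

lemma inner_eq_neg_killingForm (x y : 𝔤) : ⟪x, y⟫ = -killingForm ℝ 𝔤 x y := rfl

lemma inner_lie_left (x y z : 𝔤) : ⟪⁅x, y⁆, z⟫ = -⟪y, ⁅x, z⁆⟫ := by
  rw [inner_eq_neg_killingForm, inner_eq_neg_killingForm, ← lie_skew x y, map_neg,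
    LinearMap.neg_apply, LieModule.traceForm_apply_lie_apply]

lemma inner_equiv (φ : 𝔤 ≃ₗ⁅ℝ⁆ 𝔤) (x y : 𝔤) : ⟪φ x, φ y⟫ = ⟪x, y⟫ := by
  rw [inner_eq_neg_killingForm, inner_eq_neg_killingForm, LieAlgebra.killingForm_of_equiv_apply]

variable [FiniteDimensional ℝ 𝔤]

/-- `ad` as a continuous bilinear map. -/
noncomputable def adL : 𝔤 →L[ℝ] 𝔤 →L[ℝ] 𝔤 :=
  LinearMap.toContinuousLinearMap
    ((LinearMap.toContinuousLinearMap : (𝔤 →ₗ[ℝ] 𝔤) ≃ₗ[ℝ] (𝔤 →L[ℝ] 𝔤)).toLinearMap ∘ₗ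
      (LieAlgebra.ad ℝ 𝔤 : 𝔤 →ₗ[ℝ] Module.End ℝ 𝔤))

@[simp] lemma adL_apply (x y : 𝔤) : adL x y = ⁅x, y⁆ := rfl

/-- A Lie algebra automorphism as a continuous linear map. -/
noncomputable def autL (φ : 𝔤 ≃ₗ⁅ℝ⁆ 𝔤) : 𝔤 →L[ℝ] 𝔤 :=
  LinearMap.toContinuousLinearMap ((φ : 𝔤 →ₗ⁅ℝ⁆ 𝔤) : 𝔤 →ₗ[ℝ] 𝔤)

@[simp] lemma autL_apply (φ : 𝔤 ≃ₗ⁅ℝ⁆ 𝔤) (y : 𝔤) : autL φ y = φ y := rfl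

/-- The trace of a continuous endomorphism. -/
noncomputable def trL : (𝔤 →L[ℝ] 𝔤) →L[ℝ] ℝ :=
  LinearMap.toContinuousLinearMap
    (LinearMap.trace ℝ 𝔤 ∘ₗ (LinearMap.toContinuousLinearMap : (𝔤 →ₗ[ℝ] 𝔤) ≃ₗ[ℝ] _).symm.toLinearMap)

lemma trL_apply (C : 𝔤 →L[ℝ] 𝔤) : trL C = LinearMap.trace ℝ 𝔤 (C : 𝔤 →ₗ[ℝ] 𝔤) := rfl

lemma trL_mul_comm (C D : 𝔤 →L[ℝ] 𝔤) : trL (C * D) = trL (D * C) := by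
  rw [trL_apply, trL_apply]
  exact LinearMap.trace_mul_comm ℝ (C : 𝔤 →ₗ[ℝ] 𝔤) (D : 𝔤 →ₗ[ℝ] 𝔤)

lemma inner_eq_neg_trL (x y : 𝔤) : ⟪x, y⟫ = -trL (adL x * adL y) := rfl

/-- The adjoint of `ad` with respect to the trace form. -/
noncomputable def adAdjoint : (𝔤 →L[ℝ] 𝔤) →L[ℝ] 𝔤 :=
  ∑ i, ((-trL) ∘L ((ContinuousLinearMap.mul ℝ (𝔤 →L[ℝ] 𝔤)).flip
    (adL (stdOrthonormalBasis ℝ 𝔤 i)))).smulRight (stdOrthonormalBasis ℝ 𝔤 i)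

lemma inner_adAdjoint (C : 𝔤 →L[ℝ] 𝔤) (y : 𝔤) : ⟪adAdjoint C, y⟫ = -trL (C * adL y) := by
  conv_rhs => rw [← (stdOrthonormalBasis ℝ 𝔤).sum_repr' y]
  simp [adAdjoint, sum_inner, inner_smul_left, Finset.mul_sum, mul_comm]

lemma adAdjoint_adL (x : 𝔤) : adAdjoint (adL x) = x :=
  ext_inner_right ℝ fun y => by rw [inner_adAdjoint, inner_eq_neg_trL]

lemma adL_lie (x y : 𝔤) : adL ⁅x, y⁆ = adL x * adL y - adL y * adL x := by
  ext z
  simp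

lemma adL_injective : Function.Injective (adL : 𝔤 → 𝔤 →L[ℝ] 𝔤) :=
  Function.LeftInverse.injective adAdjoint_adL

/-- Invariance of the trace: `adAdjoint` is a left inverse of `ad` defined on all endomorphisms and
it intertwines commutators with brackets. This lets the cubic defect, an endomorphism, be converted
into an element of `𝔤`. -/
lemma lie_adAdjoint (x : 𝔤) (C : 𝔤 →L[ℝ] 𝔤) :
    ⁅x, adAdjoint C⁆ = adAdjoint (adL x * C - C * adL x) := by
  refine ext_inner_right ℝ fun y => ?_
  rw [inner_lie_left, inner_adAdjoint, inner_adAdjoint, adL_lie, mul_sub, sub_mul, map_sub, map_sub,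
    mul_assoc (adL x), trL_mul_comm (adL x), mul_assoc C, mul_assoc C]
  ring

lemma autL_mul_autL_symm (φ : 𝔤 ≃ₗ⁅ℝ⁆ 𝔤) : autL φ * autL φ.symm = 1 := by
  ext y; simp

lemma autL_symm_mul_autL (φ : 𝔤 ≃ₗ⁅ℝ⁆ 𝔤) : autL φ.symm * autL φ = 1 := by
  ext y; simp

lemma adL_equiv (φ : 𝔤 ≃ₗ⁅ℝ⁆ 𝔤) (x : 𝔤) : adL (φ x) = autL φ * adL x * autL φ.symm := by
  ext y
  change ⁅φ x, y⁆ = φ ⁅x, φ.symm y⁆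
  rw [LieEquiv.map_lie, LieEquiv.apply_symm_apply]

lemma adAdjoint_conj (φ : 𝔤 ≃ₗ⁅ℝ⁆ 𝔤) (C : 𝔤 →L[ℝ] 𝔤) :
    adAdjoint (autL φ * C * autL φ.symm) = φ (adAdjoint C) := by
  refine ext_inner_right ℝ fun y => ?_
  conv_rhs => rw [← φ.apply_symm_apply y, inner_equiv]
  rw [inner_adAdjoint, inner_adAdjoint]
  have h : adL (φ.symm y) = autL φ.symm * adL y * autL φ := adL_equiv φ.symm y
  rw [h, mul_assoc, mul_assoc, trL_mul_comm]
  simp only [mul_assoc]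

end Killing

/-! ### Local expressions and uniqueness of local inverses -/

section Jets

variable {𝔤 : Type*} [LieRing 𝔤] [LieAlgebra ℝ 𝔤] [IsCompactType 𝔤]
  {E : Type*} [NormedAddCommGroup E] [NormedSpace ℝ E]
  {E' : Type*} [NormedAddCommGroup E'] [NormedSpace ℝ E']
  {G : Type*} [NormedAddCommGroup G] [NormedSpace ℝ G] {N : Set 𝔤}

/-- `F(γ)(x)` is a smooth function of finitely many derivatives of `γ` at `x`. -/
def IsJet (N : Set 𝔤) (F : (ℝ → 𝔤) → ℝ → E) : Prop :=
  ∃ k : ℕ, ∃ f : (Fin k → 𝔤) → E, ContDiff ℝ ∞ f ∧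
    ∀ γ ∈ smoothCurves N, ∀ x, F γ x = f (fun i => iteratedDeriv i γ x)

lemma IsJet.congr {F F' : (ℝ → 𝔤) → ℝ → E} (h : IsJet N F)
    (h' : ∀ γ ∈ smoothCurves N, ∀ x, F' γ x = F γ x) : IsJet N F' := by
  obtain ⟨k, f, hf, hF⟩ := h
  exact ⟨k, f, hf, fun γ hγ x => (h' γ hγ x).trans (hF γ hγ x)⟩

lemma IsJet.comp₂ {g : E → E' → G} (hg : ContDiff ℝ ∞ (fun z : E × E' => g z.1 z.2))
    {F : (ℝ → 𝔤) → ℝ → E} {F' : (ℝ → 𝔤) → ℝ → E'} (h : IsJet N F) (h' : IsJet N F') :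
    IsJet N (fun γ x => g (F γ x) (F' γ x)) := by
  obtain ⟨k, f, hf, hF⟩ := h
  obtain ⟨k', f', hf', hF'⟩ := h'
  refine ⟨max k k', fun v => g (f fun i => v (i.castLE (le_max_left _ _)))
    (f' fun i => v (i.castLE (le_max_right _ _))), ?_, fun γ hγ x => ?_⟩
  · exact hg.comp ((hf.comp (by fun_prop)).prodMk (hf'.comp (by fun_prop)))
  · simp [hF γ hγ x, hF' γ hγ x]

lemma isJet_const (c : E) : IsJet N (fun _ _ => c) :=
  ⟨0, fun _ => c, contDiff_const, fun _ _ _ => rfl⟩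

lemma isJet_self : IsJet N (fun γ x => γ x) :=
  ⟨1, fun v => v 0, by fun_prop, fun γ _ x => by simp⟩

lemma IsJet.comp {g : E → G} (hg : ContDiff ℝ ∞ g) {F : (ℝ → 𝔤) → ℝ → E} (h : IsJet N F) :
    IsJet N (fun γ x => g (F γ x)) :=
  h.comp₂ (g := fun z (_ : E) => g z) (hg.comp contDiff_fst) h

lemma IsJet.add {F F' : (ℝ → 𝔤) → ℝ → E} (h : IsJet N F) (h' : IsJet N F') :
    IsJet N (fun γ x => F γ x + F' γ x) := h.comp₂ contDiff_add h'

lemma IsJet.sub {F F' : (ℝ → 𝔤) → ℝ → E} (h : IsJet N F) (h' : IsJet N F') :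
    IsJet N (fun γ x => F γ x - F' γ x) := h.comp₂ (contDiff_fst.sub contDiff_snd) h'

lemma IsJet.neg {F : (ℝ → 𝔤) → ℝ → E} (h : IsJet N F) : IsJet N (fun γ x => -F γ x) :=
  h.comp contDiff_neg

lemma IsJet.sum {ι : Type*} (s : Finset ι) {F : ι → (ℝ → 𝔤) → ℝ → E}
    (h : ∀ i ∈ s, IsJet N (F i)) : IsJet N (fun γ x => ∑ i ∈ s, F i γ x) := by
  classical
  induction s using Finset.induction_on with
  | empty => simpa using isJet_const (0 : E)
  | insert i s hi ih =>
    simp only [Finset.sum_insert hi]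
    exact (h i (by simp)).add (ih fun j hj => h j (by simp [hj]))

lemma IsJet.contDiff {F : (ℝ → 𝔤) → ℝ → E} (h : IsJet N F) {γ : ℝ → 𝔤}
    (hγ : γ ∈ smoothCurves N) : ContDiff ℝ ∞ (F γ) := by
  obtain ⟨k, f, hf, hF⟩ := h
  rw [show F γ = fun x => f (fun i : Fin k => iteratedDeriv i γ x) from funext (hF γ hγ)]
  refine hf.comp (contDiff_pi.2 fun i => ?_)
  rw [contDiff_infty]
  intro n
  have h1 : ContDiff ℝ ((n + i : ℕ) : ℕ∞ω) γ := hγ.1.of_le (by exact_mod_cast le_top)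
  rw [iteratedDeriv_eq_iterate]
  exact ContDiff.iterate_deriv' n i (by exact_mod_cast h1)

lemma IsJet.differentiable {F : (ℝ → 𝔤) → ℝ → E} (h : IsJet N F) {γ : ℝ → 𝔤}
    (hγ : γ ∈ smoothCurves N) : Differentiable ℝ (F γ) :=
  (h.contDiff hγ).differentiable (by simp)

lemma IsJet.deriv {F : (ℝ → 𝔤) → ℝ → E} (h : IsJet N F) :
    IsJet N (fun γ x => deriv (F γ) x) := by
  obtain ⟨k, f, hf, hF⟩ := h
  refine ⟨k + 1, fun v => fderiv ℝ f (fun i => v i.castSucc) (fun i => v i.succ), ?_,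
    fun γ hγ x => ?_⟩
  · exact ((hf.fderiv_right (m := ∞) (by simp)).comp (by fun_prop)).clm_apply (by fun_prop)
  · change _root_.deriv (F γ) x = _
    rw [show F γ = fun x => f (fun i : Fin k => iteratedDeriv i γ x) from funext (hF γ hγ)]
    have hj : HasDerivAt (fun x => fun i : Fin k => iteratedDeriv i γ x)
        (fun i : Fin k => iteratedDeriv (i + 1) γ x) x := by
      rw [hasDerivAt_pi]
      intro i
      rw [iteratedDeriv_succ]
      exact (hγ.1.differentiable_iteratedDeriv i (by exact_mod_cast WithTop.coe_lt_top _)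
        x).hasDerivAt
    have hfd := (hf.differentiable (by simp) (fun i : Fin k => iteratedDeriv i γ x)).hasFDerivAt
    exact (hfd.comp_hasDerivAt x hj).deriv

lemma IsJet.exists_local {F : (ℝ → 𝔤) → ℝ → E} (h : IsJet N F) :
    ∃ k : ℕ, ∀ γ ∈ smoothCurves N, ∀ γ' ∈ smoothCurves N, ∀ x : ℝ,
      (∀ i ≤ k, iteratedDeriv i γ x = iteratedDeriv i γ' x) → F γ x = F γ' x := by
  obtain ⟨k, f, hf, hF⟩ := h
  refine ⟨k, fun γ hγ γ' hγ' x hx => ?_⟩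
  rw [hF γ hγ, hF γ' hγ']
  congr 1
  ext i
  exact hx i i.2.le

/-- A local expression sees only germs. Along the comparison curve `γ'` its norm is constant, so
vanishing where `γ'` is constant is carried to `x`, where `γ'` agrees with `γ`. -/
lemma eq_zero_of_local {E : Type*} [NormedAddCommGroup E] {F : (ℝ → 𝔤) → ℝ → E}
    (hloc : ∃ k : ℕ, ∀ γ ∈ smoothCurves N, ∀ γ' ∈ smoothCurves N, ∀ x : ℝ,
      (∀ i ≤ k, iteratedDeriv i γ x = iteratedDeriv i γ' x) → F γ x = F γ' x)
    (hconst : ∀ γ ∈ smoothCurves N, ∀ x y, ‖F γ x‖ = ‖F γ y‖)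
    {γ γ' : ℝ → 𝔤} (hγ : γ ∈ smoothCurves N) (hγ' : γ' ∈ smoothCurves N) {v : 𝔤} (hv : v ∈ N)
    (h0 : ∀ x, F (fun _ => v) x = 0) {x y : ℝ} (hx : γ' =ᶠ[𝓝 x] γ) (hy : γ' =ᶠ[𝓝 y] fun _ => v) :
    F γ x = 0 := by
  obtain ⟨k, hk⟩ := hloc
  rw [← hk γ' hγ' γ hγ x fun i _ => hx.iteratedDeriv_eq i, ← norm_eq_zero, hconst γ' hγ' x y,
    hk γ' hγ' _ ⟨contDiff_const, fun _ => hv⟩ y fun i _ => hy.iteratedDeriv_eq i, h0, norm_zero]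

lemma exists_cutoff (x : ℝ) : ∃ b : ℝ → ℝ, ContDiff ℝ ∞ b ∧ (b =ᶠ[𝓝 x] fun _ => 1) ∧
    b =ᶠ[𝓝 (x + 3)] fun _ => 0 := by
  let b : ContDiffBump x := ⟨1, 2, by norm_num, by norm_num⟩
  refine ⟨b, b.contDiff, b.eventuallyEq_one, ?_⟩
  have : {y | 2 < dist y x} ∈ 𝓝 (x + 3) :=
    (isOpen_lt continuous_const (by fun_prop)).mem_nhds (by simp; norm_num)
  filter_upwards [this] with y hy using b.zero_of_le_dist hy.le

/-- The set `N` need not be linear, so the cutoff acts on the parameter: `y ↦ γ(x + b(y)(y - x))`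
stays in `N` and becomes constant near `x + 3`. -/
lemma eq_zero_of_local_of_const {E : Type*} [NormedAddCommGroup E] {F : (ℝ → 𝔤) → ℝ → E}
    (hloc : ∃ k : ℕ, ∀ γ ∈ smoothCurves N, ∀ γ' ∈ smoothCurves N, ∀ x : ℝ,
      (∀ i ≤ k, iteratedDeriv i γ x = iteratedDeriv i γ' x) → F γ x = F γ' x)
    (hconst : ∀ γ ∈ smoothCurves N, ∀ x y, ‖F γ x‖ = ‖F γ y‖)
    (h0 : ∀ v ∈ N, ∀ x, F (fun _ => v) x = 0) {γ : ℝ → 𝔤} (hγ : γ ∈ smoothCurves N) (x : ℝ) :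
    F γ x = 0 := by
  obtain ⟨b, hb, hb1, hb0⟩ := exists_cutoff x
  refine eq_zero_of_local hloc hconst (γ' := fun y => γ (x + b y * (y - x))) (v := γ x)
    (y := x + 3) hγ ⟨hγ.1.comp (by fun_prop), fun _ => hγ.2 _⟩ (hγ.2 x) (h0 _ (hγ.2 x)) ?_ ?_
  · filter_upwards [hb1] with y hy
    rw [hy, one_mul, add_sub_cancel]
  · filter_upwards [hb0] with y hy
    rw [hy, zero_mul, add_zero]

/-- In a linear target the cutoff multiplies the curve itself and reaches zero, so a normalization
at the zero curve suffices. -/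
lemma eq_zero_of_local_of_zero {E : Type*} [NormedAddCommGroup E] {𝔪 : Submodule ℝ 𝔤} {F : (ℝ → 𝔤) → ℝ → E}
    (hloc : ∃ k : ℕ, ∀ γ ∈ smoothCurves (𝔪 : Set 𝔤), ∀ γ' ∈ smoothCurves (𝔪 : Set 𝔤), ∀ x : ℝ,
      (∀ i ≤ k, iteratedDeriv i γ x = iteratedDeriv i γ' x) → F γ x = F γ' x)
    (hconst : ∀ γ ∈ smoothCurves (𝔪 : Set 𝔤), ∀ x y, ‖F γ x‖ = ‖F γ y‖)
    (h0 : ∀ x, F (fun _ => 0) x = 0) {γ : ℝ → 𝔤} (hγ : γ ∈ smoothCurves (𝔪 : Set 𝔤)) (x : ℝ) :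
    F γ x = 0 := by
  obtain ⟨b, hb, hb1, hb0⟩ := exists_cutoff x
  refine eq_zero_of_local hloc hconst (γ' := fun y => b y • γ y) (v := 0)
    (y := x + 3) hγ ⟨hb.smul hγ.1, fun y => 𝔪.smul_mem _ (hγ.2 y)⟩ 𝔪.zero_mem h0 ?_ ?_
  · filter_upwards [hb1] with y hy
    rw [hy, one_smul]
  · filter_upwards [hb0] with y hy
    rw [hy, zero_smul]

lemma eq_of_hasDerivAt_zero {f : ℝ → E} (h : ∀ x, HasDerivAt f 0 x) (x y : ℝ) : f x = f y :=
  is_const_of_deriv_eq_zero (fun x => (h x).differentiableAt) (fun x => (h x).deriv) x y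

lemma IsPrimitive.eq {𝔪 : Submodule ℝ 𝔤} {F F' P P' : CurveFun 𝔤} (h : IsPrimitive 𝔪 F P)
    (h' : IsPrimitive 𝔪 F' P') (hF : ∀ q ∈ smoothCurves (𝔪 : Set 𝔤), ∀ x, F' q x = F q x)
    {q : ℝ → 𝔤} (hq : q ∈ smoothCurves (𝔪 : Set 𝔤)) : P' q = P q := by
  funext x
  rw [← sub_eq_zero]
  refine eq_zero_of_local_of_zero (F := fun γ x => P' γ x - P γ x) ?_ (fun γ hγ x y => ?_)
    (fun x => by rw [h.2.2, h'.2.2, sub_zero]) hq x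
  · obtain ⟨⟨k, hk⟩, -⟩ := h
    obtain ⟨⟨k', hk'⟩, -⟩ := h'
    refine ⟨max k k', fun γ hγ γ' hγ' x hx => ?_⟩
    rw [hk γ hγ γ' hγ' x fun i hi => hx i (hi.trans (le_max_left _ _)),
      hk' γ hγ γ' hγ' x fun i hi => hx i (hi.trans (le_max_right _ _))]
  · congr 1
    refine eq_of_hasDerivAt_zero (f := fun x => P' γ x - P γ x) (fun z => ?_) x y
    simpa [hF γ hγ z] using (h'.2.1 γ hγ z).fun_sub (h.2.1 γ hγ z)

/-- The difference of two solutions lies in the kernel of `ad(γ)` and its derivative in the range.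
These are orthogonal because `ad(γ)` is skew, so the norm of the difference is constant. -/
lemma IsHPrimitive.eq {c : ℝ} {F F' P P' : CurveFun 𝔤} (h : IsHPrimitive N c F P)
    (h' : IsHPrimitive N c F' P') (hF : ∀ γ ∈ smoothCurves N, ∀ x, F' γ x = F γ x)
    {γ : ℝ → 𝔤} (hγ : γ ∈ smoothCurves N) : P' γ = P γ := by
  funext x
  rw [← sub_eq_zero]
  refine eq_zero_of_local_of_const (F := fun γ x => P' γ x - P γ x) ?_ (fun γ hγ x y => ?_)
    (fun v hv x => by rw [h.2.2 v hv, h'.2.2 v hv, sub_zero]) hγ x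
  · obtain ⟨⟨k, hk⟩, -⟩ := h
    obtain ⟨⟨k', hk'⟩, -⟩ := h'
    refine ⟨max k k', fun γ hγ γ' hγ' x hx => ?_⟩
    rw [hk γ hγ γ' hγ' x fun i hi => hx i (hi.trans (le_max_left _ _)),
      hk' γ hγ γ' hγ' x fun i hi => hx i (hi.trans (le_max_right _ _))]
  · obtain ⟨hd, he⟩ := h.2.1 γ hγ
    obtain ⟨hd', he'⟩ := h'.2.1 γ hγ
    have key : ∀ z, HasDerivAt (fun z => ‖P' γ z - P γ z‖ ^ 2) 0 z := by
      intro z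
      have h1 := ((hd' z).hasDerivAt.fun_sub (hd z).hasDerivAt).norm_sq
      convert h1 using 1
      set D := deriv (P' γ) z - deriv (P γ) z with hD
      have h2 : D = -c • ⁅γ z, ⁅γ z, D⁆⁆ := by
        have h3 := (he' z).2
        rw [hF γ hγ z, ← (he z).2] at h3
        rw [hD, lie_sub, lie_sub, smul_sub, neg_smul, neg_smul]
        rw [← sub_eq_zero] at h3 ⊢
        rw [← h3]
        module
      have h4 : ⁅γ z, P' γ z - P γ z⁆ = 0 := by
        rw [lie_sub, (he z).1, (he' z).1, sub_zero]
      have h5 := inner_lie_left (γ z) (P' γ z - P γ z) ⁅γ z, D⁆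
      rw [h4, inner_zero_left, eq_comm, neg_eq_zero] at h5
      rw [h2, inner_smul_right, h5, mul_zero, mul_zero]
    have := eq_of_hasDerivAt_zero key x y
    exact (sq_eq_sq₀ (norm_nonneg _) (norm_nonneg _)).1 this

end Jets

/-! ### Lowest-order perturbation of the cubic constraint for power series -/

section Series

open PowerSeries

variable {R : Type*} [Ring R]

lemma coeff_mul_of_vanish_left {n : ℕ} {E : PowerSeries R} (hE : ∀ i < n, coeff i E = 0)
    (V : PowerSeries R) : coeff n (E * V) = coeff n E * coeff 0 V := by
  rw [coeff_mul, Finset.sum_eq_single (n, 0)]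
  · rintro ⟨i, j⟩ hij hne
    rw [Finset.HasAntidiagonal.mem_antidiagonal] at hij
    have : i < n := by
      rcases Nat.eq_zero_or_pos j with rfl | hj
      · exact absurd (by simpa using hij) (by simpa using hne)
      · simp only at hij; omega
    simp [hE i this]
  · simp

lemma coeff_mul_of_vanish_right {n : ℕ} {E : PowerSeries R} (hE : ∀ i < n, coeff i E = 0)
    (V : PowerSeries R) : coeff n (V * E) = coeff 0 V * coeff n E := by
  rw [coeff_mul, Finset.sum_eq_single (0, n)]
  · rintro ⟨i, j⟩ hij hne
    rw [Finset.HasAntidiagonal.mem_antidiagonal] at hij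
    have : j < n := by
      rcases Nat.eq_zero_or_pos i with rfl | hj
      · exact absurd (by simpa using hij) (by simpa using hne)
      · simp only at hij; omega
    simp [hE j this]
  · simp

lemma coeff_mul_eq_zero_of_vanish_left {n : ℕ} {E : PowerSeries R} (hE : ∀ i < n, coeff i E = 0)
    (V : PowerSeries R) : ∀ i < n, coeff i (E * V) = 0 := fun i hi => by
  rw [coeff_mul_of_vanish_left (fun j hj => hE j (hj.trans hi)), hE i hi, zero_mul]

lemma coeff_mul_eq_zero_of_vanish_right {n : ℕ} {E : PowerSeries R} (hE : ∀ i < n, coeff i E = 0)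
    (V : PowerSeries R) : ∀ i < n, coeff i (V * E) = 0 := fun i hi => by
  rw [coeff_mul_of_vanish_right (fun j hj => hE j (hj.trans hi)), hE i hi, mul_zero]

/-- The polynomial `ℓ³ + ℓ`. -/
def cubic {R : Type*} [Ring R] (ℓ : R) : R := ℓ * ℓ * ℓ + ℓ

lemma coeff_zero_mul' (U V : PowerSeries R) : coeff 0 (U * V) = coeff 0 U * coeff 0 V := by
  simp [coeff_mul]

lemma coeff_cubicLin_of_vanish {n : ℕ} {E : PowerSeries R} (hE : ∀ i < n, coeff i E = 0)
    (S : PowerSeries R) : coeff n (cubicLin S E) = cubicLin (coeff 0 S) (coeff n E) := by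
  unfold cubicLin
  rw [map_add, map_add, map_add,
    coeff_mul_of_vanish_left (coeff_mul_eq_zero_of_vanish_left hE S),
    coeff_mul_of_vanish_left hE,
    coeff_mul_of_vanish_left (coeff_mul_eq_zero_of_vanish_right hE S),
    coeff_mul_of_vanish_right hE, coeff_mul_of_vanish_right hE, coeff_zero_mul']

/-- A perturbation starting at order `n > 0` enters the coefficient of order `n` only through the
linearization at the constant term. -/
lemma coeff_cubic_add_of_vanish {n : ℕ} (hn : 0 < n) {E : PowerSeries R}
    (hE : ∀ i < n, coeff i E = 0) (S : PowerSeries R) :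
    coeff n (cubic (S + E)) = coeff n (cubic S) + cubicLin (coeff 0 S) (coeff n E) := by
  have h1 : cubic (S + E) = cubic S + (E * ((S + E) * (S + E)) + S * E * (S + E) + S * S * E + E) := by
    unfold cubic; noncomm_ring
  have h0 : coeff 0 (S + E) = coeff 0 S := by rw [map_add, hE 0 hn, add_zero]
  rw [h1, map_add, map_add, map_add, map_add, coeff_mul_of_vanish_left hE,
    coeff_mul_of_vanish_left (coeff_mul_eq_zero_of_vanish_right hE S),
    coeff_mul_of_vanish_right hE, coeff_mul_of_vanish_right hE, coeff_zero_mul', coeff_zero_mul',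
    h0, cubicLin]
  noncomm_ring

lemma cubicLin_add (ℓ M N : R) : cubicLin ℓ (M + N) = cubicLin ℓ M + cubicLin ℓ N := by
  unfold cubicLin; noncomm_ring

/-- The Lax equation for a series implies the Lax equation for its cubic polynomial. -/
lemma coeff_cubicLin_of_lax {S S' E : PowerSeries R} {Q ℓ : R}
    (h : X * (S' + (C Q * S - S * C Q)) = (C ℓ * S - S * C ℓ) + X * E) (n : ℕ) :
    coeff n (cubicLin S S') + (Q * coeff n (cubic S) - coeff n (cubic S) * Q) =
      ℓ * coeff (n + 1) (cubic S) - coeff (n + 1) (cubic S) * ℓ + coeff n (cubicLin S E) := by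
  have hX : ∀ N : PowerSeries R, cubicLin S (X * N) = X * cubicLin S N := by
    intro N
    have e1 : S * (X * N) = X * (S * N) := by rw [← mul_assoc, (commute_X S).eq, mul_assoc]
    have e2 : S * S * (X * N) = X * (S * S * N) := by
      rw [← mul_assoc, (commute_X (S * S)).eq, mul_assoc]
    unfold cubicLin
    rw [e1, e2]
    noncomm_ring
  -- `cubicLin S` sends the value of a derivation on `S` to its value on `cubic S`; here the
  -- derivation is the commutator with `Y`.
  have hc : ∀ Y : PowerSeries R, cubicLin S (Y * S - S * Y) = Y * cubic S - cubic S * Y := by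
    intro Y
    unfold cubicLin cubic
    noncomm_ring
  have h1 := congrArg (cubicLin S) h
  rw [hX, cubicLin_add, cubicLin_add, hX, hc, hc] at h1
  have h2 := congrArg (coeff (n + 1)) h1
  rw [map_add, coeff_succ_X_mul, coeff_succ_X_mul] at h2
  simpa using h2

end Series

/-! ### Construction of the formal Lax solution, its locality and its gauge equivariance -/

section Lax

variable {𝔤 : Type*} [LieRing 𝔤]

/-- The orthogonal projection `1 + ad(B)²` to the centralizer of `B`, if `ad(B)³ = -ad(B)`. -/
def centProj (B y : 𝔤) : 𝔤 := y + ⁅B, ⁅B, y⁆⁆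

lemma lie_centProj {B : 𝔤} (hB : ∀ y : 𝔤, ⁅B, ⁅B, ⁅B, y⁆⁆⁆ = -⁅B, y⁆) (y : 𝔤) :
    ⁅B, centProj B y⁆ = 0 := by
  rw [centProj, lie_add, hB, add_neg_cancel]

lemma centProj_lie {B : 𝔤} (hB : ∀ y : 𝔤, ⁅B, ⁅B, ⁅B, y⁆⁆⁆ = -⁅B, y⁆) (y : 𝔤) :
    centProj B ⁅B, y⁆ = 0 := by
  rw [centProj, hB, add_neg_cancel]

lemma centProj_of_lie_eq_zero {B y : 𝔤} (h : ⁅B, y⁆ = 0) : centProj B y = y := by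
  rw [centProj, h, lie_zero, add_zero]

lemma centProj_add (B y z : 𝔤) : centProj B (y + z) = centProj B y + centProj B z := by
  simp only [centProj, lie_add]; abel

lemma centProj_neg (B y : 𝔤) : centProj B (-y) = -centProj B y := by
  rw [centProj, centProj, lie_neg, lie_neg, neg_add]

lemma centProj_zero (B : 𝔤) : centProj B 0 = 0 := by simp [centProj]

variable [LieAlgebra ℝ 𝔤]

lemma centProj_equiv (φ : 𝔤 ≃ₗ⁅ℝ⁆ 𝔤) (B y : 𝔤) : centProj (φ B) (φ y) = φ (centProj B y) := by
  simp only [centProj, map_add, LieEquiv.map_lie]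

variable [IsCompactType 𝔤]

lemma IsJet.op_mul {N : Set 𝔤} {F F' : (ℝ → 𝔤) → ℝ → (𝔤 →L[ℝ] 𝔤)} (h : IsJet N F) (h' : IsJet N F') :
    IsJet N (fun γ x => F γ x * F' γ x) :=
  h.comp₂ (g := fun y z => y * z) contDiff_mul h'

variable [FiniteDimensional ℝ 𝔤]

/-- The generating series of `ad` of a sequence. -/
noncomputable def adSeries (s : ℕ → 𝔤) : PowerSeries (𝔤 →L[ℝ] 𝔤) := .mk fun i => adL (s i)

@[simp] lemma coeff_adSeries (s : ℕ → 𝔤) (n : ℕ) : (adSeries s).coeff n = adL (s n) := by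
  simp [adSeries]

/-- The stages of the construction of the solution of the Lax equation. -/
noncomputable def laxStage (q B : ℝ → 𝔤) : ℕ → ℕ → ℝ → 𝔤
  | 0, i, x => if i = 0 then B x else 0
  | n + 1, i, x => if i = n + 1 then
      -⁅B x, deriv (laxStage q B n n) x + ⁅q x, laxStage q B n n x⁆⁆ -
        centProj (B x) (adAdjoint (cubicWeight (adL (B x)) *
          (cubic (adSeries fun j => laxStage q B n j x)).coeff (n + 1)))
      else laxStage q B n i x

/-- The coefficients `Xₙ` of the formal solution `X = ∑ Xₙ λ⁻ⁿ`, `X₀ = B`, of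
`Xₓ + [q, X] = λ[B, X]`, `ad(X)³ = -ad(X)`. -/
noncomputable def lax (q B : ℝ → 𝔤) (n : ℕ) : ℝ → 𝔤 := laxStage q B n n

lemma laxStage_of_le (q B : ℝ → 𝔤) {i n : ℕ} (h : i ≤ n) : laxStage q B n i = lax q B i := by
  induction n, h using Nat.le_induction with
  | base => rfl
  | succ n hn ih =>
    rw [← ih]
    funext x
    simp [laxStage, show i ≠ n + 1 by omega]

lemma laxStage_of_lt (q B : ℝ → 𝔤) {i n : ℕ} (h : n < i) (x : ℝ) : laxStage q B n i x = 0 := by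
  induction n with
  | zero => simp [laxStage, show i ≠ 0 by omega]
  | succ n ih => simp [laxStage, show i ≠ n + 1 by omega, ih (by omega)]

/-- The sequence `X₀, …, Xₙ, 0, 0, …`. -/
noncomputable def laxTrunc (q B : ℝ → 𝔤) (n : ℕ) (x : ℝ) (i : ℕ) : 𝔤 :=
  if i ≤ n then lax q B i x else 0

lemma lax_zero (q B : ℝ → 𝔤) : lax q B 0 = B := by
  funext x
  simp [lax, laxStage]

/-- The first term is the part in the range of `ad(B)` that the Lax equation prescribes. The second
commutes with `B`: it is the projected correction, obtained by inverting the linearized cubic, aimed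
at the coefficient of order `n + 1` of the cubic. -/
lemma lax_succ (q B : ℝ → 𝔤) (n : ℕ) (x : ℝ) : lax q B (n + 1) x =
    -⁅B x, deriv (lax q B n) x + ⁅q x, lax q B n x⁆⁆ -
      centProj (B x) (adAdjoint (cubicWeight (adL (B x)) *
        (cubic (adSeries (laxTrunc q B n x))).coeff (n + 1))) := by
  have h : (fun j => laxStage q B n j x) = laxTrunc q B n x := by
    funext j
    rw [laxTrunc]
    split_ifs with hj
    · rw [laxStage_of_le q B hj]
    · exact laxStage_of_lt q B (by omega) x
  rw [lax, laxStage, if_pos rfl, h]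
  rfl

section Jets

variable {N : Set 𝔤}

lemma IsJet.lie {F F' : CurveFun 𝔤} (h : IsJet N F) (h' : IsJet N F') :
    IsJet N (fun γ x => ⁅F γ x, F' γ x⁆) :=
  h.comp₂ (g := fun y z => ⁅y, z⁆)
    (show ContDiff ℝ ∞ (fun z : 𝔤 × 𝔤 => adL z.1 z.2) by fun_prop) h'

lemma IsJet.centProj {F F' : CurveFun 𝔤} (h : IsJet N F) (h' : IsJet N F') :
    IsJet N (fun γ x => centProj (F γ x) (F' γ x)) :=
  h'.add (h.lie (h.lie h'))

lemma IsJet.coeff_cubic_adSeries {s : (ℝ → 𝔤) → ℝ → ℕ → 𝔤}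
    (h : ∀ i, IsJet N (fun γ x => s γ x i)) (n : ℕ) :
    IsJet N (fun γ x => (cubic (adSeries (s γ x))).coeff n) := by
  have h1 : ∀ i, IsJet N (fun γ x => adL (s γ x i)) := fun i => (h i).comp (by fun_prop)
  simp only [cubic, map_add, PowerSeries.coeff_mul, coeff_adSeries]
  refine (IsJet.sum _ fun p _ => ?_).add (h1 n)
  exact (IsJet.sum _ fun r _ => (h1 _).op_mul (h1 _)).op_mul (h1 _)

/-- The recursion uses only differentiation, brackets and linear maps, never a primitive; this is
the source of locality. -/
lemma isJet_lax {Q B : CurveFun 𝔤} (hQ : IsJet N Q) (hB : IsJet N B) (n : ℕ) :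
    IsJet N (fun γ => lax (Q γ) (B γ) n) := by
  induction n using Nat.strong_induction_on with
  | _ n ih =>
    cases n with
    | zero => simpa only [lax_zero] using hB
    | succ n =>
      have hn := ih n (by omega)
      have ht : ∀ i, IsJet N (fun γ x => laxTrunc (Q γ) (B γ) n x i) := by
        intro i
        unfold laxTrunc
        split_ifs with hi
        · exact ih i (by omega)
        · exact isJet_const 0
      have hw : IsJet N (fun γ x => cubicWeight (adL (B γ x))) :=
        hB.comp (g := fun b => cubicWeight (adL b)) (by unfold cubicWeight; fun_prop)
      refine IsJet.congr ?_ fun γ _ x => lax_succ (Q γ) (B γ) n x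
      exact (hB.lie (hn.deriv.add (hQ.lie hn))).neg.sub (hB.centProj
        ((hw.op_mul (IsJet.coeff_cubic_adSeries ht (n + 1))).comp (g := adAdjoint) (by fun_prop)))

end Jets

section Equivariance

/-- Conjugation with an automorphism. -/
noncomputable def conjHom (φ : 𝔤 ≃ₗ⁅ℝ⁆ 𝔤) : (𝔤 →L[ℝ] 𝔤) →+* (𝔤 →L[ℝ] 𝔤) where
  toFun C := autL φ * C * autL φ.symm
  map_one' := by rw [mul_one, autL_mul_autL_symm]
  map_mul' C D := by
    rw [show autL φ * C * autL φ.symm * (autL φ * D * autL φ.symm) =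
      autL φ * C * (autL φ.symm * autL φ) * (D * autL φ.symm) by noncomm_ring,
      autL_symm_mul_autL]
    noncomm_ring
  map_zero' := by simp
  map_add' C D := by noncomm_ring

lemma conjHom_adL (φ : 𝔤 ≃ₗ⁅ℝ⁆ 𝔤) (x : 𝔤) : conjHom φ (adL x) = adL (φ x) := (adL_equiv φ x).symm

lemma conjHom_smul (φ : 𝔤 ≃ₗ⁅ℝ⁆ 𝔤) (c : ℝ) (C : 𝔤 →L[ℝ] 𝔤) :
    conjHom φ (c • C) = c • conjHom φ C := by
  simp [conjHom]

lemma cubicWeight_equiv (φ : 𝔤 ≃ₗ⁅ℝ⁆ 𝔤) (x : 𝔤) :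
    cubicWeight (adL (φ x)) = conjHom φ (cubicWeight (adL x)) := by
  simp [cubicWeight, conjHom_smul, conjHom_adL]

lemma coeff_cubic_adSeries_equiv (φ : 𝔤 ≃ₗ⁅ℝ⁆ 𝔤) (s : ℕ → 𝔤) (n : ℕ) :
    (cubic (adSeries fun i => φ (s i))).coeff n = conjHom φ ((cubic (adSeries s)).coeff n) := by
  simp only [cubic, map_add, PowerSeries.coeff_mul, coeff_adSeries, map_sum, map_mul, conjHom_adL]

/-- In finite dimensions, differentiability of the operators on each fixed vector suffices: expand
`f` in an orthonormal basis. -/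
lemma hasDerivAt_op_apply {φ : ℝ → 𝔤 →L[ℝ] 𝔤} {φ' : 𝔤 →L[ℝ] 𝔤} {x : ℝ}
    (hφ : ∀ y, HasDerivAt (fun s => φ s y) (φ' y) x) {f : ℝ → 𝔤} {f' : 𝔤} (hf : HasDerivAt f f' x) :
    HasDerivAt (fun s => φ s (f s)) (φ' (f x) + φ x f') x := by
  have h : ∀ (ψ : 𝔤 →L[ℝ] 𝔤) (y : 𝔤), ψ y = ∑ i, inner ℝ (stdOrthonormalBasis ℝ 𝔤 i) y •
      ψ (stdOrthonormalBasis ℝ 𝔤 i) := fun ψ y => by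
    conv_lhs => rw [← (stdOrthonormalBasis ℝ 𝔤).sum_repr' y]
    simp
  rw [h φ' (f x), h (φ x) f', ← Finset.sum_add_distrib]
  rw [show (fun s => φ s (f s)) = _ from funext fun s => h (φ s) (f s)]
  refine HasDerivAt.fun_sum fun i _ => ?_
  have h1 : HasDerivAt (fun s => inner ℝ (stdOrthonormalBasis ℝ 𝔤 i) (f s))
      (inner ℝ (stdOrthonormalBasis ℝ 𝔤 i) f') x :=
    (innerSL ℝ (stdOrthonormalBasis ℝ 𝔤 i)).hasFDerivAt.comp_hasDerivAt x hf
  exact h1.smul (hφ _)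

/-- `ψₓ = ψ ad(b)` along a curve of automorphisms. -/
def HasLogDeriv (ψ : ℝ → 𝔤 ≃ₗ⁅ℝ⁆ 𝔤) (b : ℝ → 𝔤) (s : Set ℝ) : Prop :=
  ∀ x ∈ s, ∀ y, HasDerivAt (fun s => ψ s y) (ψ x ⁅b x, y⁆) x

lemma HasLogDeriv.apply {ψ : ℝ → 𝔤 ≃ₗ⁅ℝ⁆ 𝔤} {b : ℝ → 𝔤} {s : Set ℝ} (h : HasLogDeriv ψ b s)
    {x : ℝ} (hx : x ∈ s) {f : ℝ → 𝔤} {f' : 𝔤} (hf : HasDerivAt f f' x) :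
    HasDerivAt (fun s => ψ s (f s)) (ψ x (f' + ⁅b x, f x⁆)) x := by
  rw [map_add, add_comm]
  exact hasDerivAt_op_apply (φ := fun s => autL (ψ s)) (φ' := autL (ψ x) * adL (b x))
    (fun y => h x hx y) hf

/-- Conjugation by `ψ` carries `Dₓ + ad(q)` to `Dₓ + ad(ψ(q - b))`, and every other ingredient of
the recursion commutes with automorphisms. -/
lemma lax_equivariant {ψ : ℝ → 𝔤 ≃ₗ⁅ℝ⁆ 𝔤} {b : ℝ → 𝔤} (h : HasLogDeriv ψ b univ)
    {q B q' B' : ℝ → 𝔤} (hq : ∀ x, q' x = ψ x (q x - b x)) (hB : ∀ x, B' x = ψ x (B x))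
    (hd : ∀ n, Differentiable ℝ (lax q B n)) (n : ℕ) (x : ℝ) :
    lax q' B' n x = ψ x (lax q B n x) := by
  induction n using Nat.strong_induction_on generalizing x with
  | _ n ih =>
    cases n with
    | zero => rw [lax_zero, lax_zero, hB]
    | succ n =>
      have h1 : deriv (lax q' B' n) x + ⁅q' x, lax q' B' n x⁆ =
          ψ x (deriv (lax q B n) x + ⁅q x, lax q B n x⁆) := by
        rw [show lax q' B' n = fun x => ψ x (lax q B n x) from funext (ih n (by omega)),
          (h.apply (mem_univ x) (hd n x).hasDerivAt).deriv, hq, ← LieEquiv.map_lie, ← map_add,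
          sub_lie]
        congr 1
        abel
      have h2 : laxTrunc q' B' n x = fun i => ψ x (laxTrunc q B n x i) := by
        funext i
        unfold laxTrunc
        split_ifs with hi
        · exact ih i (by omega) x
        · exact (map_zero _).symm
      rw [lax_succ, lax_succ, h1, h2, hB, coeff_cubic_adSeries_equiv, cubicWeight_equiv, ← map_mul]
      rw [show ∀ C, conjHom (ψ x) C = autL (ψ x) * C * autL (ψ x).symm from fun _ => rfl,
        adAdjoint_conj, centProj_equiv, ← LieEquiv.map_lie, map_sub, map_neg]

end Equivariance

end Lax

/-! ### The Lax equation and the cubic constraint -/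

section LaxEquation

namespace IsHermitianSymmetric

variable {𝔤 : Type*} [LieRing 𝔤] [LieAlgebra ℝ 𝔤] {𝔥 : LieSubalgebra ℝ 𝔤} {𝔪 : Submodule ℝ 𝔤} {A : 𝔤}

lemma exists_add (hA : IsHermitianSymmetric 𝔥 𝔪 A) (y : 𝔤) : ∃ a ∈ 𝔥, ∃ z ∈ 𝔪, a + z = y :=
  Submodule.mem_sup.1 (hA.isCompl.sup_eq_top ▸ Submodule.mem_top)

lemma lie_mem (hA : IsHermitianSymmetric 𝔥 𝔪 A) (y : 𝔤) : ⁅A, y⁆ ∈ 𝔪 := by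
  obtain ⟨a, ha, z, hz, rfl⟩ := hA.exists_add y
  rw [lie_add, (hA.centralizer a).2 ha, zero_add]
  exact hA.lie_h_m A hA.mem z hz

lemma cube (hA : IsHermitianSymmetric 𝔥 𝔪 A) (y : 𝔤) : ⁅A, ⁅A, ⁅A, y⁆⁆⁆ = -⁅A, y⁆ :=
  hA.sq _ (hA.lie_mem y)

lemma centProj_of_mem (hA : IsHermitianSymmetric 𝔥 𝔪 A) {y : 𝔤} (hy : y ∈ 𝔪) :
    centProj A y = 0 := by
  rw [centProj, hA.sq y hy, add_neg_cancel]

end IsHermitianSymmetric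

variable {𝔤 : Type*} [LieRing 𝔤] [LieAlgebra ℝ 𝔤] [FiniteDimensional ℝ 𝔤] [IsCompactType 𝔤]

lemma adL_cube {B : 𝔤} (hB : ∀ y : 𝔤, ⁅B, ⁅B, ⁅B, y⁆⁆⁆ = -⁅B, y⁆) :
    adL B * adL B * adL B = -adL B := by
  ext y
  simpa using hB y

/-- For constant `B` and `q = 0` the formal solution is `X = B`. -/
lemma lax_const {B : 𝔤} (n : ℕ) :
    lax (fun _ => 0) (fun _ => B) (n + 1) = fun _ => 0 := by
  induction n using Nat.strong_induction_on with
  | _ n ih =>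
    funext x
    have h1 : deriv (lax (fun _ => (0 : 𝔤)) (fun _ => B) n) x = 0 := by
      cases n with
      | zero => rw [lax_zero, deriv_const]
      | succ n => rw [ih n (by omega), deriv_const]
    have h2 : adSeries (laxTrunc (fun _ => 0) (fun _ => B) n x) = PowerSeries.C (adL B) := by
      ext1 i
      rw [coeff_adSeries, PowerSeries.coeff_C, laxTrunc]
      cases i with
      | zero => simp [lax_zero]
      | succ i =>
        rw [if_neg (Nat.succ_ne_zero i)]
        split_ifs with hi
        · rw [ih i (by omega), map_zero]
        · rw [map_zero]
    rw [lax_succ, h1, h2, cubic, ← map_mul, ← map_mul, ← map_add, PowerSeries.coeff_C,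
      if_neg (Nat.succ_ne_zero n)]
    simp [centProj_zero]

lemma hasDerivAt_coeff_cubic {s s' : ℝ → ℕ → 𝔤} {x : ℝ}
    (h : ∀ i, HasDerivAt (fun x => s x i) (s' x i) x) (n : ℕ) :
    HasDerivAt (fun x => (cubic (adSeries (s x))).coeff n)
      ((cubicLin (adSeries (s x)) (adSeries (s' x))).coeff n) x := by
  have h1 : ∀ i, HasDerivAt (fun x => (adSeries (s x)).coeff i) ((adSeries (s' x)).coeff i) x := by
    intro i
    simp only [coeff_adSeries]
    exact adL.hasFDerivAt.comp_hasDerivAt x (h i)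
  have hmul : ∀ {U V : ℝ → PowerSeries (𝔤 →L[ℝ] 𝔤)} {U' V' : PowerSeries (𝔤 →L[ℝ] 𝔤)},
      (∀ i, HasDerivAt (fun x => (U x).coeff i) (U'.coeff i) x) →
      (∀ i, HasDerivAt (fun x => (V x).coeff i) (V'.coeff i) x) →
      ∀ i, HasDerivAt (fun x => (U x * V x).coeff i) ((U' * V x + U x * V').coeff i) x := by
    intro U V U' V' hU hV i
    simp only [map_add, PowerSeries.coeff_mul, ← Finset.sum_add_distrib]
    exact HasDerivAt.fun_sum fun p _ => (hU p.1).mul (hV p.2)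
  have h3 := (hmul (hmul h1 h1) h1 n).fun_add (h1 n)
  have e : (cubicLin (adSeries (s x)) (adSeries (s' x))).coeff n =
      ((adSeries (s' x) * adSeries (s x) + adSeries (s x) * adSeries (s' x)) * adSeries (s x) +
        adSeries (s x) * adSeries (s x) * adSeries (s' x)).coeff n + (adSeries (s' x)).coeff n := by
    rw [← map_add, cubicLin, add_mul]
  rw [e]
  simpa only [cubic, map_add] using h3

section ConstantLax

variable {𝔥 : LieSubalgebra ℝ 𝔤} {𝔪 : Submodule ℝ 𝔤} {A : 𝔤}

/-- The covariant derivative of `Xₙ`. -/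
noncomputable def laxD (A : 𝔤) (q : ℝ → 𝔤) (n : ℕ) (x : ℝ) : 𝔤 :=
  deriv (lax q (fun _ => A) n) x + ⁅q x, lax q (fun _ => A) n x⁆

/-- The coefficients of `ad(X)³ + ad(X)`. -/
noncomputable def laxCubic (A : 𝔤) (q : ℝ → 𝔤) (n : ℕ) (x : ℝ) : 𝔤 →L[ℝ] 𝔤 :=
  (cubic (adSeries fun i => lax q (fun _ => A) i x)).coeff n

/-- By construction the Lax equation holds up to the component of `Xₙ' + [q, Xₙ]` in the centralizer
of `A`. This defect is what `lax_claim` shows to vanish. -/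
lemma lie_lax_succ (hA : IsHermitianSymmetric 𝔥 𝔪 A) (q : ℝ → 𝔤) (n : ℕ) (x : ℝ) :
    ⁅A, lax q (fun _ => A) (n + 1) x⁆ + centProj A (laxD A q n x) = laxD A q n x := by
  rw [lax_succ, lie_sub, lie_centProj hA.cube, sub_zero, lie_neg, centProj, laxD]
  abel

lemma differentiable_lax {q : ℝ → 𝔤} (hq : q ∈ smoothCurves (𝔪 : Set 𝔤)) (n : ℕ) :
    Differentiable ℝ (lax q (fun _ => A) n) :=
  (isJet_lax isJet_self (isJet_const A) n).differentiable hq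

/-- The Lax equation passes to the cubic of the series. If the defects below order `n` vanish, the
defect of order `n` enters only through the linearization at `ad(A)`. -/
lemma hasDerivAt_laxCubic (hA : IsHermitianSymmetric 𝔥 𝔪 A) {q : ℝ → 𝔤}
    (hq : q ∈ smoothCurves (𝔪 : Set 𝔤)) {n : ℕ} {x : ℝ}
    (hE : ∀ i < n, centProj A (laxD A q i x) = 0) :
    HasDerivAt (laxCubic A q n)
      (adL A * laxCubic A q (n + 1) x - laxCubic A q (n + 1) x * adL A +
        cubicLin (adL A) (adL (centProj A (laxD A q n x))) -
        (adL (q x) * laxCubic A q n x - laxCubic A q n x * adL (q x))) x := by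
  have h1 := hasDerivAt_coeff_cubic (s := fun x i => lax q (fun _ => A) i x)
    (s' := fun x i => deriv (lax q (fun _ => A) i) x) (x := x)
    (fun i => (differentiable_lax hq i x).hasDerivAt) n
  have hlax : PowerSeries.X * (adSeries (fun i => deriv (lax q (fun _ => A) i) x) +
      (PowerSeries.C (adL (q x)) * adSeries (fun i => lax q (fun _ => A) i x) -
        adSeries (fun i => lax q (fun _ => A) i x) * PowerSeries.C (adL (q x)))) =
      (PowerSeries.C (adL A) * adSeries (fun i => lax q (fun _ => A) i x) -
        adSeries (fun i => lax q (fun _ => A) i x) * PowerSeries.C (adL A)) +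
      PowerSeries.X * adSeries (fun i => centProj A (laxD A q i x)) := by
    ext1 i
    cases i with
    | zero => simp [PowerSeries.coeff_zero_X_mul, lax_zero, coeff_adSeries,
        -PowerSeries.coeff_zero_eq_constantCoeff]
    | succ i =>
      simp only [PowerSeries.coeff_succ_X_mul, map_add, map_sub, PowerSeries.coeff_C_mul,
        PowerSeries.coeff_mul_C, coeff_adSeries]
      rw [← adL_lie, ← adL_lie, ← map_add, ← map_add, lie_lax_succ hA, laxD]
  have h2 := coeff_cubicLin_of_lax hlax n
  rw [coeff_cubicLin_of_vanish (E := adSeries fun i => centProj A (laxD A q i x))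
    (fun i hi => by rw [coeff_adSeries, hE i hi, map_zero]), coeff_adSeries, coeff_adSeries,
    lax_zero, ← eq_sub_iff_add_eq] at h2
  rw [h2] at h1
  exact h1

/-- The correction in `lax_succ` was chosen for this. It removes the centralizer part of `adAdjoint`
of the weighted coefficient, and when the coefficient commutes with `ad(A)` there is no other part.
-/
lemma adAdjoint_laxCubic (hA : IsHermitianSymmetric 𝔥 𝔪 A) {q : ℝ → 𝔤} {n : ℕ} {x : ℝ}
    (hc : adL A * laxCubic A q (n + 1) x = laxCubic A q (n + 1) x * adL A) :
    adAdjoint (cubicWeight (adL A) * laxCubic A q (n + 1) x) = 0 := by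
  have hℓ := adL_cube hA.cube
  set S₀ := adSeries (laxTrunc q (fun _ => A) n x) with hS₀
  set D := deriv (lax q (fun _ => A) n) x + ⁅q x, lax q (fun _ => A) n x⁆ with hD
  set u := adAdjoint (cubicWeight (adL A) * (cubic S₀).coeff (n + 1)) with hu
  have hX : lax q (fun _ => A) (n + 1) x = ⁅A, -D⁆ + -centProj A u := by
    rw [lax_succ, lie_neg, sub_eq_add_neg]
  set E := adSeries (fun i => if i ≤ n then 0 else lax q (fun _ => A) i x) with hE
  have hsplit : adSeries (fun i => lax q (fun _ => A) i x) = S₀ + E := by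
    ext1 i
    rw [map_add, hS₀, hE, coeff_adSeries, coeff_adSeries, coeff_adSeries, ← map_add, laxTrunc]
    split_ifs <;> simp
  have h1 : laxCubic A q (n + 1) x = (cubic S₀).coeff (n + 1) +
      cubicLin (adL A) (adL (-centProj A u)) := by
    rw [laxCubic, hsplit, coeff_cubic_add_of_vanish (Nat.succ_pos n)]
    · rw [hS₀, hE, coeff_adSeries, coeff_adSeries, if_neg (by omega), laxTrunc,
        if_pos (Nat.zero_le n), lax_zero, hX, map_add, cubicLin_add, adL_lie,
        cubicLin_commutator hℓ, zero_add]
    · intro i hi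
      rw [hE, coeff_adSeries, if_pos (by omega), map_zero]
  have hcomm : adL A * adL (-centProj A u) = adL (-centProj A u) * adL A := by
    rw [← sub_eq_zero, ← adL_lie, lie_neg, lie_centProj hA.cube, neg_zero, map_zero]
  have h2 : adAdjoint (cubicWeight (adL A) * laxCubic A q (n + 1) x) = u - centProj A u := by
    rw [h1, mul_add, cubicWeight_mul_cubicLin hℓ hcomm, map_add, adAdjoint_adL, ← hu,
      sub_eq_add_neg]
  have h3 : ⁅A, u⁆ = 0 := by
    have h4 : ⁅A, adAdjoint (cubicWeight (adL A) * laxCubic A q (n + 1) x)⁆ = 0 := by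
      rw [lie_adAdjoint, ← mul_assoc, cubicWeight_commute, mul_assoc, hc, mul_assoc, sub_self,
        map_zero]
    rwa [h2, lie_sub, lie_centProj hA.cube, sub_zero] at h4
  rw [h2, centProj_of_lie_eq_zero h3, sub_self]

lemma laxCubic_const (hA : IsHermitianSymmetric 𝔥 𝔪 A) (n : ℕ) (x : ℝ) :
    laxCubic A (fun _ => 0) n x = 0 := by
  have h : adSeries (fun i => lax (fun _ => 0) (fun _ => A) i x) = PowerSeries.C (adL A) := by
    ext1 i
    rw [coeff_adSeries, PowerSeries.coeff_C]
    cases i with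
    | zero => simp [lax_zero]
    | succ i => rw [lax_const, map_zero, if_neg (Nat.succ_ne_zero i)]
  rw [laxCubic, h, cubic, ← map_mul, ← map_mul, ← map_add, adL_cube hA.cube, neg_add_cancel,
    map_zero, map_zero]

/-- Constraint and defect are treated together by induction on the order. The next cubic coefficient
first commutes with `ad(A)`, then its derivative yields the vanishing of the next defect, then the
coefficient is constant in `x`, and locality makes it zero. All curves `q` are handled at once
because the last step compares different curves. -/
lemma lax_claim (hA : IsHermitianSymmetric 𝔥 𝔪 A) (n : ℕ) :
    ∀ q ∈ smoothCurves (𝔪 : Set 𝔤), ∀ i ≤ n, ∀ x,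
      centProj A (laxD A q i x) = 0 ∧ laxCubic A q i x = 0 := by
  have hℓ := adL_cube hA.cube
  induction n with
  | zero =>
    intro q hq i hi x
    obtain rfl : i = 0 := by omega
    constructor
    · rw [laxD, lax_zero, deriv_const, zero_add, ← lie_skew]
      exact hA.centProj_of_mem (𝔪.neg_mem (hA.lie_mem _))
    · rw [laxCubic, cubic, map_add, coeff_zero_mul', coeff_zero_mul', coeff_adSeries, lax_zero, hℓ,
        neg_add_cancel]
  | succ n ih =>
    -- Differentiating the identically vanishing coefficient of order `n` leaves only the commutator
    -- of `ad(A)` with the next one.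
    have hcomm : ∀ q ∈ smoothCurves (𝔪 : Set 𝔤), ∀ x,
        adL A * laxCubic A q (n + 1) x = laxCubic A q (n + 1) x * adL A := by
      intro q hq x
      have h1 := hasDerivAt_laxCubic hA hq (n := n) (x := x) fun i hi => (ih q hq i hi.le x).1
      have h0 : laxCubic A q n = fun _ => 0 := funext fun x => (ih q hq n le_rfl x).2
      rw [h0] at h1
      have h2 := h1.unique (hasDerivAt_const x 0)
      rw [(ih q hq n le_rfl x).1] at h2
      rw [← sub_eq_zero]
      simpa [cubicLin] using h2
    have hτ : ∀ q ∈ smoothCurves (𝔪 : Set 𝔤), ∀ x,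
        adAdjoint (cubicWeight (adL A) * laxCubic A q (n + 1) x) = 0 :=
      fun q hq x => adAdjoint_laxCubic hA (hcomm q hq x)
    -- Since `ad(q) = [ad(A), Z]` and `C` commutes with `ad(A)`, the term `[ad(q), C]` is itself a
    -- commutator with `ad(A)` and is absorbed into `Y`.
    have hder : ∀ q ∈ smoothCurves (𝔪 : Set 𝔤), ∀ x, ∃ Y : 𝔤 →L[ℝ] 𝔤,
        HasDerivAt (laxCubic A q (n + 1)) (adL A * Y - Y * adL A +
          cubicLin (adL A) (adL (centProj A (laxD A q (n + 1) x)))) x := by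
      intro q hq x
      have h1 := hasDerivAt_laxCubic hA hq (n := n + 1) (x := x)
        fun i hi => (ih q hq i (by omega) x).1
      set C := laxCubic A q (n + 1) x with hC
      set C' := laxCubic A q (n + 2) x
      set Z := adL (-⁅A, q x⁆)
      have hZ : adL (q x) = adL A * Z - Z * adL A := by
        rw [← adL_lie, lie_neg, hA.sq _ (hq.2 x), neg_neg]
      have hc : adL A * C = C * adL A := hcomm q hq x
      refine ⟨C' - (Z * C - C * Z), ?_⟩
      convert h1 using 1
      have e1 : adL (q x) * C - C * adL (q x) =
          adL A * (Z * C - C * Z) - (Z * C - C * Z) * adL A := by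
        have e2 : adL A * (C * Z) = C * (adL A * Z) := by rw [← mul_assoc, hc, mul_assoc]
        have e3 : Z * C * adL A = Z * (adL A * C) := by rw [mul_assoc, hc]
        rw [hZ, mul_sub (adL A), sub_mul (Z * C), e2, e3]
        noncomm_ring
      rw [e1, mul_sub (adL A), sub_mul C']
      abel
    -- The vanishing quantity in `hτ` has derivative `[A, ·] + e`; projection to the centralizer
    -- isolates `e`.
    have he : ∀ q ∈ smoothCurves (𝔪 : Set 𝔤), ∀ x, centProj A (laxD A q (n + 1) x) = 0 := by
      intro q hq x
      obtain ⟨Y, hY⟩ := hder q hq x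
      set e := centProj A (laxD A q (n + 1) x) with he
      have hAe : ⁅A, e⁆ = 0 := lie_centProj hA.cube _
      have hce : adL A * adL e = adL e * adL A := by
        rw [← sub_eq_zero, ← adL_lie, hAe, map_zero]
      have h1 : HasDerivAt (fun x => adAdjoint (cubicWeight (adL A) * laxCubic A q (n + 1) x))
          (adAdjoint (cubicWeight (adL A) * (adL A * Y - Y * adL A +
            cubicLin (adL A) (adL e)))) x :=
        (adAdjoint (𝔤 := 𝔤)).hasFDerivAt.comp_hasDerivAt x (hY.const_mul (cubicWeight (adL A)))
      rw [funext (hτ q hq)] at h1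
      have h2 := h1.unique (hasDerivAt_const x 0)
      have h3 : cubicWeight (adL A) * (adL A * Y - Y * adL A) =
          adL A * (cubicWeight (adL A) * Y) - cubicWeight (adL A) * Y * adL A := by
        rw [mul_sub, ← mul_assoc, ← cubicWeight_commute, mul_assoc, mul_assoc]
      rw [mul_add, h3, cubicWeight_mul_cubicLin hℓ hce, map_add, ← lie_adAdjoint,
        adAdjoint_adL] at h2
      have h4 := congrArg (centProj A) h2
      rwa [centProj_add, centProj_lie hA.cube, centProj_of_lie_eq_zero hAe, zero_add,
        centProj_zero] at h4
    -- Without the defect, the derivative is a commutator with `ad(A)`, and it commutes with `ad(A)`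
    -- because the coefficient does for all `x`.
    have hconst : ∀ q ∈ smoothCurves (𝔪 : Set 𝔤), ∀ x, HasDerivAt (laxCubic A q (n + 1)) 0 x := by
      intro q hq x
      obtain ⟨Y, hY⟩ := hder q hq x
      rw [he q hq x, map_zero, show cubicLin (adL A) (0 : 𝔤 →L[ℝ] 𝔤) = 0 by simp [cubicLin],
        add_zero] at hY
      have h1 := hY.const_mul (adL A)
      rw [show (fun x => adL A * laxCubic A q (n + 1) x) = _ from funext (hcomm q hq)] at h1
      have h2 := h1.unique (hY.mul_const (adL A))
      rwa [commutator_eq_zero hℓ h2] at hY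
    intro q hq i hi x
    rcases Nat.lt_or_ge i (n + 1) with h | h
    · exact ih q hq i (by omega) x
    obtain rfl : i = n + 1 := by omega
    refine ⟨he q hq x, ?_⟩
    have hjet : IsJet (𝔪 : Set 𝔤) (fun q => laxCubic A q (n + 1)) :=
      IsJet.coeff_cubic_adSeries (fun i => isJet_lax isJet_self (isJet_const A) i) (n + 1)
    exact eq_zero_of_local_of_zero (F := fun q => laxCubic A q (n + 1)) hjet.exists_local
      (fun γ hγ x y => congrArg _ (eq_of_hasDerivAt_zero (hconst γ hγ) x y))
      (laxCubic_const hA (n + 1)) hq x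

/-- The Lax equation `∂ₓXₙ + [q, Xₙ] = [A, Xₙ₊₁]`. -/
theorem lax_equation (hA : IsHermitianSymmetric 𝔥 𝔪 A) {q : ℝ → 𝔤}
    (hq : q ∈ smoothCurves (𝔪 : Set 𝔤)) (n : ℕ) (x : ℝ) :
    deriv (lax q (fun _ => A) n) x + ⁅q x, lax q (fun _ => A) n x⁆ =
      ⁅A, lax q (fun _ => A) (n + 1) x⁆ := by
  have h := lie_lax_succ hA q n x
  rw [(lax_claim hA n q hq n le_rfl x).1, add_zero] at h
  exact h.symm

end ConstantLax

end LaxEquation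

/-! ### The isospectral hierarchy from the Lax equation -/

section IsospectralHierarchy

variable {𝔤 : Type*} [LieRing 𝔤] [LieAlgebra ℝ 𝔤]
  {𝔥 : LieSubalgebra ℝ 𝔤} {𝔪 : Submodule ℝ 𝔤} {A : 𝔤}

lemma IsHermitianSymmetric.centProj_mem (hA : IsHermitianSymmetric 𝔥 𝔪 A) (y : 𝔤) :
    centProj A y ∈ 𝔥 := (hA.centralizer _).1 (lie_centProj hA.cube y)

lemma IsHermitianSymmetric.lie_m_h (hA : IsHermitianSymmetric 𝔥 𝔪 A) {y a : 𝔤} (hy : y ∈ 𝔪)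
    (ha : a ∈ 𝔥) : ⁅y, a⁆ ∈ 𝔪 := by
  rw [← lie_skew]
  exact 𝔪.neg_mem (hA.lie_h_m a ha y hy)

/-- Since `[𝔪, 𝔥] ⊆ 𝔪` and `[𝔪, 𝔪] ⊆ 𝔥`, only the `𝔪`-part `-ad(A)²z` contributes. -/
lemma IsHermitianSymmetric.centProj_lie_m (hA : IsHermitianSymmetric 𝔥 𝔪 A) {y : 𝔤} (hy : y ∈ 𝔪)
    (z : 𝔤) : centProj A ⁅y, z⁆ = -⁅y, ⁅A, ⁅A, z⁆⁆⁆ := by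
  have h1 : ⁅y, z⁆ = ⁅y, centProj A z⁆ + -⁅y, ⁅A, ⁅A, z⁆⁆⁆ := by
    rw [centProj, lie_add, add_neg_cancel_right]
  rw [h1, centProj_add, hA.centProj_of_mem (hA.lie_m_h hy (hA.centProj_mem z)), zero_add]
  apply centProj_of_lie_eq_zero
  rw [lie_neg, (hA.centralizer _).2 (hA.lie_m_m y hy _ (hA.lie_mem _)), neg_zero]

variable [IsCompactType 𝔤]

lemma Dinv_eq {F F' P : CurveFun 𝔤} (h : IsPrimitive 𝔪 F P)
    (hF : ∀ q ∈ smoothCurves (𝔪 : Set 𝔤), ∀ x, F' q x = F q x)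
    {q : ℝ → 𝔤} (hq : q ∈ smoothCurves (𝔪 : Set 𝔤)) : Dinv 𝔪 F' q = P q := by
  have h' : IsPrimitive 𝔪 F' P :=
    ⟨h.1, fun q hq x => by rw [hF q hq x]; exact h.2.1 q hq x, h.2.2⟩
  have he : ∃ P, IsPrimitive 𝔪 F' P := ⟨P, h'⟩
  rw [Dinv, dif_pos he]
  exact IsPrimitive.eq h' he.choose_spec (fun _ _ _ => rfl) hq

variable [FiniteDimensional ℝ 𝔤]

lemma hasDerivAt_centProj (B : 𝔤) {f : ℝ → 𝔤} {f' : 𝔤} {x : ℝ} (h : HasDerivAt f f' x) :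
    HasDerivAt (fun x => centProj B (f x)) (centProj B f') x := by
  have h1 : HasDerivAt (fun x => (1 + adL B * adL B) (f x)) ((1 + adL B * adL B) f') x :=
    (1 + adL B * adL B).hasFDerivAt.comp_hasDerivAt x h
  exact h1

lemma centProj_deriv_lax (hA : IsHermitianSymmetric 𝔥 𝔪 A) {q : ℝ → 𝔤}
    (hq : q ∈ smoothCurves (𝔪 : Set 𝔤)) (n : ℕ) (x : ℝ) :
    centProj A (deriv (lax q (fun _ => A) n) x) =
      ⁅q x, ⁅A, ⁅A, lax q (fun _ => A) n x⁆⁆⁆ := by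
  have h := lax_equation hA hq n x
  rw [← eq_sub_iff_add_eq] at h
  rw [h, sub_eq_add_neg, centProj_add, centProj_lie hA.cube, zero_add, centProj_neg,
    hA.centProj_lie_m (hq.2 x), neg_neg]

/-- The `𝔥`-part of the Lax equation says that the `𝔥`-part of `Xₙ₊₁` has derivative `-[q, ·]` of
its `𝔪`-part, so the primitive in the recursion is already known and local. -/
lemma isPrimitive_lax (hA : IsHermitianSymmetric 𝔥 𝔪 A) {F : CurveFun 𝔤} {n : ℕ}
    (hF : ∀ q ∈ smoothCurves (𝔪 : Set 𝔤), ∀ x, F q x = -⁅A, lax q (fun _ => A) (n + 1) x⁆) :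
    IsPrimitive 𝔪 (adq (Jinv A F)) (fun q x => centProj A (lax q (fun _ => A) (n + 1) x)) := by
  refine ⟨?_, fun q hq x => ?_, fun x => ?_⟩
  · exact ((isJet_const A).centProj (isJet_lax isJet_self (isJet_const A) (n + 1))).exists_local
  · convert hasDerivAt_centProj A (differentiable_lax hq (n + 1) x).hasDerivAt using 1
    rw [centProj_deriv_lax hA hq]
    rw [adq, Jinv, hF q hq x, lie_neg A, neg_neg]
  · change centProj A (lax (fun _ => 0) (fun _ => A) (n + 1) x) = 0
    rw [lax_const, centProj_zero]

/-- The isospectral hierarchy in terms of the Lax equation. -/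
theorem Rop_iterate (hA : IsHermitianSymmetric 𝔥 𝔪 A) (n : ℕ) :
    ∀ q ∈ smoothCurves (𝔪 : Set 𝔤), ∀ x,
      ((Rop 𝔪 A)^[n] (Jq A)) q x = -⁅A, lax q (fun _ => A) (n + 1) x⁆ := by
  induction n with
  | zero =>
    intro q hq x
    rw [← lax_equation hA hq, lax_zero, deriv_const, zero_add, lie_skew]
    rfl
  | succ n ih =>
    intro q hq x
    rw [Function.iterate_succ_apply', ← lax_equation hA hq]
    set F := (Rop 𝔪 A)^[n] (Jq A) with hF
    have h1 : Jinv A F q = fun x => ⁅A, ⁅A, lax q (fun _ => A) (n + 1) x⁆⁆ := by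
      funext x
      rw [Jinv, ih q hq x, lie_neg A, neg_neg]
    have h2 : HasDerivAt (fun x => ⁅A, ⁅A, lax q (fun _ => A) (n + 1) x⁆⁆)
        ⁅A, ⁅A, deriv (lax q (fun _ => A) (n + 1)) x⁆⁆ x :=
      (adL A * adL A).hasFDerivAt.comp_hasDerivAt x
        (differentiable_lax hq (n + 1) x).hasDerivAt
    have h3 := centProj_deriv_lax hA hq (n + 1) x
    change deriv (Jinv A F q) x - ⁅q x, Dinv 𝔪 (adq (Jinv A F)) q x⁆ = _
    rw [Dinv_eq (isPrimitive_lax hA ih) (fun _ _ _ => rfl) hq, h1, h2.deriv]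
    simp only [centProj] at h3 ⊢
    rw [← eq_sub_iff_add_eq'] at h3
    rw [h3, lie_add]
    abel

end IsospectralHierarchy

/-! ### Partial derivatives of functions on the plane -/

section Calculus

variable {E : Type*} [NormedAddCommGroup E] [NormedSpace ℝ E]

lemma hasDerivAt_slice_fst {f : ℝ × ℝ → E} {U : Set (ℝ × ℝ)} (hU : IsOpen U)
    (hf : ContDiffOn ℝ ∞ f U) {x t : ℝ} (h : (x, t) ∈ U) :
    HasDerivAt (fun s => f (s, t)) (fderiv ℝ f (x, t) (1, 0)) x := by
  have h1 := ((hf.contDiffAt (hU.mem_nhds h)).differentiableAt (by simp)).hasFDerivAt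
  exact h1.comp_hasDerivAt x ((hasDerivAt_id x).prodMk (hasDerivAt_const x t))

lemma hasDerivAt_slice_snd {f : ℝ × ℝ → E} {U : Set (ℝ × ℝ)} (hU : IsOpen U)
    (hf : ContDiffOn ℝ ∞ f U) {x t : ℝ} (h : (x, t) ∈ U) :
    HasDerivAt (fun s => f (x, s)) (fderiv ℝ f (x, t) (0, 1)) t := by
  have h1 := ((hf.contDiffAt (hU.mem_nhds h)).differentiableAt (by simp)).hasFDerivAt
  exact h1.comp_hasDerivAt t ((hasDerivAt_const t x).prodMk (hasDerivAt_id t))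

lemma contDiffOn_fderiv_apply {f : ℝ × ℝ → E} {U : Set (ℝ × ℝ)} (hU : IsOpen U)
    (hf : ContDiffOn ℝ ∞ f U) (v : ℝ × ℝ) : ContDiffOn ℝ ∞ (fun p => fderiv ℝ f p v) U :=
  (hf.fderiv_of_isOpen hU (m := ∞) (by simp)).clm_apply contDiffOn_const

lemma fderiv_fderiv_comm {f : ℝ × ℝ → E} {U : Set (ℝ × ℝ)} (hU : IsOpen U)
    (hf : ContDiffOn ℝ ∞ f U) {p : ℝ × ℝ} (h : p ∈ U) (v w : ℝ × ℝ) :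
    fderiv ℝ (fun p => fderiv ℝ f p v) p w = fderiv ℝ (fun p => fderiv ℝ f p w) p v := by
  have h1 := hf.contDiffAt (hU.mem_nhds h)
  have h2 : DifferentiableAt ℝ (fderiv ℝ f) p :=
    (h1.fderiv_right (m := ∞) (by simp)).differentiableAt (by simp)
  have h3 : ∀ v w, fderiv ℝ (fun p => fderiv ℝ f p v) p w = fderiv ℝ (fderiv ℝ f) p w v := by
    intro v w
    rw [fderiv_clm_apply h2 (differentiableAt_const v)]
    simp
  rw [h3, h3]
  exact (h1.isSymmSndFDerivAt (by
    rw [minSmoothness_of_isRCLikeNormedField]; exact ENat.LEInfty.out)).eq w v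

lemma const_of_hasDerivAt_zero {S : Set ℝ} (hS : IsOpen S) (hS' : S.OrdConnected) {f : ℝ → E}
    (h : ∀ x ∈ S, HasDerivAt f 0 x) {x y : ℝ} (hx : x ∈ S) (hy : y ∈ S) : f x = f y :=
  hS.is_const_of_deriv_eq_zero hS'.isPreconnected
    (fun x hx => (h x hx).differentiableAt.differentiableWithinAt) (fun x hx => (h x hx).deriv)
    hx hy

end Calculus

/-! ### Linear equations in the automorphism group -/

section Aut

variable {𝔤 : Type*} [LieRing 𝔤] [LieAlgebra ℝ 𝔤]

lemma aut_mul_apply (φ φ' : 𝔤 ≃ₗ⁅ℝ⁆ 𝔤) (y : 𝔤) : (φ * φ') y = φ (φ' y) := rfl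

lemma aut_one_apply (y : 𝔤) : (1 : 𝔤 ≃ₗ⁅ℝ⁆ 𝔤) y = y := rfl

lemma aut_apply_inv_apply (φ : 𝔤 ≃ₗ⁅ℝ⁆ 𝔤) (y : 𝔤) : φ (φ⁻¹ y) = y := φ.apply_symm_apply y

lemma aut_inv_apply_apply (φ : 𝔤 ≃ₗ⁅ℝ⁆ 𝔤) (y : 𝔤) : φ⁻¹ (φ y) = y := φ.symm_apply_apply y

variable [IsCompactType 𝔤]

local notation "⟪" x ", " y "⟫" => inner ℝ x y

lemma inner_inv_left (φ : 𝔤 ≃ₗ⁅ℝ⁆ 𝔤) (x y : 𝔤) : ⟪φ⁻¹ x, y⟫ = ⟪x, φ y⟫ := by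
  rw [← inner_equiv φ, aut_apply_inv_apply]

lemma norm_equiv (φ : 𝔤 ≃ₗ⁅ℝ⁆ 𝔤) (x : 𝔤) : ‖φ x‖ = ‖x‖ := by
  rw [← sq_eq_sq₀ (norm_nonneg _) (norm_nonneg _), ← real_inner_self_eq_norm_sq,
    ← real_inner_self_eq_norm_sq, inner_equiv]

/-- `ad(b)` is skew, so the distance between two solutions is constant. -/
lemma eqOn_of_lie_ode {S : Set ℝ} (hS : IsOpen S) (hS' : S.OrdConnected) {b f g : ℝ → 𝔤}
    (hf : ∀ x ∈ S, HasDerivAt f ⁅b x, f x⁆ x) (hg : ∀ x ∈ S, HasDerivAt g ⁅b x, g x⁆ x)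
    {x₀ : ℝ} (hx₀ : x₀ ∈ S) (h0 : f x₀ = g x₀) {x : ℝ} (hx : x ∈ S) : f x = g x := by
  have key : ∀ z ∈ S, HasDerivAt (fun z => ‖f z - g z‖ ^ 2) 0 z := by
    intro z hz
    convert ((hf z hz).fun_sub (hg z hz)).norm_sq using 1
    have h := inner_lie_left (b z) (f z - g z) (f z - g z)
    rw [real_inner_comm] at h
    rw [← lie_sub]
    linarith
  have h1 := const_of_hasDerivAt_zero hS hS' key hx hx₀
  rw [h0, sub_self, norm_zero, zero_pow two_ne_zero, sq_eq_zero_iff, norm_eq_zero] at h1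
  exact sub_eq_zero.1 h1

variable [FiniteDimensional ℝ 𝔤]

lemma contDiffOn_of_inner {P : Type*} [NormedAddCommGroup P] [NormedSpace ℝ P] {U : Set P}
    {f : P → 𝔤} (h : ∀ z, ContDiffOn ℝ ∞ (fun p => ⟪f p, z⟫) U) : ContDiffOn ℝ ∞ f U := by
  have e : f = fun p => ∑ i, ⟪stdOrthonormalBasis ℝ 𝔤 i, f p⟫ • stdOrthonormalBasis ℝ 𝔤 i :=
    funext fun p => ((stdOrthonormalBasis ℝ 𝔤).sum_repr' (f p)).symm
  rw [e]
  exact ContDiffOn.sum fun i _ =>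
    ((h _).congr fun p _ => real_inner_comm _ _).smul contDiffOn_const

lemma hasDerivAt_of_inner {f : ℝ → 𝔤} {f' : 𝔤} {x : ℝ}
    (h : ∀ z, HasDerivAt (fun p => ⟪f p, z⟫) ⟪f', z⟫ x) : HasDerivAt f f' x := by
  have e : ∀ y : 𝔤, y = ∑ i, ⟪stdOrthonormalBasis ℝ 𝔤 i, y⟫ • stdOrthonormalBasis ℝ 𝔤 i :=
    fun y => ((stdOrthonormalBasis ℝ 𝔤).sum_repr' y).symm
  rw [e f', show f = _ from funext fun p => e (f p)]
  refine HasDerivAt.fun_sum fun i _ => HasDerivAt.smul_const ?_ _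
  simpa only [real_inner_comm (stdOrthonormalBasis ℝ 𝔤 i)] using h (stdOrthonormalBasis ℝ 𝔤 i)

lemma contDiffOn_autL {P : Type*} [NormedAddCommGroup P] [NormedSpace ℝ P] {U : Set P}
    {φ : P → 𝔤 ≃ₗ⁅ℝ⁆ 𝔤} (h : ∀ y, ContDiffOn ℝ ∞ (fun p => φ p y) U) :
    ContDiffOn ℝ ∞ (fun p => autL (φ p)) U := contDiffOn_clm_apply.2 h

lemma contDiffOn_aut_apply {P : Type*} [NormedAddCommGroup P] [NormedSpace ℝ P] {U : Set P}
    {φ : P → 𝔤 ≃ₗ⁅ℝ⁆ 𝔤} (h : ∀ y, ContDiffOn ℝ ∞ (fun p => φ p y) U) {f : P → 𝔤}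
    (hf : ContDiffOn ℝ ∞ f U) : ContDiffOn ℝ ∞ (fun p => φ p (f p)) U :=
  (contDiffOn_autL h).clm_apply hf

lemma contDiffOn_aut_inv {P : Type*} [NormedAddCommGroup P] [NormedSpace ℝ P] {U : Set P}
    {φ : P → 𝔤 ≃ₗ⁅ℝ⁆ 𝔤} (h : ∀ y, ContDiffOn ℝ ∞ (fun p => φ p y) U) (y : 𝔤) :
    ContDiffOn ℝ ∞ (fun p => (φ p)⁻¹ y) U := by
  refine contDiffOn_of_inner fun z => ?_
  simp only [inner_inv_left]
  exact contDiffOn_const.inner ℝ (h z)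

lemma contDiffOn_lie {P : Type*} [NormedAddCommGroup P] [NormedSpace ℝ P] {U : Set P} {f g : P → 𝔤}
    (hf : ContDiffOn ℝ ∞ f U) (hg : ContDiffOn ℝ ∞ g U) :
    ContDiffOn ℝ ∞ (fun p => ⁅f p, g p⁆) U :=
  ((adL (𝔤 := 𝔤)).contDiff.comp_contDiffOn hf).clm_apply hg

lemma hasDerivAt_lie {f g : ℝ → 𝔤} {f' g' : 𝔤} {x : ℝ} (hf : HasDerivAt f f' x)
    (hg : HasDerivAt g g' x) : HasDerivAt (fun x => ⁅f x, g x⁆) (⁅f', g x⁆ + ⁅f x, g'⁆) x :=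
  ((adL (𝔤 := 𝔤)).hasFDerivAt.comp_hasDerivAt x hf).clm_apply hg

/-- If `φₓ = -ad(b) φ` then `(φ⁻¹)ₓ = φ⁻¹ ad(b)`. -/
lemma hasDerivAt_aut_inv {φ : ℝ → 𝔤 ≃ₗ⁅ℝ⁆ 𝔤} {b : 𝔤} {x : ℝ}
    (h : ∀ y, HasDerivAt (fun s => φ s y) ⁅-b, φ x y⁆ x) (y : 𝔤) :
    HasDerivAt (fun s => (φ s)⁻¹ y) ((φ x)⁻¹ ⁅b, y⁆) x := by
  refine hasDerivAt_of_inner fun z => ?_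
  simp only [inner_inv_left]
  have h1 := (hasDerivAt_const x y).inner ℝ (h z)
  rwa [inner_zero_left, add_zero, neg_lie, inner_neg_right, ← inner_lie_left] at h1

open Classical in
/-- A continuous linear map as an automorphism, if it is one. -/
noncomputable def autOf (C : 𝔤 →L[ℝ] 𝔤) : 𝔤 ≃ₗ⁅ℝ⁆ 𝔤 :=
  if h : (∀ y z, C ⁅y, z⁆ = ⁅C y, C z⁆) ∧ Function.Bijective C then
    LieEquiv.ofBijective { (C : 𝔤 →ₗ[ℝ] 𝔤) with map_lie' := fun {y z} => h.1 y z } h.2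
  else 1

/-- The bracket condition is stated through `⟨[y, z], w⟩` because that is a scalar conserved by the
equation. Isometry gives bijectivity, and then the bracket itself is preserved. -/
lemma autOf_apply {C : 𝔤 →L[ℝ] 𝔤} (h : ∀ y z, ⟪C y, C z⟫ = ⟪y, z⟫)
    (h' : ∀ y z w, ⟪⁅C y, C z⁆, C w⟫ = ⟪⁅y, z⁆, w⟫) (y : 𝔤) : autOf C y = C y := by
  have hinj : Function.Injective (C : 𝔤 →ₗ[ℝ] 𝔤) := by
    rw [injective_iff_map_eq_zero]
    intro y hy
    rw [← inner_self_eq_zero (𝕜 := ℝ), ← h, show C y = 0 from hy, inner_zero_left]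
  have hsurj : Function.Surjective C := LinearMap.injective_iff_surjective.1 hinj
  have hlie : ∀ y z, C ⁅y, z⁆ = ⁅C y, C z⁆ := by
    intro y z
    refine ext_inner_right ℝ fun v => ?_
    obtain ⟨w, rfl⟩ := hsurj v
    rw [h, h']
  rw [autOf, dif_pos ⟨hlie, hinj, hsurj⟩]
  rfl

lemma autOf_one : autOf (1 : 𝔤 →L[ℝ] 𝔤) = 1 :=
  LieEquiv.ext fun y => autOf_apply (by simp) (by simp) y

/-- Smooth solutions `φ` of `φₓ = ad(b) φ` in the adjoint group. -/
theorem exists_smooth_frame {U : Set (ℝ × ℝ)} (hU : IsOpen U) {x₀ : ℝ}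
    (hstar : ∀ p ∈ U, ∀ s ∈ Icc (0 : ℝ) 1, (x₀ + s * (p.1 - x₀), p.2) ∈ U)
    {b : ℝ × ℝ → 𝔤} (hb : ContDiffOn ℝ ∞ b U) :
    ∃ φ : ℝ × ℝ → 𝔤 ≃ₗ⁅ℝ⁆ 𝔤, (∀ y, ContDiffOn ℝ ∞ (fun p => φ p y) U) ∧
      (∀ t, φ (x₀, t) = 1) ∧ (∀ p ∈ U, φ p ∈ adjointGroup 𝔤) ∧
      ∀ x t, (x, t) ∈ U → ∀ y, HasDerivAt (fun s => φ (s, t) y) ⁅b (x, t), φ (x, t) y⁆ x := by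
  have : CompleteSpace 𝔤 := FiniteDimensional.complete ℝ 𝔤
  obtain ⟨u, hu, hu0, hud⟩ := exists_smooth_fundamental_solution hU hstar
    (a := fun p => adL (b p)) ((adL (𝔤 := 𝔤)).contDiff.comp_contDiffOn hb)
  have hud' : ∀ x t, (x, t) ∈ U → ∀ y, HasDerivAt (fun s => u (s, t) y) ⁅b (x, t), u (x, t) y⁆ x := by
    intro x t hp y
    have h1 := (hud x t hp).clm_apply (hasDerivAt_const x y)
    simpa using h1
  have hS : ∀ t, IsOpen {x : ℝ | (x, t) ∈ U} := fun t => hU.preimage (by fun_prop)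
  have hseg : ∀ x t, (x, t) ∈ U → uIcc x₀ x ⊆ {x : ℝ | (x, t) ∈ U} := by
    intro x t hp y hy
    rw [← segment_eq_uIcc, segment_eq_image'] at hy
    obtain ⟨s, hs, rfl⟩ := hy
    exact hstar _ hp s hs
  have hS0 : ∀ x t, (x, t) ∈ U → (x₀, t) ∈ U := fun x t h => hseg x t h left_mem_uIcc
  have hSc : ∀ t, OrdConnected {x : ℝ | (x, t) ∈ U} := by
    intro t
    refine ordConnected_iff.2 fun x hx y hy hxy z hz => ?_
    rcases le_total x₀ z with h | h
    · exact hseg y t hy (Icc_subset_uIcc ⟨h, hz.2⟩)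
    · exact hseg x t hx (Icc_subset_uIcc' ⟨hz.1, h⟩)
  -- The inner product and the triple product are both `ad(b)`-invariant, hence constant along
  -- solutions of `uₓ = ad(b) u`.
  have hiso : ∀ x t, (x, t) ∈ U → ∀ y z, ⟪u (x, t) y, u (x, t) z⟫ = ⟪y, z⟫ := by
    intro x t hp y z
    have h1 := const_of_hasDerivAt_zero (hS t) (hSc t) (f := fun x => ⟪u (x, t) y, u (x, t) z⟫)
      (fun x hx => ((hud' x t hx y).inner ℝ (hud' x t hx z)).congr_deriv
        (by rw [inner_lie_left]; ring)) hp (hS0 x t hp)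
    simpa [hu0] using h1
  have htri : ∀ x t, (x, t) ∈ U → ∀ y z w,
      ⟪⁅u (x, t) y, u (x, t) z⁆, u (x, t) w⟫ = ⟪⁅y, z⁆, w⟫ := by
    intro x t hp y z w
    have h1 := const_of_hasDerivAt_zero (hS t) (hSc t)
      (f := fun x => ⟪⁅u (x, t) y, u (x, t) z⁆, u (x, t) w⟫)
      (fun x hx => ((hasDerivAt_lie (hud' x t hx y) (hud' x t hx z)).inner ℝ
        (hud' x t hx w)).congr_deriv (by
          rw [← leibniz_lie, inner_lie_left (b (x, t))]; ring)) hp (hS0 x t hp)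
    simpa [hu0] using h1
  have happ : ∀ p ∈ U, ∀ y, autOf (u p) y = u p y :=
    fun p hp y => autOf_apply (hiso p.1 p.2 hp) (htri p.1 p.2 hp) y
  have hsm : ∀ y, ContDiffOn ℝ ∞ (fun p => autOf (u p) y) U := fun y =>
    (hu.clm_apply contDiffOn_const).congr fun p hp => happ p hp y
  refine ⟨fun p => autOf (u p), hsm, fun t => by simp only [hu0, autOf_one], fun p hp => ?_,
    fun x t hp y => ?_⟩
  · have hcl : ∀ s : ℝ, max 0 (min 1 s) ∈ Icc (0 : ℝ) 1 :=
      fun s => ⟨le_max_left _ _, max_le zero_le_one (min_le_left _ _)⟩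
    refine ⟨fun s => autOf (u (x₀ + max 0 (min 1 s) * (p.1 - x₀), p.2)), fun y => ?_, ?_, ?_⟩
    · exact (hsm y).continuousOn.comp_continuous (by fun_prop) fun s => hstar p hp _ (hcl s)
    · simp [hu0, autOf_one]
    · simp
  · rw [happ _ hp]
    refine (hud' x t hp y).congr_of_eventuallyEq ?_
    filter_upwards [(hS t).mem_nhds hp] with s hs using happ _ hs y

end Aut

/-! ### Existence of parallel frames -/

section Frames

variable {𝔤 : Type*} [LieRing 𝔤] [LieAlgebra ℝ 𝔤] [FiniteDimensional ℝ 𝔤] [IsCompactType 𝔤]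
  {𝔥 : LieSubalgebra ℝ 𝔤} {𝔪 : Submodule ℝ 𝔤} {A : 𝔤} {I : Set ℝ}

lemma symmetricSpace_cube (hA : IsHermitianSymmetric 𝔥 𝔪 A) {v : 𝔤} (hv : v ∈ symmetricSpace A)
    (y : 𝔤) : ⁅v, ⁅v, ⁅v, y⁆⁆⁆ = -⁅v, y⁆ := by
  obtain ⟨φ, -, rfl⟩ := hv
  conv_lhs => rw [← φ.apply_symm_apply y]
  conv_rhs => rw [← φ.apply_symm_apply y]
  rw [← LieEquiv.map_lie, ← LieEquiv.map_lie, ← LieEquiv.map_lie, hA.cube, map_neg]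

/-- Differentiating `ad(γ)³ = -ad(γ)` puts `ad(γ')` in the kernel of the linearization, which is
injective on the centralizer part. -/
lemma centProj_deriv_eq_zero {γ : ℝ → 𝔤} {γ' : 𝔤} {x : ℝ}
    (hγ : ∀ᶠ s in 𝓝 x, ∀ y : 𝔤, ⁅γ s, ⁅γ s, ⁅γ s, y⁆⁆⁆ = -⁅γ s, y⁆) (h : HasDerivAt γ γ' x) :
    centProj (γ x) γ' = 0 := by
  have hx := hγ.self_of_nhds
  have h1 : HasDerivAt (fun s => adL (γ s)) (adL γ') x :=
    (adL (𝔤 := 𝔤)).hasFDerivAt.comp_hasDerivAt x h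
  have h2 := ((h1.fun_mul h1).fun_mul h1).fun_add h1
  have h3 : (fun s => adL (γ s) * adL (γ s) * adL (γ s) + adL (γ s)) =ᶠ[𝓝 x] fun _ => 0 := by
    filter_upwards [hγ] with s hs
    rw [adL_cube hs, neg_add_cancel]
  have h4 := h2.unique ((hasDerivAt_const x (0 : 𝔤 →L[ℝ] 𝔤)).congr_of_eventuallyEq h3)
  have h5 : cubicLin (adL (γ x)) (adL γ') = 0 := by
    rw [← h4]
    simp only [cubicLin]
    noncomm_ring
  have h6 : γ' = centProj (γ x) γ' + ⁅γ x, -⁅γ x, γ'⁆⁆ := by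
    rw [centProj, lie_neg, add_neg_cancel_right]
  have hc : adL (γ x) * adL (centProj (γ x) γ') = adL (centProj (γ x) γ') * adL (γ x) := by
    rw [← sub_eq_zero, ← adL_lie, lie_centProj hx, map_zero]
  rw [h6, map_add, cubicLin_add, adL_lie, cubicLin_commutator (adL_cube hx), add_zero] at h5
  apply adL_injective
  rw [← cubicWeight_mul_cubicLin (adL_cube hx) hc, h5, mul_zero, map_zero]

/-- Thus `γ` solves the linear equation generated by `[γ, γ']`, the same one that defines parallel
transport. -/
lemma lie_lie_deriv {γ : ℝ → 𝔤} {γ' : 𝔤} {x : ℝ}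
    (hγ : ∀ᶠ s in 𝓝 x, ∀ y : 𝔤, ⁅γ s, ⁅γ s, ⁅γ s, y⁆⁆⁆ = -⁅γ s, y⁆) (h : HasDerivAt γ γ' x) :
    ⁅⁅γ x, γ'⁆, γ x⁆ = γ' := by
  rw [← lie_skew]
  exact (eq_neg_of_add_eq_zero_left (centProj_deriv_eq_zero hγ h)).symm

lemma isOpen_strip (hI : IsOpen I) : IsOpen ((univ : Set ℝ) ×ˢ I) := isOpen_univ.prod hI

lemma strip_star (I : Set ℝ) : ∀ p ∈ (univ : Set ℝ) ×ˢ I, ∀ s ∈ Icc (0 : ℝ) 1,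
    ((0 : ℝ) + s * (p.1 - 0), p.2) ∈ (univ : Set ℝ) ×ˢ I := fun _ hp _ _ => ⟨mem_univ _, hp.2⟩

/-- Smooth solutions of `φ' = ad(b) φ` over an interval. -/
lemma exists_smooth_path (hI : IsOpen I) (hI' : I.OrdConnected) {b : ℝ → 𝔤}
    (hb : ContDiffOn ℝ ∞ b I) {t₀ : ℝ} (ht₀ : t₀ ∈ I) :
    ∃ φ : ℝ → 𝔤 ≃ₗ⁅ℝ⁆ 𝔤, IsSmoothPath (adjointGroup 𝔤) I φ ∧ φ t₀ = 1 ∧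
      ∀ t ∈ I, ∀ y, HasDerivAt (fun s => φ s y) ⁅b t, φ t y⁆ t := by
  have hstar : ∀ p ∈ I ×ˢ (univ : Set ℝ), ∀ s ∈ Icc (0 : ℝ) 1,
      (t₀ + s * (p.1 - t₀), p.2) ∈ I ×ˢ (univ : Set ℝ) := by
    refine fun p hp s hs => ⟨hI'.uIcc_subset ht₀ hp.1 ?_, mem_univ _⟩
    rw [← segment_eq_uIcc, segment_eq_image']
    exact ⟨s, hs, rfl⟩
  obtain ⟨φ, h1, h2, h3, h4⟩ := exists_smooth_frame (hI.prod isOpen_univ) hstar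
    (b := fun p => b p.1) (hb.comp contDiffOn_fst fun p hp => hp.1)
  refine ⟨fun t => φ (t, 0), ⟨fun t ht => h3 _ ⟨ht, mem_univ _⟩, fun y => ?_⟩, h2 0,
    fun t ht y => h4 t 0 ⟨ht, mem_univ _⟩ y⟩
  exact (h1 y).comp (f := fun t : ℝ => (t, (0 : ℝ))) (by fun_prop) fun t ht => ⟨ht, mem_univ _⟩

/-- The equation `ψₓ = ψ ad(q)` has its coefficient on the right, so `φₓ = -ad(q) φ` is solved
instead and inverted. -/
lemma exists_frame_of_hasimoto (hI : IsOpen I) {q : ℝ → ℝ → 𝔤}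
    (hq : IsSmoothField (𝔪 : Set 𝔤) I q) : ∃ ψ χ, IsParallelFrame 𝔪 A I ψ χ q := by
  obtain ⟨φ, h1, h2, h3, h4⟩ := exists_smooth_frame (isOpen_strip hI) (strip_star I) hq.1.neg
  refine ⟨fun x t => (φ (x, t))⁻¹, fun x t => (φ (x, t))⁻¹ A,
    fun x t ht => inv_mem (h3 _ ⟨mem_univ _, ht⟩), fun y => contDiffOn_aut_inv h1 y,
    fun _ _ _ => rfl, hq.2, fun x t ht y => ?_⟩
  exact (hasDerivAt_aut_inv (fun y => h4 x t ⟨mem_univ _, ht⟩ y) y).deriv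

lemma exists_frame_of_map (hA : IsHermitianSymmetric 𝔥 𝔪 A) (hI : IsOpen I) (hI' : I.OrdConnected)
    {χ : ℝ → ℝ → 𝔤} (hχ : IsSmoothField (symmetricSpace A) I χ) :
    ∃ ψ q, IsParallelFrame 𝔪 A I ψ χ q := by
  rcases I.eq_empty_or_nonempty with rfl | ⟨t₀, ht₀⟩
  · exact ⟨fun _ _ => 1, fun _ _ => 0, by simp, by simp, by simp, by simp, by simp⟩
  have hUo := isOpen_strip hI
  have hmem : ∀ (x : ℝ), ∀ t ∈ I, (x, t) ∈ (univ : Set ℝ) ×ˢ I := fun x t ht => ⟨mem_univ _, ht⟩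
  set f : ℝ × ℝ → 𝔤 := fun p => χ p.1 p.2 with hf
  have hfs : ContDiffOn ℝ ∞ f (univ ×ˢ I) := hχ.1
  have hcube : ∀ (x : ℝ), ∀ t ∈ I, ∀ y : 𝔤, ⁅χ x t, ⁅χ x t, ⁅χ x t, y⁆⁆⁆ = -⁅χ x t, y⁆ :=
    fun x t ht => symmetricSpace_cube hA (hχ.2 x t ht)
  obtain ⟨φ₀, hφ₀, hφ₀A⟩ := hχ.2 0 t₀ ht₀
  -- Transport first in `t` along `x = 0`, starting from an automorphism that takes `A` to `χ(0,
  -- t₀)`, and then in `x` for each `t`.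
  obtain ⟨ψ₀, ⟨hψ₀m, hψ₀s⟩, hψ₀1, hψ₀d⟩ := exists_smooth_path hI hI'
    (b := fun t => ⁅f (0, t), fderiv ℝ f (0, t) (0, 1)⁆)
    ((contDiffOn_lie hfs (contDiffOn_fderiv_apply hUo hfs (0, 1))).comp
      (f := fun t : ℝ => ((0 : ℝ), t)) (by fun_prop) fun t ht => hmem 0 t ht) ht₀
  have hbase : ∀ t ∈ I, ψ₀ t (φ₀ A) = χ 0 t := by
    intro t ht
    refine eqOn_of_lie_ode hI hI' (f := fun t => ψ₀ t (φ₀ A)) (g := fun t => χ 0 t)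
      (b := fun t => ⁅f (0, t), fderiv ℝ f (0, t) (0, 1)⁆)
      (fun t ht => hψ₀d t ht _) (fun t ht => ?_) ht₀ (by simp only [hψ₀1]; exact hφ₀A) ht
    have hd := hasDerivAt_slice_snd hUo hfs (hmem 0 t ht)
    refine hd.congr_deriv (lie_lie_deriv ?_ hd).symm
    filter_upwards [hI.mem_nhds ht] with s hs using hcube 0 s hs
  obtain ⟨Ψ, hΨs, hΨ0, hΨm, hΨd⟩ := exists_smooth_frame hUo (strip_star I)
    (b := fun p => ⁅f p, fderiv ℝ f p (1, 0)⁆)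
    (contDiffOn_lie hfs (contDiffOn_fderiv_apply hUo hfs (1, 0)))
  set ψ : ℝ → ℝ → 𝔤 ≃ₗ⁅ℝ⁆ 𝔤 := fun x t => Ψ (x, t) * (ψ₀ t * φ₀) with hψ
  have hψd : ∀ (x : ℝ), ∀ t ∈ I, ∀ y, HasDerivAt (fun s => ψ s t y)
      ⁅⁅f (x, t), fderiv ℝ f (x, t) (1, 0)⁆, ψ x t y⁆ x :=
    fun x t ht y => hΨd x t (hmem x t ht) _
  have hmap : ∀ (x : ℝ), ∀ t ∈ I, ψ x t A = χ x t := by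
    intro x t ht
    refine eqOn_of_lie_ode isOpen_univ ordConnected_univ (f := fun x => ψ x t A)
      (g := fun x => χ x t) (b := fun x => ⁅f (x, t), fderiv ℝ f (x, t) (1, 0)⁆)
      (fun x _ => hψd x t ht _) (fun x _ => ?_) (mem_univ 0) ?_ (mem_univ x)
    · have hd := hasDerivAt_slice_fst hUo hfs (hmem x t ht)
      exact hd.congr_deriv (lie_lie_deriv (Eventually.of_forall fun s => hcube s t ht) hd).symm
    · simp only [hψ, hΨ0, one_mul]
      exact hbase t ht
  -- Pulled back by `ψ`, the generator `[χ, χₓ]` becomes a bracket with `A`, hence lies in `𝔪`.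
  refine ⟨ψ, fun x t => (ψ x t)⁻¹ ⁅f (x, t), fderiv ℝ f (x, t) (1, 0)⁆, fun x t ht => ?_,
    fun y => ?_, fun x t ht => (hmap x t ht).symm, fun x t ht => ?_, fun x t ht y => ?_⟩
  · exact mul_mem (hΨm _ (hmem x t ht)) (mul_mem (hψ₀m t ht) hφ₀)
  · exact contDiffOn_aut_apply hΨs ((hψ₀s (φ₀ y)).comp contDiffOn_snd fun p hp => hp.2)
  · rw [LieEquiv.map_lie, show (ψ x t)⁻¹ (f (x, t)) = A by
      change (ψ x t)⁻¹ (χ x t) = A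
      rw [← hmap x t ht, aut_inv_apply_apply]]
    exact hA.lie_mem _
  · rw [(hψd x t ht y).deriv, LieEquiv.map_lie, aut_apply_inv_apply]

end Frames

/-! ### The map and spin hierarchies from the Lax equation -/

section MapAndSpinHierarchies

section

variable {𝔤 : Type*} [LieRing 𝔤] [LieAlgebra ℝ 𝔤] [IsCompactType 𝔤]

lemma Hinv_eq {N : Set 𝔤} {c : ℝ} {F P : CurveFun 𝔤} (h : IsHPrimitive N c F P) {γ : ℝ → 𝔤}
    (hγ : γ ∈ smoothCurves N) : Hinv N c F γ = P γ := by
  have he : ∃ P, IsHPrimitive N c F P := ⟨P, h⟩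
  rw [Hinv, dif_pos he]
  exact IsHPrimitive.eq h he.choose_spec (fun _ _ _ => rfl) hγ

lemma IsSmoothField.slice {N : Set 𝔤} {I : Set ℝ} {f : ℝ → ℝ → 𝔤} (hf : IsSmoothField N I f) {t : ℝ}
    (ht : t ∈ I) : (fun x => f x t) ∈ smoothCurves N := by
  refine ⟨?_, fun x => hf.2 x t ht⟩
  rw [← contDiffOn_univ]
  exact hf.1.comp (f := fun x : ℝ => (x, t)) (by fun_prop) fun x _ => ⟨mem_univ _, ht⟩

end

variable {𝔤 : Type*} [LieRing 𝔤] [LieAlgebra ℝ 𝔤] [FiniteDimensional ℝ 𝔤] [IsCompactType 𝔤]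
  {𝔥 : LieSubalgebra ℝ 𝔤} {𝔪 : Submodule ℝ 𝔤} {A : 𝔤} {I : Set ℝ}

namespace IsParallelFrame

variable {ψ : ℝ → ℝ → 𝔤 ≃ₗ⁅ℝ⁆ 𝔤} {χ q : ℝ → ℝ → 𝔤}

lemma hasLogDeriv (h : IsParallelFrame 𝔪 A I ψ χ q) (hI : IsOpen I) {t : ℝ} (ht : t ∈ I) :
    HasLogDeriv (fun x => ψ x t) (fun x => q x t) univ := by
  intro x _ y
  have hd := hasDerivAt_slice_fst (isOpen_strip hI) (h.smooth y) (x := x) (t := t)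
    ⟨mem_univ _, ht⟩
  rw [← h.deriv_eq x t ht y]
  exact hd.differentiableAt.hasDerivAt

lemma isSmoothField_map (h : IsParallelFrame 𝔪 A I ψ χ q) :
    IsSmoothField (symmetricSpace A) I χ :=
  ⟨(h.smooth A).congr fun p hp => h.map_eq p.1 p.2 hp.2,
    fun x t ht => ⟨ψ x t, h.mem x t ht, (h.map_eq x t ht).symm⟩⟩

/-- Smoothness is not part of the frame data for `q`, but `ψ⁻¹χₓ = [q, A]` and `ad(A)² = -1` on `𝔪`
recover `q` as `[A, ψ⁻¹χₓ]`. -/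
lemma isSmoothField_hasimoto (hA : IsHermitianSymmetric 𝔥 𝔪 A)
    (h : IsParallelFrame 𝔪 A I ψ χ q) (hI : IsOpen I) : IsSmoothField (𝔪 : Set 𝔤) I q := by
  refine ⟨?_, h.q_mem⟩
  have h1 := contDiffOn_fderiv_apply (isOpen_strip hI) (h.smooth A) (1, 0)
  refine (contDiffOn_lie contDiffOn_const
    (contDiffOn_aut_apply (contDiffOn_aut_inv h.smooth) h1) (f := fun _ => A)).congr ?_
  rintro ⟨x, t⟩ ⟨-, ht : t ∈ I⟩
  have hd := hasDerivAt_slice_fst (isOpen_strip hI) (h.smooth A) (x := x) (t := t)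
    ⟨mem_univ _, ht⟩
  have h2 := hd.unique (h.hasLogDeriv hI ht x (mem_univ x) A)
  simp only
  rw [h2, aut_inv_apply_apply, ← lie_skew (q x t) A, lie_neg, hA.sq _ (h.q_mem x t ht), neg_neg]

end IsParallelFrame

lemma exists_curve_frame (hA : IsHermitianSymmetric 𝔥 𝔪 A) {γ : ℝ → 𝔤}
    (hγ : γ ∈ smoothCurves (symmetricSpace A)) :
    ∃ ψ : ℝ → 𝔤 ≃ₗ⁅ℝ⁆ 𝔤, ∃ q ∈ smoothCurves (𝔪 : Set 𝔤), HasLogDeriv ψ q univ ∧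
      ∀ x, γ x = ψ x A := by
  obtain ⟨ψ, q, h⟩ := exists_frame_of_map hA isOpen_univ ordConnected_univ (χ := fun x _ => γ x)
    ⟨(hγ.1.comp contDiff_fst).contDiffOn, fun x _ _ => hγ.2 x⟩
  exact ⟨fun x => ψ x 0, fun x => q x 0,
    (h.isSmoothField_hasimoto hA isOpen_univ).slice (mem_univ 0),
    h.hasLogDeriv isOpen_univ (mem_univ 0), fun x => h.map_eq x 0 (mem_univ 0)⟩

/-- Gauging by the frame itself removes `q` from `Dₓ + ad(q)` and moves `A` to `γ`. -/
lemma lax_frame {ψ : ℝ → 𝔤 ≃ₗ⁅ℝ⁆ 𝔤} {γ q : ℝ → 𝔤} (hq : q ∈ smoothCurves (𝔪 : Set 𝔤))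
    (hψ : HasLogDeriv ψ q univ) (hγ : ∀ x, γ x = ψ x A) (n : ℕ) (x : ℝ) :
    lax (fun _ => 0) γ n x = ψ x (lax q (fun _ => A) n x) :=
  lax_equivariant hψ (fun x => by rw [sub_self, map_zero]) hγ (differentiable_lax hq) n x

section MapHierarchy

variable {γ : ℝ → 𝔤}

/-- The Lax equation `∂ₓYₙ = [γ, Yₙ₊₁]` along a curve in `M`. -/
theorem map_lax_equation (hA : IsHermitianSymmetric 𝔥 𝔪 A)
    (hγ : γ ∈ smoothCurves (symmetricSpace A)) (n : ℕ) (x : ℝ) :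
    HasDerivAt (lax (fun _ => 0) γ n) ⁅γ x, lax (fun _ => 0) γ (n + 1) x⁆ x := by
  obtain ⟨ψ, q, hq, hψ, hψγ⟩ := exists_curve_frame hA hγ
  have h1 := hψ.apply (mem_univ x) (differentiable_lax (A := A) hq n x).hasDerivAt
  rw [lax_equation hA hq, LieEquiv.map_lie, ← lax_frame hq hψ hψγ, ← hψγ] at h1
  rwa [show lax (fun _ => 0) γ n = _ from funext (lax_frame hq hψ hψγ n)]

/-- The relation `[𝔪, 𝔪] ⊆ 𝔥`, transported to an arbitrary point of the orbit. -/
lemma lie_lie_tangent (hA : IsHermitianSymmetric 𝔥 𝔪 A) {v y z : 𝔤} (hv : v ∈ symmetricSpace A)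
    (hy : centProj v y = 0) (hz : centProj v z = 0) : ⁅v, ⁅y, z⁆⁆ = 0 := by
  obtain ⟨φ, -, rfl⟩ := hv
  have key : ∀ y, centProj (φ A) y = 0 → ∃ y' ∈ 𝔪, φ y' = y := by
    intro y hy
    refine ⟨φ.symm y, ?_, φ.apply_symm_apply y⟩
    rw [← φ.apply_symm_apply y, centProj_equiv] at hy
    have h1 : centProj A (φ.symm y) = 0 := φ.injective (hy.trans (map_zero φ).symm)
    rw [centProj] at h1
    rw [eq_neg_of_add_eq_zero_left h1]
    exact 𝔪.neg_mem (hA.lie_mem _)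
  obtain ⟨y', hy', rfl⟩ := key y hy
  obtain ⟨z', hz', rfl⟩ := key z hz
  rw [← LieEquiv.map_lie, ← LieEquiv.map_lie, (hA.centralizer _).2 (hA.lie_m_m y' hy' z' hz'),
    map_zero]

lemma hasDerivAt_curve (hγ : γ ∈ smoothCurves (symmetricSpace A)) (x : ℝ) :
    HasDerivAt γ (deriv γ x) x := (hγ.1.differentiable (by simp) x).hasDerivAt

lemma centProj_deriv_curve (hA : IsHermitianSymmetric 𝔥 𝔪 A)
    (hγ : γ ∈ smoothCurves (symmetricSpace A)) (x : ℝ) : centProj (γ x) (deriv γ x) = 0 :=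
  centProj_deriv_eq_zero (Eventually.of_forall fun s => symmetricSpace_cube hA (hγ.2 s))
    (hasDerivAt_curve hγ x)

/-- Differentiating `(1 + ad(γ)²)Yₙ` and projecting, the terms in the range of `ad(γ)` drop out and
only the one with `γₓ` outermost remains. -/
lemma map_hprimitive (hA : IsHermitianSymmetric 𝔥 𝔪 A)
    (hγ : γ ∈ smoothCurves (symmetricSpace A)) (n : ℕ) (x : ℝ) :
    ∃ D, HasDerivAt (fun x => centProj (γ x) (lax (fun _ => 0) γ n x)) D x ∧
      centProj (γ x) D = ⁅deriv γ x, ⁅γ x, lax (fun _ => 0) γ n x⁆⁆ := by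
  have hc := symmetricSpace_cube hA (hγ.2 x)
  have h1 := hasDerivAt_curve hγ x
  have h2 := map_lax_equation hA hγ n x
  refine ⟨_, h2.fun_add (hasDerivAt_lie h1 (hasDerivAt_lie h1 h2)), ?_⟩
  have h3 : ⁅γ x, ⁅deriv γ x, ⁅γ x, lax (fun _ => 0) γ n x⁆⁆⁆ = 0 :=
    lie_lie_tangent hA (hγ.2 x) (centProj_deriv_curve hA hγ x) (centProj_lie hc _)
  rw [centProj_add, centProj_add, centProj_lie hc, centProj_lie hc, centProj_of_lie_eq_zero h3]
  abel

/-- One step of the recursion for `[γ, Yₙ]`, with the normal part of `Yₙ` already inserted for the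
inverse; `D` includes the normal component of the derivative, which the bracket with `γ` kills. -/
lemma map_recursion (hA : IsHermitianSymmetric 𝔥 𝔪 A)
    (hγ : γ ∈ smoothCurves (symmetricSpace A)) (n : ℕ) (x : ℝ) :
    ∃ D, HasDerivAt (fun x => ⁅γ x, lax (fun _ => 0) γ n x⁆) D x ∧
      -⁅γ x, D - ⁅deriv γ x, centProj (γ x) (lax (fun _ => 0) γ n x)⁆⁆ =
        ⁅γ x, lax (fun _ => 0) γ (n + 1) x⁆ := by
  have hc := symmetricSpace_cube hA (hγ.2 x)
  refine ⟨_, hasDerivAt_lie (hasDerivAt_curve hγ x) (map_lax_equation hA hγ n x), ?_⟩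
  have h3 : ⁅γ x, ⁅deriv γ x, ⁅γ x, ⁅γ x, lax (fun _ => 0) γ n x⁆⁆⁆⁆ = 0 :=
    lie_lie_tangent hA (hγ.2 x) (centProj_deriv_curve hA hγ x) (centProj_lie hc _)
  rw [centProj, lie_add (deriv γ x), lie_sub, lie_add (γ x), lie_add (γ x), h3, hc]
  abel

lemma isHPrimitive_map (hA : IsHermitianSymmetric 𝔥 𝔪 A) {F : CurveFun 𝔤} {n : ℕ}
    (hF : ∀ γ ∈ smoothCurves (symmetricSpace A), ∀ x,
      F γ x = ⁅γ x, lax (fun _ => 0) γ (n + 1) x⁆) :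
    IsHPrimitive (symmetricSpace A) 1 (adCurveX F)
      (fun γ x => centProj (γ x) (lax (fun _ => 0) γ (n + 1) x)) := by
  have hjet : IsJet (symmetricSpace A)
      (fun γ x => centProj (γ x) (lax (fun _ => 0) γ (n + 1) x)) :=
    isJet_self.centProj (isJet_lax (isJet_const 0) isJet_self (n + 1))
  refine ⟨hjet.exists_local, fun γ hγ => ⟨hjet.differentiable hγ, fun x => ⟨?_, ?_⟩⟩,
    fun v hv x => ?_⟩
  · exact lie_centProj (symmetricSpace_cube hA (hγ.2 x)) _
  · obtain ⟨D, hD, hD'⟩ := map_hprimitive hA hγ (n + 1) x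
    rw [hD.deriv, one_smul, adCurveX, hF γ hγ x]
    exact hD'
  · change centProj v (lax (fun _ => 0) (fun _ => v) (n + 1) x) = 0
    rw [lax_const, centProj_zero]

/-- The hierarchy of map equations in terms of the Lax equation. -/
theorem Rmap_iterate (hA : IsHermitianSymmetric 𝔥 𝔪 A) (n : ℕ) :
    ∀ γ ∈ smoothCurves (symmetricSpace A), ∀ x,
      ((Rmap A)^[n] curveX) γ x = ⁅γ x, lax (fun _ => 0) γ (n + 1) x⁆ := by
  induction n with
  | zero =>
    intro γ hγ x
    rw [← (map_lax_equation hA hγ 0 x).deriv, lax_zero]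
    rfl
  | succ n ih =>
    intro γ hγ x
    obtain ⟨D, hD, hD'⟩ := map_recursion hA hγ (n + 1) x
    rw [Function.iterate_succ_apply', ← hD']
    set F := (Rmap A)^[n] curveX
    have h1 : F γ = fun x => ⁅γ x, lax (fun _ => 0) γ (n + 1) x⁆ := funext (ih γ hγ)
    change -⁅γ x, -⁅γ x, ⁅γ x, deriv (F γ) x⁆⁆ -
      ⁅deriv γ x, Hinv (symmetricSpace A) 1 (adCurveX F) γ x⁆⁆ = _
    rw [Hinv_eq (isHPrimitive_map hA ih) hγ, h1, hD.deriv, lie_sub, lie_sub, lie_neg,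
      symmetricSpace_cube hA (hγ.2 x), neg_neg]

end MapHierarchy

section SpinHierarchy

variable {T : ℝ → 𝔤}

lemma normSq_pos (hm : 𝔪 ≠ ⊥) : 0 < normSq 𝔪 := by
  have := Submodule.one_le_finrank_iff.2 hm
  exact Nat.cast_pos.2 this

lemma smul_mem_smoothCurves (hT : T ∈ smoothCurves (spinSpace 𝔪 A)) :
    (fun x => √(normSq 𝔪) • T x) ∈ smoothCurves (symmetricSpace A) :=
  ⟨contDiff_const.smul hT.1, hT.2⟩

/-- With `s = √(dim 𝔪)` and `γ = sT`, the operator `dim 𝔪 · ad(T)²` is `ad(γ)²` while `ad(Tₓ) = s⁻¹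
ad(γₓ)`; this accounts for the factor `c / s`. -/
lemma isHPrimitive_spin (hA : IsHermitianSymmetric 𝔥 𝔪 A) (hm : 𝔪 ≠ ⊥) {F : CurveFun 𝔤} {n : ℕ}
    {c : ℝ} (hF : ∀ T ∈ smoothCurves (spinSpace 𝔪 A), ∀ x,
      F T x = c • ⁅√(normSq 𝔪) • T x, lax (fun _ => 0) (fun x => √(normSq 𝔪) • T x) (n + 1) x⁆) :
    IsHPrimitive (spinSpace 𝔪 A) (normSq 𝔪) (adCurveX F) (fun T x => (c / √(normSq 𝔪)) •
      centProj (√(normSq 𝔪) • T x) (lax (fun _ => 0) (fun x => √(normSq 𝔪) • T x) (n + 1) x)) := by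
  have ha := normSq_pos hm
  have hs2 := Real.mul_self_sqrt ha.le
  have hs : √(normSq 𝔪) ≠ 0 := (Real.sqrt_pos.2 ha).ne'
  set s := √(normSq 𝔪) with hsdef
  have hself : IsJet (spinSpace 𝔪 A) (fun T x => s • T x) :=
    isJet_self.comp (g := fun y => s • y) (by fun_prop)
  have hjet : IsJet (spinSpace 𝔪 A) (fun T x => (c / s) •
      centProj (s • T x) (lax (fun _ => 0) (fun x => s • T x) (n + 1) x)) :=
    (hself.centProj (isJet_lax (isJet_const 0) hself (n + 1))).comp
      (g := fun y => (c / s) • y) (by fun_prop)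
  refine ⟨hjet.exists_local, fun T hT => ⟨hjet.differentiable hT, fun x => ?_⟩, fun v hv x => ?_⟩
  · have hγ := smul_mem_smoothCurves hT
    constructor
    · rw [lie_smul]
      have h1 := lie_centProj (symmetricSpace_cube hA (hγ.2 x))
        (lax (fun _ => 0) (fun x => s • T x) (n + 1) x)
      rw [smul_lie, smul_eq_zero_iff_right hs] at h1
      rw [h1, smul_zero]
    · obtain ⟨D, hD, hD'⟩ := map_hprimitive hA hγ (n + 1) x
      have hdT : deriv (fun x => s • T x) x = s • deriv T x :=
        ((hT.1.differentiable (by simp) x).hasDerivAt.const_smul s).deriv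
      have hd := (hD.fun_const_smul (c / s)).deriv
      rw [← hsdef] at hd hD'
      beta_reduce
      rw [hd, adCurveX, hF T hT x]
      have h2 : (c / s) • D + normSq 𝔪 • ⁅T x, ⁅T x, (c / s) • D⁆⁆ =
          (c / s) • centProj (s • T x) D := by
        rw [centProj]
        simp only [lie_smul, smul_lie, smul_add, smul_smul, ← hs2]
        congr 2
        ring
      rw [h2, hD', hdT]
      simp only [lie_smul, smul_lie, smul_smul]
      congr 1
      field_simp
  · change (c / s) • centProj (s • v) (lax (fun _ => 0) (fun _ => s • v) (n + 1) x) = 0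
    rw [lax_const, centProj_zero, smul_zero]

/-- The hierarchy of spin models in terms of the Lax equation. -/
theorem Rspin_iterate (hA : IsHermitianSymmetric 𝔥 𝔪 A) (hm : 𝔪 ≠ ⊥) (n : ℕ) :
    ∀ T ∈ smoothCurves (spinSpace 𝔪 A), ∀ x, ((Rspin 𝔪 A)^[n] curveX) T x =
      (√(normSq 𝔪) ^ n / √(normSq 𝔪)) • ⁅√(normSq 𝔪) • T x,
        lax (fun _ => 0) (fun x => √(normSq 𝔪) • T x) (n + 1) x⁆ := by
  have ha := normSq_pos hm
  have hs2 := Real.mul_self_sqrt ha.le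
  have hs : √(normSq 𝔪) ≠ 0 := (Real.sqrt_pos.2 ha).ne'
  have hdT : ∀ T ∈ smoothCurves (spinSpace 𝔪 A), ∀ x,
      deriv (fun x => √(normSq 𝔪) • T x) x = √(normSq 𝔪) • deriv T x := fun T hT x =>
    ((hT.1.differentiable (by simp) x).hasDerivAt.const_smul _).deriv
  induction n with
  | zero =>
    intro T hT x
    rw [← (map_lax_equation hA (smul_mem_smoothCurves hT) 0 x).deriv, lax_zero, hdT T hT, smul_smul,
      pow_zero, one_div, inv_mul_cancel₀ hs, one_smul]
    rfl
  | succ n ih =>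
    intro T hT x
    have hγ := smul_mem_smoothCurves hT
    obtain ⟨D, hD, hD'⟩ := map_recursion hA hγ (n + 1) x
    rw [Function.iterate_succ_apply', ← hD']
    set F := (Rspin 𝔪 A)^[n] curveX
    set s := √(normSq 𝔪) with hsdef
    have h1 : F T = fun x => (s ^ n / s) • ⁅s • T x, lax (fun _ => 0) (fun x => s • T x) (n + 1) x⁆ :=
      funext (ih T hT)
    change -(normSq 𝔪 • ⁅T x, deriv (F T) x -
      normSq 𝔪 • ⁅deriv T x, Hinv (spinSpace 𝔪 A) (normSq 𝔪) (adCurveX F) T x⁆⁆) = _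
    rw [Hinv_eq (isHPrimitive_spin hA hm ih) hT, h1, (hD.fun_const_smul (s ^ n / s)).deriv, hdT T hT]
    -- The powers of `s` inside the bracket cancel, and `ad(T)⁻¹ = -s ad(γ)` on tangent vectors
    -- contributes one factor `s` per step.
    rw [← hsdef, ← hs2]
    simp only [lie_sub, lie_smul, smul_lie, smul_sub, smul_neg, smul_smul]
    rw [show s * s * (s ^ n / s) = s ^ (n + 1) / s * s by field_simp; ring,
      show s * s * (s * s * (s ^ n / s / s)) = s ^ (n + 1) / s * (s * s) by
        field_simp; ring]

end SpinHierarchy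

end MapAndSpinHierarchies

/-! ### Time evolution of frames and zero curvature -/

section FrameEvolution

lemma isKilling_of_isCompactType (𝔤 : Type*) [LieRing 𝔤] [LieAlgebra ℝ 𝔤] [IsCompactType 𝔤] :
    LieAlgebra.IsKilling ℝ 𝔤 := by
  refine ⟨?_⟩
  rw [LieSubmodule.eq_bot_iff]
  intro x hx
  by_contra hne
  have h1 := IsCompactType.killing_neg x hne
  rw [LieIdeal.mem_killingCompl] at hx
  exact h1.ne (hx x trivial)

section

variable {𝔤 : Type*} [LieRing 𝔤] [LieAlgebra ℝ 𝔤] [IsCompactType 𝔤]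

/-- Local expressions in a smooth field are smooth. -/
lemma IsJet.contDiffOn_field {E : Type*} [NormedAddCommGroup E] [NormedSpace ℝ E] {N : Set 𝔤}
    {I : Set ℝ} {F : (ℝ → 𝔤) → ℝ → E} (h : IsJet N F) (hI : IsOpen I) {q : ℝ → ℝ → 𝔤}
    (hq : IsSmoothField N I q) :
    ContDiffOn ℝ ∞ (fun z : ℝ × ℝ => F (fun x => q x z.2) z.1) (univ ×ˢ I) := by
  obtain ⟨k, f, hf, hF⟩ := h
  have hU := isOpen_strip hI
  have key : ∀ i, ContDiffOn ℝ ∞ (fun z : ℝ × ℝ => iteratedDeriv i (fun x => q x z.2) z.1)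
      (univ ×ˢ I) := by
    intro i
    induction i with
    | zero => simpa using hq.1
    | succ i ih =>
      refine (contDiffOn_fderiv_apply hU ih (1, 0)).congr fun z hz => ?_
      rw [iteratedDeriv_succ]
      exact (hasDerivAt_slice_fst hU ih (x := z.1) (t := z.2) hz).deriv
  have h1 : ContDiffOn ℝ ∞ (fun z : ℝ × ℝ => fun i : Fin k =>
      iteratedDeriv i (fun x => q x z.2) z.1) (univ ×ˢ I) := contDiffOn_pi.2 fun i => key i
  exact (hf.comp_contDiffOn h1).congr fun z hz => hF _ (hq.slice hz.2) z.1

end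

variable {𝔤 : Type*} [LieRing 𝔤] [LieAlgebra ℝ 𝔤] [FiniteDimensional ℝ 𝔤] [IsCompactType 𝔤]
  {𝔥 : LieSubalgebra ℝ 𝔤} {𝔪 : Submodule ℝ 𝔤} {A : 𝔤} {I : Set ℝ}

/-- Derivations are inner. -/
lemma eq_adL_of_derivation {C : 𝔤 →L[ℝ] 𝔤} (hC : ∀ y z, C ⁅y, z⁆ = ⁅C y, z⁆ + ⁅y, C z⁆) :
    C = adL (adAdjoint C) := by
  have := isKilling_of_isCompactType 𝔤
  let D : LieDerivation ℝ 𝔤 𝔤 :=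
    { toLinearMap := (C : 𝔤 →ₗ[ℝ] 𝔤)
      leibniz' := fun y z => by
        change C ⁅y, z⁆ = ⁅y, C z⁆ - ⁅z, C y⁆
        rw [hC, ← lie_skew z (C y)]
        abel }
  obtain ⟨p, hp⟩ := LieDerivation.IsKilling.exists_eq_ad D
  have h1 : C = adL p := by
    ext y
    change D y = ⁅p, y⁆
    rw [← hp, LieDerivation.ad_apply_apply]
  rw [h1, adAdjoint_adL]

/-- `φ⁻¹φ'` is a derivation, hence inner; `adAdjoint` names the element explicitly, so it inherits
smoothness in parameters. -/
lemma deriv_aut_inner {φ : ℝ → 𝔤 ≃ₗ⁅ℝ⁆ 𝔤} {D : 𝔤 →L[ℝ] 𝔤} {t : ℝ}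
    (h : HasDerivAt (fun s => autL (φ s)) D t) (y : 𝔤) :
    HasDerivAt (fun s => φ s y) (φ t ⁅adAdjoint (autL (φ t)⁻¹ * D), y⁆) t := by
  have hd : ∀ y, HasDerivAt (fun s => φ s y) (D y) t := fun y => by
    simpa using h.clm_apply (hasDerivAt_const t y)
  have hC : ∀ y z, (autL (φ t)⁻¹ * D) ⁅y, z⁆ =
      ⁅(autL (φ t)⁻¹ * D) y, z⁆ + ⁅y, (autL (φ t)⁻¹ * D) z⁆ := by
    intro y z
    have h1 := hasDerivAt_lie (hd y) (hd z)
    simp only [← LieEquiv.map_lie] at h1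
    have h2 := (hd ⁅y, z⁆).unique h1
    change (φ t)⁻¹ (D ⁅y, z⁆) = ⁅(φ t)⁻¹ (D y), z⁆ + ⁅y, (φ t)⁻¹ (D z)⁆
    rw [h2, map_add, LieEquiv.map_lie, LieEquiv.map_lie, aut_inv_apply_apply, aut_inv_apply_apply]
  rw [← adL_apply, ← eq_adL_of_derivation hC]
  change HasDerivAt (fun s => φ s y) (φ t ((φ t)⁻¹ (D y))) t
  rw [aut_apply_inv_apply]
  exact hd y

lemma IsSmoothPath.exists_logDeriv {K : Subgroup (𝔤 ≃ₗ⁅ℝ⁆ 𝔤)} (hI : IsOpen I)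
    {g : ℝ → 𝔤 ≃ₗ⁅ℝ⁆ 𝔤} (hg : IsSmoothPath K I g) :
    ∃ d : ℝ → 𝔤, ContDiffOn ℝ ∞ d I ∧ HasLogDeriv g d I := by
  have h1 := contDiffOn_autL hg.2
  have h2 := h1.deriv_of_isOpen hI (m := ∞) (by simp)
  refine ⟨fun t => adAdjoint (autL (g t)⁻¹ * deriv (fun s => autL (g s)) t), ?_, fun t ht y => ?_⟩
  · exact (adAdjoint (𝔤 := 𝔤)).contDiff.comp_contDiffOn
      ((contDiffOn_autL (contDiffOn_aut_inv hg.2)).mul h2)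
  · exact deriv_aut_inner ((h1.contDiffAt (hI.mem_nhds ht)).differentiableAt (by simp)).hasDerivAt y

/-- The evolution `ψₜ = ψ ad(p)` of a frame, with the zero curvature equation
`qₜ = pₓ + [q, p]`. -/
lemma IsParallelFrame.exists_evolution {ψ : ℝ → ℝ → 𝔤 ≃ₗ⁅ℝ⁆ 𝔤} {χ q : ℝ → ℝ → 𝔤}
    (hA : IsHermitianSymmetric 𝔥 𝔪 A) (h : IsParallelFrame 𝔪 A I ψ χ q) (hI : IsOpen I) :
    ∃ p : ℝ → ℝ → 𝔤, ContDiffOn ℝ ∞ (fun z : ℝ × ℝ => p z.1 z.2) (univ ×ˢ I) ∧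
      (∀ x, HasLogDeriv (fun t => ψ x t) (fun t => p x t) I) ∧
      ∀ x, ∀ t ∈ I, ∃ p', HasDerivAt (fun x => p x t) p' x ∧
        HasDerivAt (fun t => q x t) (p' + ⁅q x t, p x t⁆) t := by
  have hU := isOpen_strip hI
  have hmem : ∀ (x : ℝ), ∀ t ∈ I, (x, t) ∈ (univ : Set ℝ) ×ˢ I := fun x t ht => ⟨mem_univ _, ht⟩
  have h1 := contDiffOn_autL h.smooth
  have h2 := contDiffOn_fderiv_apply hU h1 (0, 1)
  set p : ℝ × ℝ → 𝔤 := fun z => adAdjoint (autL (ψ z.1 z.2)⁻¹ *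
    fderiv ℝ (fun z : ℝ × ℝ => autL (ψ z.1 z.2)) z (0, 1)) with hp
  have hps : ContDiffOn ℝ ∞ p (univ ×ˢ I) := (adAdjoint (𝔤 := 𝔤)).contDiff.comp_contDiffOn
    ((contDiffOn_autL (contDiffOn_aut_inv h.smooth)).mul h2)
  have hpd : ∀ x, HasLogDeriv (fun t => ψ x t) (fun t => p (x, t)) I := fun x t ht y =>
    deriv_aut_inner (φ := fun t => ψ x t) (hasDerivAt_slice_snd hU h1 (hmem x t ht)) y
  have hqs := (h.isSmoothField_hasimoto hA hI).1
  refine ⟨fun x t => p (x, t), hps, hpd, fun x t ht => ⟨_, hasDerivAt_slice_fst hU hps (hmem x t ht),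
    ?_⟩⟩
  have hp' := hasDerivAt_slice_fst hU hps (hmem x t ht)
  have hq' := hasDerivAt_slice_snd hU hqs (hmem x t ht)
  refine hq'.congr_deriv (adL_injective ?_)
  ext y
  set f : ℝ × ℝ → 𝔤 := fun z => ψ z.1 z.2 y
  have hfs : ContDiffOn ℝ ∞ f (univ ×ˢ I) := h.smooth y
  have hx : ∀ z ∈ (univ : Set ℝ) ×ˢ I, fderiv ℝ f z (1, 0) = ψ z.1 z.2 ⁅q z.1 z.2, y⁆ :=
    fun z hz => (hasDerivAt_slice_fst hU hfs hz).unique (h.hasLogDeriv hI hz.2 z.1 (mem_univ _) y)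
  have ht' : ∀ z ∈ (univ : Set ℝ) ×ˢ I, fderiv ℝ f z (0, 1) = ψ z.1 z.2 ⁅p z, y⁆ :=
    fun z hz => (hasDerivAt_slice_snd hU hfs hz).unique (hpd z.1 z.2 hz.2 y)
  have e1 := hasDerivAt_slice_snd hU (contDiffOn_fderiv_apply hU hfs (1, 0)) (hmem x t ht)
  have e2 := hasDerivAt_slice_fst hU (contDiffOn_fderiv_apply hU hfs (0, 1)) (hmem x t ht)
  have e3 := (hpd x).apply ht (hasDerivAt_lie hq' (hasDerivAt_const t y))
  have e4 := (h.hasLogDeriv hI ht).apply (mem_univ x) (hasDerivAt_lie hp' (hasDerivAt_const x y))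
  have e5 := e1.unique (e3.congr_of_eventuallyEq (by
    filter_upwards [hI.mem_nhds ht] with s hs using hx (x, s) (hmem x s hs)))
  have e6 := e2.unique (e4.congr_of_eventuallyEq
    (Eventually.of_forall fun s => ht' (s, t) (hmem s t ht)))
  -- Zero curvature is the equality of the mixed partial derivatives of `ψ y`, with `ψ` cancelled.
  rw [fderiv_fderiv_comm hU hfs (hmem x t ht), e6] at e5
  have e7 := (ψ x t).injective e5
  simp only [lie_zero, add_zero] at e7
  change ⁅_, y⁆ = ⁅_, y⁆
  rw [add_lie, lie_lie, ← sub_eq_zero, ← neg_eq_zero, ← sub_eq_zero.2 e7]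
  abel

end FrameEvolution

/-! ### The flows expressed through `p + Xₙ` -/

section FlowsInTermsOfLax

lemma preimage_mul_inv {c : ℝ} (hc : c ≠ 0) (I : Set ℝ) :
    (fun t => c⁻¹ * t) ⁻¹' ((fun t => c * t) ⁻¹' I) = I := by
  ext t
  simp [hc]

lemma aut_apply_eq_iff {𝔤 : Type*} [LieRing 𝔤] [LieAlgebra ℝ 𝔤] (φ : 𝔤 ≃ₗ⁅ℝ⁆ 𝔤) {y z : 𝔤} :
    φ y = φ z ↔ y = z := φ.injective.eq_iff

lemma timeScale_inv {E : Type*} {c : ℝ} (hc : c ≠ 0) (f : ℝ → ℝ → E) :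
    timeScale c⁻¹ (timeScale c f) = f := by
  funext x t
  simp [timeScale, hc]

section

variable {𝔤 : Type*} [LieRing 𝔤] [LieAlgebra ℝ 𝔤] [IsCompactType 𝔤] {I : Set ℝ}

lemma IsSmoothField.timeScale {N : Set 𝔤} {f : ℝ → ℝ → 𝔤} (hf : IsSmoothField N I f) (c : ℝ) :
    IsSmoothField N ((fun t => c * t) ⁻¹' I) (timeScale c f) :=
  ⟨hf.1.comp (f := fun z : ℝ × ℝ => (z.1, c * z.2)) (by fun_prop) fun _ hz => ⟨mem_univ _, hz.2⟩,
    fun x _ ht => hf.2 x _ ht⟩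

lemma IsSmoothField.smul {N N' : Set 𝔤} {f : ℝ → ℝ → 𝔤} (hf : IsSmoothField N I f) {r : ℝ}
    (hr : ∀ v ∈ N, r • v ∈ N') : IsSmoothField N' I (fun x t => r • f x t) :=
  ⟨contDiffOn_const.smul hf.1, fun x t ht => hr _ (hf.2 x t ht)⟩

lemma IsHermitianSymmetric.map_mem {𝔥 : LieSubalgebra ℝ 𝔤}
    {𝔪 : Submodule ℝ 𝔤} {A : 𝔤} (hA : IsHermitianSymmetric 𝔥 𝔪 A) {φ : 𝔤 ≃ₗ⁅ℝ⁆ 𝔤}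
    (hφ : φ A = A) {y : 𝔤} (hy : y ∈ 𝔪) : φ y ∈ 𝔪 := by
  have h1 : φ y = -⁅A, ⁅A, φ y⁆⁆ := by
    conv_rhs => rw [← hφ, ← LieEquiv.map_lie, ← LieEquiv.map_lie, hA.sq y hy, map_neg, neg_neg]
  rw [h1]
  exact 𝔪.neg_mem (hA.lie_mem _)

end

variable {𝔤 : Type*} [LieRing 𝔤] [LieAlgebra ℝ 𝔤] [FiniteDimensional ℝ 𝔤] [IsCompactType 𝔤]
  {𝔥 : LieSubalgebra ℝ 𝔤} {𝔪 : Submodule ℝ 𝔤} {A : 𝔤} {I : Set ℝ}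

/-- The `+(n+1)` flow after rescaling time, in terms of the Lax equation. -/
lemma isospectralFlow_iff (hA : IsHermitianSymmetric 𝔥 𝔪 A) (hm : 𝔪 ≠ ⊥) {n : ℕ}
    {q : ℝ → ℝ → 𝔤} (hq : IsSmoothField (𝔪 : Set 𝔤) I q) :
    IsospectralFlow 𝔪 A n ((fun t => normSq 𝔪 * t) ⁻¹' I) (timeScale (normSq 𝔪) q) ↔
      ∀ x, ∀ t ∈ I, deriv (fun s => q x s) t =
        -⁅A, lax (fun x => q x t) (fun _ => A) (n + 1) x⁆ := by
  have ha := (normSq_pos hm).ne'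
  have key : ∀ x t, (1 / normSq 𝔪) • deriv (fun s => timeScale (normSq 𝔪) q x s) t =
      deriv (fun s => q x s) (normSq 𝔪 * t) := by
    intro x t
    change (1 / normSq 𝔪) • deriv (fun s => (fun s => q x s) (normSq 𝔪 * s)) t = _
    rw [deriv_comp_mul_left (normSq 𝔪) (fun s => q x s), smul_smul, one_div, inv_mul_cancel₀ ha,
      one_smul]
  constructor
  · intro h x t ht
    have ht' : normSq 𝔪 * ((normSq 𝔪)⁻¹ * t) = t := mul_inv_cancel_left₀ ha t
    have h1 := h.2 x ((normSq 𝔪)⁻¹ * t) (by rwa [mem_preimage, ht'])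
    rw [key, ht', Rop_iterate hA n] at h1
    · simpa only [timeScale, ht'] using h1
    · simp only [timeScale, ht']
      exact hq.slice ht
  · refine fun h => ⟨hq.timeScale _, fun x t ht => ?_⟩
    rw [key, h x _ ht]
    exact (Rop_iterate hA n _ (hq.slice (t := normSq 𝔪 * t) ht) x).symm

section Gauge

variable {k : ℝ → 𝔤 ≃ₗ⁅ℝ⁆ 𝔤}

lemma lax_map {φ : 𝔤 ≃ₗ⁅ℝ⁆ 𝔤} (hφ : φ A = A) {q : ℝ → 𝔤} (hq : q ∈ smoothCurves (𝔪 : Set 𝔤))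
    (n : ℕ) (x : ℝ) : lax (fun x => φ (q x)) (fun _ => A) n x = φ (lax q (fun _ => A) n x) :=
  lax_equivariant (ψ := fun _ => φ) (b := fun _ => 0)
    (fun x _ y => by simpa using hasDerivAt_const x (φ y)) (fun x => by rw [sub_zero])
    (fun _ => hφ.symm) (differentiable_lax hq) n x

/-- The Lax coefficients commute with automorphisms fixing `A`, so a time-dependent rotation changes
the flow only by the bracket with its logarithmic derivative. -/
lemma isospectralFlow_gauge_iff (hA : IsHermitianSymmetric 𝔥 𝔪 A) (hm : 𝔪 ≠ ⊥) (hI : IsOpen I)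
    {n : ℕ} {q : ℝ → ℝ → 𝔤} (hq : IsSmoothField (𝔪 : Set 𝔤) I q)
    (hk : ∀ y, ContDiffOn ℝ ∞ (fun t => k t y) I) (hkA : ∀ t ∈ I, k t A = A) {c : ℝ → 𝔤}
    (hc : HasLogDeriv k c I) :
    IsospectralFlow 𝔪 A n ((fun t => normSq 𝔪 * t) ⁻¹' I)
        (timeScale (normSq 𝔪) (fun x t => k t (q x t))) ↔
      ∀ x, ∀ t ∈ I, deriv (fun s => q x s) t =
        -⁅A, lax (fun x => q x t) (fun _ => A) (n + 1) x⁆ + ⁅q x t, c t⁆ := by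
  have hkq : IsSmoothField (𝔪 : Set 𝔤) I (fun x t => k t (q x t)) :=
    ⟨contDiffOn_aut_apply (φ := fun z : ℝ × ℝ => k z.2)
      (fun y => (hk y).comp contDiffOn_snd fun z hz => hz.2) hq.1,
      fun x t ht => hA.map_mem (hkA t ht) (hq.2 x t ht)⟩
  rw [isospectralFlow_iff hA hm hkq]
  refine forall_congr' fun x => forall₂_congr fun t ht => ?_
  have hd := hasDerivAt_slice_snd (isOpen_strip hI) hq.1 (x := x) (t := t) ⟨mem_univ _, ht⟩
  rw [lax_map (hkA t ht) (hq.slice ht)]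
  have h1 : -⁅A, k t (lax (fun x => q x t) (fun _ => A) (n + 1) x)⁆ =
      k t (-⁅A, lax (fun x => q x t) (fun _ => A) (n + 1) x⁆) := by
    rw [map_neg, LieEquiv.map_lie, hkA t ht]
  rw [(hc.apply ht hd).deriv, h1, aut_apply_eq_iff, hd.deriv, ← lie_skew (q x t) (c t),
    ← sub_eq_add_neg, eq_sub_iff_add_eq]

/-- It is the inverse path that has logarithmic derivative `c`. The last clause, applied to `B = A`,
places the path in the isotropy group when `c` commutes with `A`. -/
lemma exists_path_inv_logDeriv (hI : IsOpen I) (hI' : I.OrdConnected) {c : ℝ → 𝔤}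
    (hc : ContDiffOn ℝ ∞ c I) :
    ∃ h : ℝ → 𝔤 ≃ₗ⁅ℝ⁆ 𝔤, IsSmoothPath (adjointGroup 𝔤) I h ∧
      HasLogDeriv (fun t => (h t)⁻¹) c I ∧
      ∀ B, (∀ t ∈ I, ⁅c t, B⁆ = 0) → ∀ t ∈ I, h t B = B := by
  rcases I.eq_empty_or_nonempty with rfl | ⟨t₀, ht₀⟩
  · exact ⟨fun _ => 1, ⟨by simp, by simp⟩, by simp [HasLogDeriv], by simp⟩
  obtain ⟨h, h1, h2, h3⟩ := exists_smooth_path hI hI' hc.neg ht₀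
  have h4 : HasLogDeriv (fun t => (h t)⁻¹) c I := fun t ht y =>
    hasDerivAt_aut_inv (fun y => h3 t ht y) y
  refine ⟨h, h1, h4, fun B hB t ht => ?_⟩
  have h5 : (h t)⁻¹ B = (h t₀)⁻¹ B :=
    const_of_hasDerivAt_zero hI hI' (f := fun t => (h t)⁻¹ B)
      (fun s hs => (h4 s hs B).congr_deriv (by rw [hB s hs, map_zero])) ht ht₀
  rw [h2, inv_one, aut_one_apply] at h5
  rw [← h5, aut_apply_inv_apply, h5]

end Gauge

namespace IsParallelFrame

variable {ψ : ℝ → ℝ → 𝔤 ≃ₗ⁅ℝ⁆ 𝔤} {χ q p : ℝ → ℝ → 𝔤}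

lemma mul_left (h : IsParallelFrame 𝔪 A I ψ χ q) (hI : IsOpen I) {g : ℝ → 𝔤 ≃ₗ⁅ℝ⁆ 𝔤}
    (hg : IsSmoothPath (adjointGroup 𝔤) I g) :
    IsParallelFrame 𝔪 A I (fun x t => g t * ψ x t) (fun x t => g t (χ x t)) q where
  mem x t ht := mul_mem (hg.1 t ht) (h.mem x t ht)
  smooth y := contDiffOn_aut_apply (φ := fun z : ℝ × ℝ => g z.2)
    (fun y => (hg.2 y).comp contDiffOn_snd fun z hz => hz.2) (h.smooth y)
  map_eq x t ht := by rw [h.map_eq x t ht, aut_mul_apply]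
  q_mem := h.q_mem
  deriv_eq x t ht y := by
    have h1 := (autL (g t)).hasFDerivAt.comp_hasDerivAt x (h.hasLogDeriv hI ht x (mem_univ x) y)
    exact h1.deriv

/-- Pulled back by the frame, `χₜ` is `[p, A]` and the right-hand side is `[A, Xₙ₊₁]`. -/
lemma mapFlow_iff (hA : IsHermitianSymmetric 𝔥 𝔪 A) (h : IsParallelFrame 𝔪 A I ψ χ q)
    (hI : IsOpen I) (hp : ∀ x, HasLogDeriv (fun t => ψ x t) (fun t => p x t) I) (n : ℕ) :
    MapFlow A n I χ ↔ ∀ x, ∀ t ∈ I,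
      ⁅A, p x t + lax (fun x => q x t) (fun _ => A) (n + 1) x⁆ = 0 := by
  have hχ := h.isSmoothField_map
  have hq := h.isSmoothField_hasimoto hA hI
  rw [MapFlow, and_iff_right hχ]
  refine forall_congr' fun x => forall₂_congr fun t ht => ?_
  have h1 : HasDerivAt (fun s => χ x s) (ψ x t ⁅p x t, A⁆) t :=
    (hp x t ht A).congr_of_eventuallyEq (by
      filter_upwards [hI.mem_nhds ht] with s hs using h.map_eq x s hs)
  rw [h1.deriv, Rmap_iterate hA n _ (hχ.slice ht),
    lax_frame (hq.slice ht) (h.hasLogDeriv hI ht) (fun x => h.map_eq x t ht), h.map_eq x t ht,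
    ← LieEquiv.map_lie, aut_apply_eq_iff, ← lie_skew, lie_add, eq_comm,
    eq_neg_iff_add_eq_zero, add_comm]

end IsParallelFrame

section Evolution

variable {q p : ℝ → ℝ → 𝔤} {n : ℕ}

/-- Zero curvature for `p` and the Lax equation for `Xₙ` add up to one equation for `w = p + Xₙ`. -/
lemma hasDerivAt_add_lax (hA : IsHermitianSymmetric 𝔥 𝔪 A) (hq : IsSmoothField (𝔪 : Set 𝔤) I q)
    {x t : ℝ} (ht : t ∈ I) (hp : ∃ p', HasDerivAt (fun x => p x t) p' x ∧
      HasDerivAt (fun t => q x t) (p' + ⁅q x t, p x t⁆) t) (n : ℕ) :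
    HasDerivAt (fun x => p x t + lax (fun x => q x t) (fun _ => A) n x)
      (deriv (fun t => q x t) t + ⁅A, lax (fun x => q x t) (fun _ => A) (n + 1) x⁆ -
        ⁅q x t, p x t + lax (fun x => q x t) (fun _ => A) n x⁆) x := by
  obtain ⟨p', h1, h2⟩ := hp
  refine (h1.fun_add (differentiable_lax (A := A) (hq.slice ht) n x).hasDerivAt).congr_deriv ?_
  rw [h2.deriv, ← lax_equation hA (hq.slice ht), lie_add]
  abel

lemma deriv_mem (hA : IsHermitianSymmetric 𝔥 𝔪 A) (hI : IsOpen I)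
    (hq : IsSmoothField (𝔪 : Set 𝔤) I q) (x : ℝ) {t : ℝ} (ht : t ∈ I) :
    deriv (fun t => q x t) t ∈ 𝔪 := by
  have hd := (hasDerivAt_slice_snd (isOpen_strip hI) hq.1 (x := x) (t := t)
    ⟨mem_univ _, ht⟩).differentiableAt.hasDerivAt
  have h1 := (adL A * adL A).hasFDerivAt.comp_hasDerivAt t hd
  have h2 : (fun t => -q x t) =ᶠ[𝓝 t] (adL A * adL A) ∘ fun t => q x t := by
    filter_upwards [hI.mem_nhds ht] with s hs using (hA.sq _ (hq.2 x s hs)).symm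
  have h3 := hd.fun_neg.unique (h1.congr_of_eventuallyEq h2)
  rw [← neg_neg (deriv (fun t => q x t) t), h3]
  exact 𝔪.neg_mem (hA.lie_mem _)

/-- For `w` in `𝔥`, the expression for `wₓ` lies in `𝔪`, while `[A, wₓ] = 0`; as `ad(A)` is
injective on `𝔪`, it vanishes. -/
lemma evolution_of_lie_eq_zero (hA : IsHermitianSymmetric 𝔥 𝔪 A) (hI : IsOpen I)
    (hq : IsSmoothField (𝔪 : Set 𝔤) I q)
    (hp : ∀ x, ∀ t ∈ I, ∃ p', HasDerivAt (fun x => p x t) p' x ∧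
      HasDerivAt (fun t => q x t) (p' + ⁅q x t, p x t⁆) t) {t : ℝ} (ht : t ∈ I)
    (h : ∀ x, ⁅A, p x t + lax (fun x => q x t) (fun _ => A) n x⁆ = 0) (x : ℝ) :
    p x t + lax (fun x => q x t) (fun _ => A) n x =
        p 0 t + lax (fun x => q x t) (fun _ => A) n 0 ∧
      deriv (fun s => q x s) t = -⁅A, lax (fun x => q x t) (fun _ => A) (n + 1) x⁆ +
        ⁅q x t, p x t + lax (fun x => q x t) (fun _ => A) n x⁆ := by
  have hd := fun x => hasDerivAt_add_lax hA hq ht (hp x t ht) n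
  have h0 : ∀ x, deriv (fun t => q x t) t + ⁅A, lax (fun x => q x t) (fun _ => A) (n + 1) x⁆ -
      ⁅q x t, p x t + lax (fun x => q x t) (fun _ => A) n x⁆ = 0 := by
    intro x
    have h1 := (adL A).hasFDerivAt.comp_hasDerivAt x (hd x)
    have h2 := h1.unique ((hasDerivAt_const x (0 : 𝔤)).congr_of_eventuallyEq
      (Eventually.of_forall h))
    rw [adL_apply] at h2
    have h3 := hA.sq _ (𝔪.sub_mem (𝔪.add_mem (deriv_mem hA hI hq x ht) (hA.lie_mem
      (lax (fun x => q x t) (fun _ => A) (n + 1) x)))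
      (hA.lie_m_h (hq.2 x t ht) ((hA.centralizer _).1 (h x))))
    rwa [h2, lie_zero, zero_eq_neg] at h3
  refine ⟨eq_of_hasDerivAt_zero (fun x => (hd x).congr_deriv (h0 x)) x 0, ?_⟩
  rw [← sub_eq_zero, ← h0 x]
  abel

/-- The hypothesis says exactly `(w - c)ₓ + [q, w - c] = 0`, that is, `w - c` is covariantly
constant and its image under `ψ` is constant. -/
lemma frame_apply_const (hA : IsHermitianSymmetric 𝔥 𝔪 A) {ψ : ℝ → ℝ → 𝔤 ≃ₗ⁅ℝ⁆ 𝔤}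
    {χ : ℝ → ℝ → 𝔤} (hψ : IsParallelFrame 𝔪 A I ψ χ q) (hI : IsOpen I)
    (hp : ∀ x, ∀ t ∈ I, ∃ p', HasDerivAt (fun x => p x t) p' x ∧
      HasDerivAt (fun t => q x t) (p' + ⁅q x t, p x t⁆) t) {t : ℝ} (ht : t ∈ I) {c : 𝔤}
    (h : ∀ x, deriv (fun s => q x s) t =
      -⁅A, lax (fun x => q x t) (fun _ => A) (n + 1) x⁆ + ⁅q x t, c⁆) (x y : ℝ) :
    ψ x t (p x t + lax (fun x => q x t) (fun _ => A) n x - c) =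
      ψ y t (p y t + lax (fun x => q x t) (fun _ => A) n y - c) := by
  have hq := hψ.isSmoothField_hasimoto hA hI
  refine eq_of_hasDerivAt_zero (f := fun x => ψ x t
    (p x t + lax (fun x => q x t) (fun _ => A) n x - c)) (fun x => ?_) x y
  have h1 := (hψ.hasLogDeriv hI ht).apply (mem_univ x)
    ((hasDerivAt_add_lax hA hq ht (hp x t ht) n).sub_const c)
  refine h1.congr_deriv ?_
  rw [h x, lie_sub, ← map_zero (ψ x t)]
  congr 1
  abel

end Evolution

end FlowsInTermsOfLax

/-! ### Equivalence of the map equation and the isospectral flow -/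

section Equivalence

variable {𝔤 : Type*} [LieRing 𝔤] [LieAlgebra ℝ 𝔤] [FiniteDimensional ℝ 𝔤] [IsCompactType 𝔤]
  {𝔥 : LieSubalgebra ℝ 𝔤} {𝔪 : Submodule ℝ 𝔤} {A : 𝔤} {I : Set ℝ}
  {ψ : ℝ → ℝ → 𝔤 ≃ₗ⁅ℝ⁆ 𝔤} {χ q : ℝ → ℝ → 𝔤}

lemma HasLogDeriv.mul {φ φ' : ℝ → 𝔤 ≃ₗ⁅ℝ⁆ 𝔤} {b b' : ℝ → 𝔤} {s : Set ℝ} (h : HasLogDeriv φ b s)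
    (h' : HasLogDeriv φ' b' s) :
    HasLogDeriv (fun t => φ t * φ' t) (fun t => b' t + (φ' t)⁻¹ (b t)) s := by
  intro t ht y
  refine (h.apply ht (h' t ht y)).congr_deriv ?_
  rw [aut_mul_apply, add_lie, map_add (φ' t), map_add (φ t), LieEquiv.map_lie (φ' t) ((φ' t)⁻¹ (b t)),
    aut_apply_inv_apply, ← map_add]

lemma IsSmoothPath.inv {K : Subgroup (𝔤 ≃ₗ⁅ℝ⁆ 𝔤)} {g : ℝ → 𝔤 ≃ₗ⁅ℝ⁆ 𝔤} (hg : IsSmoothPath K I g) :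
    IsSmoothPath K I (fun t => (g t)⁻¹) :=
  ⟨fun t ht => inv_mem (hg.1 t ht), contDiffOn_aut_inv hg.2⟩

lemma isotropyGroup_inv_apply {φ : 𝔤 ≃ₗ⁅ℝ⁆ 𝔤} (hφ : φ ∈ isotropyGroup A) : φ⁻¹ A = A :=
  (inv_mem hφ).2

/-- Bracketing with a basis is an injective linear map, hence a closed embedding in finite
dimensions. -/
lemma tendsto_zero_of_lie {ι : Type*} {l : Filter ι} {p : ι → 𝔤}
    (h : ∀ y : 𝔤, Tendsto (fun i => ⁅p i, y⁆) l (𝓝 0)) : Tendsto p l (𝓝 0) := by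
  let b := Module.finBasis ℝ 𝔤
  let L : 𝔤 →ₗ[ℝ] (Fin (Module.finrank ℝ 𝔤) → 𝔤) :=
    LinearMap.pi fun i => ((adL (𝔤 := 𝔤)).flip (b i)).toLinearMap
  have hL : Function.Injective L := fun y z hyz => adL_injective
    (ContinuousLinearMap.coe_injective (b.ext fun i => congrFun hyz i))
  have hL' := (LinearMap.isClosedEmbedding_of_injective (LinearMap.ker_eq_bot.2 hL)).isInducing
  rw [hL'.tendsto_nhds_iff, map_zero, tendsto_pi_nhds]
  exact fun i => h (b i)

/-- `Xₙ₊₁` is a continuous function of the jet that vanishes at the zero jet. The index starts at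
one because `X₀ = A`. -/
lemma tendsto_lax {q : ℝ → 𝔤} (hq : q ∈ smoothCurves (𝔪 : Set 𝔤)) {l : Filter ℝ}
    (hd : ∀ i : ℕ, Tendsto (iteratedDeriv i q) l (𝓝 0)) (n : ℕ) :
    Tendsto (lax q (fun _ => A) (n + 1)) l (𝓝 0) := by
  obtain ⟨k, f, hf, hF⟩ := isJet_lax (N := (𝔪 : Set 𝔤)) isJet_self (isJet_const A) (n + 1)
  have h0 := hF (fun _ => 0) ⟨contDiff_const, fun _ => 𝔪.zero_mem⟩ 0
  beta_reduce at h0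
  rw [lax_const] at h0
  beta_reduce at h0
  rw [h0]
  refine ((hf.continuous.tendsto _).comp (tendsto_pi_nhds.2 fun i => ?_)).congr
    fun x => (hF q hq x).symm
  simpa using hd i

namespace IsParallelFrame

/-- The map equation and the isospectral flow are equivalent up to time dependent isometries. -/
theorem exists_mapFlow_iff_exists_isospectralFlow (hA : IsHermitianSymmetric 𝔥 𝔪 A) (hm : 𝔪 ≠ ⊥)
    (n : ℕ) (hI : IsOpen I) (hI' : I.OrdConnected) (h : IsParallelFrame 𝔪 A I ψ χ q) :
    (∃ g, IsSmoothPath (adjointGroup 𝔤) I g ∧ MapFlow A n I (fun x t => g t (χ x t))) ↔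
      ∃ k, IsSmoothPath (isotropyGroup A) I k ∧
        IsospectralFlow 𝔪 A (n + 1) ((fun t => normSq 𝔪 * t) ⁻¹' I)
          (timeScale (normSq 𝔪) (fun x t => (k t)⁻¹ (q x t))) := by
  have hq := h.isSmoothField_hasimoto hA hI
  have hjet : IsJet (𝔪 : Set 𝔤) (fun q => lax q (fun _ => A) (n + 1)) :=
    isJet_lax isJet_self (isJet_const A) (n + 1)
  have hX := hjet.contDiffOn_field hI hq
  have hsm : ∀ {p : ℝ → ℝ → 𝔤}, ContDiffOn ℝ ∞ (fun z : ℝ × ℝ => p z.1 z.2) (univ ×ˢ I) →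
      ContDiffOn ℝ ∞ (fun t => p 0 t + lax (fun x => q x t) (fun _ => A) (n + 1) 0) I := fun hp =>
    (hp.add hX).comp (f := fun t : ℝ => ((0 : ℝ), t)) (by fun_prop) fun t ht => ⟨mem_univ _, ht⟩
  constructor
  · rintro ⟨g, hg, hflow⟩
    have h' := h.mul_left hI hg
    obtain ⟨p, hps, hp, hpq⟩ := h'.exists_evolution hA hI
    have h1 := (h'.mapFlow_iff hA hI hp n).1 hflow
    have h2 := fun x t ht => evolution_of_lie_eq_zero hA hI hq hpq (t := t) ht (fun x => h1 x t ht) x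
    -- The rotation has to absorb `c(t) = w(0, t)`, which equals `w(x, t)` for every `x`.
    obtain ⟨k, hk, hkc, hkA⟩ := exists_path_inv_logDeriv hI hI' (hsm hps)
    have hkA := hkA A fun t ht => by rw [← lie_skew, h1 0 t ht, neg_zero]
    have hk' : IsSmoothPath (isotropyGroup A) I k := ⟨fun t ht => ⟨hk.1 t ht, hkA t ht⟩, hk.2⟩
    refine ⟨k, hk', (isospectralFlow_gauge_iff hA hm hI hq hk.inv.2
      (fun t ht => isotropyGroup_inv_apply (hk'.1 t ht)) hkc).2 fun x t ht => ?_⟩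
    rw [← (h2 x t ht).1, (h2 x t ht).2]
  · rintro ⟨k, hk, hflow⟩
    obtain ⟨c, hcs, hc⟩ := hk.inv.exists_logDeriv hI
    have hkA : ∀ t ∈ I, (k t)⁻¹ A = A := fun t ht => isotropyGroup_inv_apply (hk.1 t ht)
    have hcA : ∀ t ∈ I, ⁅A, c t⁆ = 0 := by
      intro t ht
      have h1 := (hc t ht A).unique ((hasDerivAt_const t A).congr_of_eventuallyEq (by
        filter_upwards [hI.mem_nhds ht] with s hs using hkA s hs))
      rw [← map_zero ((k t)⁻¹), aut_apply_eq_iff] at h1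
      rw [← lie_skew, h1, neg_zero]
    have h1 := (isospectralFlow_gauge_iff hA hm hI hq hk.inv.2 hkA hc).1 hflow
    obtain ⟨p, hps, hp, hpq⟩ := h.exists_evolution hA hI
    have h2 := fun t ht => frame_apply_const hA h hI hpq (t := t) ht (fun x => h1 x t ht)
    set d : ℝ → 𝔤 := fun t => ψ 0 t (p 0 t + lax (fun x => q x t) (fun _ => A) (n + 1) 0 - c t)
    have hd : ContDiffOn ℝ ∞ d I := contDiffOn_aut_apply
      (fun y => (h.smooth y).comp (f := fun t : ℝ => ((0 : ℝ), t)) (by fun_prop)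
        fun t ht => ⟨mem_univ _, ht⟩) ((hsm hps).sub hcs)
    -- Logarithmic derivative `-d` replaces `p` by `p - ψ⁻¹d = p - (w - c)`, so the new `w` is `c`,
    -- which commutes with `A`.
    obtain ⟨g, hg, hgd, -⟩ := exists_path_inv_logDeriv hI hI' hd.neg
    refine ⟨fun t => (g t)⁻¹, hg.inv, ((h.mul_left hI hg.inv).mapFlow_iff hA hI
      (fun x => hgd.mul (hp x)) n).2 fun x t ht => ?_⟩
    have h3 : (ψ x t)⁻¹ (d t) = p x t + lax (fun x => q x t) (fun _ => A) (n + 1) x - c t := by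
      simp only [d]
      rw [← h2 t ht x 0, aut_inv_apply_apply]
    rw [map_neg, h3, ← hcA t ht]
    congr 1
    abel

lemma tendsto_evolution {p : ℝ → ℝ → 𝔤} {t : ℝ} (ht : t ∈ I)
    (hp : ∀ x, HasLogDeriv (fun t => ψ x t) (fun t => p x t) I)
    (hψ : ∀ y : 𝔤, Tendsto (fun x => deriv (fun s => ψ x s y) t) atBot (𝓝 0)) :
    Tendsto (fun x => p x t) atBot (𝓝 0) := by
  refine tendsto_zero_of_lie fun y => ?_
  rw [tendsto_zero_iff_norm_tendsto_zero]
  refine (tendsto_zero_iff_norm_tendsto_zero.1 (hψ y)).congr fun x => ?_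
  rw [(hp x t ht y).deriv, norm_equiv]

/-- The map equation and the isospectral flow are equivalent under decay at `x = -∞`. -/
theorem mapFlow_iff_isospectralFlow (hA : IsHermitianSymmetric 𝔥 𝔪 A) (hm : 𝔪 ≠ ⊥) (n : ℕ)
    (hI : IsOpen I) (h : IsParallelFrame 𝔪 A I ψ χ q)
    (hd : ∀ t ∈ I, ∀ i : ℕ, Tendsto (iteratedDeriv i (fun x => q x t)) atBot (𝓝 0))
    (hψ : ∀ t ∈ I, ∀ y : 𝔤, Tendsto (fun x => deriv (fun s => ψ x s y) t) atBot (𝓝 0)) :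
    MapFlow A n I χ ↔ IsospectralFlow 𝔪 A (n + 1) ((fun t => normSq 𝔪 * t) ⁻¹' I)
      (timeScale (normSq 𝔪) q) := by
  have hq := h.isSmoothField_hasimoto hA hI
  obtain ⟨p, -, hp, hpq⟩ := h.exists_evolution hA hI
  have hw : ∀ t ∈ I, Tendsto (fun x => p x t + lax (fun x => q x t) (fun _ => A) (n + 1) x) atBot
      (𝓝 0) := fun t ht => by
    simpa using (tendsto_evolution ht hp (hψ t ht)).add
      (tendsto_lax (A := A) (hq.slice ht) (hd t ht) n)
  rw [h.mapFlow_iff hA hI hp, isospectralFlow_iff hA hm hq]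
  refine ⟨fun h1 x t ht => ?_, fun h1 x t ht => ?_⟩
  · have h2 := evolution_of_lie_eq_zero hA hI hq hpq ht (fun x => h1 x t ht)
    -- `w` does not depend on `x` and tends to zero at `-∞`, so the gauge term is absent.
    have h3 := tendsto_nhds_unique (hw t ht) (tendsto_const_nhds.congr fun x => (h2 x).1.symm)
    rw [(h2 x).2, (h2 x).1, ← h3, lie_zero, add_zero]
  · have h2 := frame_apply_const hA h hI hpq (n := n + 1) (c := 0) ht
      (fun x => by rw [h1 x t ht, lie_zero, add_zero])
    simp only [sub_zero] at h2
    -- The frame need not converge at `-∞`, but it acts isometrically, so constancy of `ψ w` makes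
    -- the norm of `w` constant.
    have h3 : ‖p x t + lax (fun x => q x t) (fun _ => A) (n + 1) x‖ = ‖(0 : 𝔤)‖ :=
      tendsto_nhds_unique (tendsto_const_nhds.congr fun y => by
        rw [← norm_equiv (ψ x t), h2 x y, norm_equiv]) (hw t ht).norm
    rw [norm_zero, norm_eq_zero] at h3
    rw [h3, lie_zero]

end IsParallelFrame

end Equivalence

/-! ### Rescaling to the spin model -/

section SpinModel

variable {𝔤 : Type*} [LieRing 𝔤] [LieAlgebra ℝ 𝔤] [FiniteDimensional ℝ 𝔤] [IsCompactType 𝔤]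
  {𝔥 : LieSubalgebra ℝ 𝔤} {𝔪 : Submodule ℝ 𝔤} {A : 𝔤} {I : Set ℝ}

/-- `-ad(A)²` is the projection onto `𝔪`, so its trace is the dimension of `𝔪`. -/
lemma norm_hermitian (hA : IsHermitianSymmetric 𝔥 𝔪 A) : ‖A‖ = √(normSq 𝔪) := by
  have hproj : LinearMap.IsProj 𝔪 ((-(adL A * adL A) : 𝔤 →L[ℝ] 𝔤) : 𝔤 →ₗ[ℝ] 𝔤) := by
    refine ⟨fun y => 𝔪.neg_mem (hA.lie_mem _), fun y hy => ?_⟩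
    change -⁅A, ⁅A, y⁆⁆ = y
    rw [hA.sq y hy, neg_neg]
  have h1 : ‖A‖ ^ 2 = normSq 𝔪 := by
    rw [← real_inner_self_eq_norm_sq, inner_eq_neg_trL, ← map_neg, trL_apply]
    exact hproj.trace
  rw [← h1, Real.sqrt_sq (norm_nonneg A)]

/-- Rescaling time multiplies `Tₜ` by `sⁿ / s`, with `s = √(dim 𝔪)`, which is exactly the factor in
`Rspin_iterate`. -/
theorem mapFlow_iff_spinFlow (hA : IsHermitianSymmetric 𝔥 𝔪 A) (hm : 𝔪 ≠ ⊥) (n : ℕ)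
    (χ : ℝ → ℝ → 𝔤) :
    MapFlow A n I χ ↔ SpinFlow 𝔪 A n ((fun t => √(normSq 𝔪) ^ n * t) ⁻¹' I)
      (timeScale (√(normSq 𝔪) ^ n) (fun x t => (1 / √(normSq 𝔪)) • χ x t)) := by
  have hs : 0 < √(normSq 𝔪) := Real.sqrt_pos.2 (normSq_pos hm)
  have hc : √(normSq 𝔪) ^ n ≠ 0 := (pow_pos hs n).ne'
  set s := √(normSq 𝔪) with hsdef
  set c := s ^ n with hcdef
  have hsv : ∀ v : 𝔤, s • (1 / s) • v = v := fun v => by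
    rw [smul_smul, mul_one_div_cancel hs.ne', one_smul]
  have hsm : IsSmoothField (symmetricSpace A) I χ ↔ IsSmoothField (spinSpace 𝔪 A)
      ((fun t => c * t) ⁻¹' I) (timeScale c (fun x t => (1 / s) • χ x t)) := by
    constructor
    · refine fun h => (h.smul fun v hv => ?_).timeScale c
      change s • (1 / s) • v ∈ symmetricSpace A
      rwa [hsv]
    · intro h
      have h1 := h.timeScale c⁻¹
      rw [preimage_mul_inv hc, timeScale_inv hc] at h1
      have h2 := h1.smul (N' := symmetricSpace A) (r := s) fun v hv => hv
      simpa only [hsv] using h2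
  have hnorm : ∀ v ∈ symmetricSpace A, ‖(1 / s) • v‖ = 1 := by
    rintro _ ⟨φ, -, rfl⟩
    rw [norm_smul, norm_equiv, norm_hermitian hA, ← hsdef, Real.norm_of_nonneg (by positivity),
      one_div_mul_cancel hs.ne']
  rw [MapFlow, SpinFlow, ← hsm]
  refine and_congr_right fun hχ => ?_
  have hone : ∀ x, ∀ t ∈ (fun t => c * t) ⁻¹' I,
      ‖timeScale c (fun x t => (1 / s) • χ x t) x t‖ = 1 := fun x t ht => hnorm _ (hχ.2 x _ ht)
  rw [and_iff_right hone]
  have key : ∀ x t, c * t ∈ I →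
      ((deriv (fun s' => timeScale c (fun x t => (1 / s) • χ x t) x s') t =
        ((Rspin 𝔪 A)^[n] curveX) (fun y => timeScale c (fun x t => (1 / s) • χ x t) y t) x) ↔
      deriv (fun s' => χ x s') (c * t) = ((Rmap A)^[n] curveX) (fun y => χ y (c * t)) x) := by
    intro x t ht
    rw [Rspin_iterate hA hm n _ ((hsm.1 hχ).slice ht), Rmap_iterate hA n _ (hχ.slice ht)]
    simp only [timeScale, ← hsdef, ← hcdef, hsv]
    rw [deriv_comp_mul_left c (fun s' => (1 / s) • χ x s'), deriv_fun_const_smul_field, smul_smul,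
      mul_one_div, (smul_right_injective 𝔤 (div_ne_zero hc hs.ne')).eq_iff]
  refine forall_congr' fun x => ⟨fun h t ht => (key x t ht).2 (h _ ht), fun h t ht => ?_⟩
  have ht' : c * (c⁻¹ * t) = t := mul_inv_cancel_left₀ hc t
  have h1 := (key x (c⁻¹ * t) (by rwa [ht'])).1 (h _ (by rwa [mem_preimage, ht']))
  rwa [ht'] at h1

end SpinModel

end HermSym

/-! ### Assembly of the theorem -/

open HermSym
theorem mainTheorem10 {𝔤 : Type*} [LieRing 𝔤] [LieAlgebra ℝ 𝔤] [FiniteDimensional ℝ 𝔤]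
    [IsCompactType 𝔤] (𝔥 : LieSubalgebra ℝ 𝔤) (𝔪 : Submodule ℝ 𝔤) (A : 𝔤)
    (hA : IsHermitianSymmetric 𝔥 𝔪 A) (hm : 𝔪 ≠ ⊥) (n : ℕ)
    (I : Set ℝ) (hI : IsOpen I) (hI' : I.OrdConnected) :
    -- the inverse derivatives in the three hierarchies are well defined
    (∀ k : ℕ,
      (∃ P, IsPrimitive 𝔪 (adq (Jinv A ((Rop 𝔪 A)^[k] (Jq A)))) P ∧
        ∀ P', IsPrimitive 𝔪 (adq (Jinv A ((Rop 𝔪 A)^[k] (Jq A)))) P' →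
          ∀ q ∈ smoothCurves (𝔪 : Set 𝔤), P' q = P q) ∧
      (∃ P, IsHPrimitive (symmetricSpace A) 1 (adCurveX ((Rmap A)^[k] curveX)) P ∧
        ∀ P', IsHPrimitive (symmetricSpace A) 1 (adCurveX ((Rmap A)^[k] curveX)) P' →
          ∀ γ ∈ smoothCurves (symmetricSpace A), P' γ = P γ) ∧
      (∃ P, IsHPrimitive (spinSpace 𝔪 A) (normSq 𝔪) (adCurveX ((Rspin 𝔪 A)^[k] curveX)) P ∧
        ∀ P', IsHPrimitive (spinSpace 𝔪 A) (normSq 𝔪) (adCurveX ((Rspin 𝔪 A)^[k] curveX)) P' →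
          ∀ γ ∈ smoothCurves (spinSpace 𝔪 A), P' γ = P γ)) ∧
    -- every map has a Hasimoto variable, and every `𝔪`-valued `q` is one
    (∀ χ, IsSmoothField (symmetricSpace A) I χ → ∃ ψ q, IsParallelFrame 𝔪 A I ψ χ q) ∧
    (∀ q, IsSmoothField (𝔪 : Set 𝔤) I q → ∃ ψ χ, IsParallelFrame 𝔪 A I ψ χ q) ∧
    -- equivalence of the map equation with the isospectral flow, modulo the freedom
    -- in the correspondence between maps and Hasimoto variables
    (∀ (ψ : ℝ → ℝ → (𝔤 ≃ₗ⁅ℝ⁆ 𝔤)) (χ q : ℝ → ℝ → 𝔤), IsParallelFrame 𝔪 A I ψ χ q →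
      ((∃ g, IsSmoothPath (adjointGroup 𝔤) I g ∧ MapFlow A n I (fun x t => g t (χ x t))) ↔
       (∃ h, IsSmoothPath (isotropyGroup A) I h ∧
          IsospectralFlow 𝔪 A (n + 1) ((fun t => normSq 𝔪 * t) ⁻¹' I)
            (timeScale (normSq 𝔪) (fun x t => (h t)⁻¹ (q x t)))))) ∧
    -- exact equivalence under decay at `x = -∞`
    (∀ (ψ : ℝ → ℝ → (𝔤 ≃ₗ⁅ℝ⁆ 𝔤)) (χ q : ℝ → ℝ → 𝔤), IsParallelFrame 𝔪 A I ψ χ q →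
      (∀ t ∈ I, ∀ i : ℕ, Tendsto (iteratedDeriv i (fun x => q x t)) atBot (𝓝 0)) →
      (∀ t ∈ I, ∀ y : 𝔤, Tendsto (fun x => deriv (fun s => ψ x s y) t) atBot (𝓝 0)) →
      (MapFlow A n I χ ↔
        IsospectralFlow 𝔪 A (n + 1) ((fun t => normSq 𝔪 * t) ⁻¹' I)
          (timeScale (normSq 𝔪) q))) ∧
    -- equivalence of the map equation with the spin model
    (∀ χ : ℝ → ℝ → 𝔤, MapFlow A n I χ ↔
      SpinFlow 𝔪 A n ((fun t => √(normSq 𝔪) ^ n * t) ⁻¹' I)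
        (timeScale (√(normSq 𝔪) ^ n) (fun x t => (1 / √(normSq 𝔪)) • χ x t))) := by
  refine ⟨fun k => ⟨?_, ?_, ?_⟩, fun χ hχ => exists_frame_of_map hA hI hI' hχ,
    fun q hq => exists_frame_of_hasimoto hI hq,
    fun ψ χ q h => h.exists_mapFlow_iff_exists_isospectralFlow hA hm n hI hI',
    fun ψ χ q h hd hψ => h.mapFlow_iff_isospectralFlow hA hm n hI hd hψ,
    mapFlow_iff_spinFlow hA hm n⟩
  · have h := isPrimitive_lax hA (Rop_iterate hA k)
    exact ⟨_, h, fun P' hP' q hq => h.eq hP' (fun _ _ _ => rfl) hq⟩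
  · have h := isHPrimitive_map hA (Rmap_iterate hA k)
    exact ⟨_, h, fun P' hP' γ hγ => h.eq hP' (fun _ _ _ => rfl) hγ⟩
  · have h := isHPrimitive_spin hA hm (Rspin_iterate hA hm k)
    exact ⟨_, h, fun P' hP' γ hγ => h.eq hP' (fun _ _ _ => rfl) hγ⟩
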